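/- **Theorem 2.** Every simple polygonal tree in $\mathbb R^4$ can be straightened, by an algorithm that runs in $O(n^2)$ time and $O(n)$ space and that accomplishes the straightening in $O(n)$ moves, where $n\ge 1$ is the number of segments of the tree. Here a *polygonal tree* is a finite tree whose vertices are placed at points of $\mathbb R^4$, each edge being the (nondegenerate) segment between the places of its ends; it is *simple* if two different segments meet only when they are adjacent, and then only in the endpoint that they share. The tree is rooted at one of its leaves $z$. Two segments are *coalesced* if, for some common proper ancestor $x$ of their lower ends, the two chains that lead from $x$ down to and including these segments are both straight and lie on one common ray from $x$. To *straighten* the tree is to move it continuously from the given configuration, for some choice of the leaf $z$, so that all segments keep their lengths; at all times any two different segments either satisfy the condition of simplicity or are coalesced, and two segments that violate the condition of simplicity at some time are coalesced from that time on (these are the noncrossing overlaps that are allowed); and at the end all segments, directed away from $z$, point in one and the same direction, so that the tree lies on a common line (indeed on a ray from the place of $z$) and all its paths from $z$ are straight. A *move* is one of the following motions, in which the angle of the rotation grows monotonically, at constant speed, from $0$ to some angle in $[0,\pi]$, and the plane of the rotation is fixed. Either, for an edge $ab$, the whole part of the tree beyond $a$ on the side of $b$ rotates rigidly about the joint $a$,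 parallel to a 2-plane, while the rest stands still; or, for edges $ab$ and $bc$ with $c\ne a$, the edges $ab$, $bc$ and all that lies beyond $c$ rotate rigidly in this way about $a$, the other branches at $b$ are carried along by translation, and the rest stands still. So at most two joints flex in a move. The *algorithm* is one fixed program for a real RAM: exact real arithmetic with $+,-,\times,/,\sqrt{\ }$ and comparisons at unit cost, finitely many arrays of real numbers and of natural numbers with computed indices, and no conversion of reals into integers. Its input consists of $n$, the list of the edges (in any order, as pairs of vertex numbers) and the coordinates of the vertices, and its output is the list of the moves. With a constant $C$ that does not depend on the tree, it halts after at most $Cn^2$ steps, writes only to array cells with index below $Cn$, writes no integer above $Cn$, and outputs at most $Cn$ moves, which, executed one after the other, straighten the tree. -/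

import Mathlib

/-- Euclidean 4-space. -/
abbrev E4 : Type := EuclideanSpace ℝ (Fin 4)

namespace TreeStraightening

noncomputable section

/-! ### Configurations of a tree in 4-space

The combinatorial tree is a `SimpleGraph V` that satisfies `SimpleGraph.IsTree`; a configuration
places its vertices in `E4`, and every edge is the segment between the places of its ends. -/

/-- Two edges `a b` and `c d` meet at most in the ends that they have in common: not at all if they
are not adjacent, and only in the shared end if they are. -/
def Clean {V : Type} (p : V → E4) (a b c d : V) : Prop :=
  segment ℝ (p a) (p b) ∩ segment ℝ (p c) (p d) ⊆ p '' (({a, b} : Set V) ∩ {c, d})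

/-- A simple configuration: edges are proper segments, and two different edges meet only if they
are adjacent, and then only in the end that they share. -/
def IsSimple {V : Type} (G : SimpleGraph V) (p : V → E4) : Prop :=
  (∀ a b, G.Adj a b → p a ≠ p b) ∧
  ∀ a b c d, G.Adj a b → G.Adj c d → s(a, b) ≠ s(c, d) → Clean p a b c d

/-- A leaf: a vertex with exactly one neighbour. -/
def IsLeaf {V : Type} (G : SimpleGraph V) (z : V) : Prop :=
  ∃! w, G.Adj z w

/-- In the tree `G` rooted at `z`, the vertex `x` lies on the path from `z` to `v`
(`x = z` and `x = v` are allowed). -/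
def Anc {V : Type} (G : SimpleGraph V) (z x v : V) : Prop :=
  G.dist z x + G.dist x v = G.dist z v

/-- In the tree `G` rooted at `z`, the vertex `u` is the parent of `v`. -/
def IsParent {V : Type} (G : SimpleGraph V) (z u v : V) : Prop :=
  G.Adj u v ∧ G.dist z v = G.dist z u + 1

/-- The segment from `p u` to `p v` points in the direction `d`. -/
def PointsAlong {V : Type} (p : V → E4) (d : E4) (u v : V) : Prop :=
  p v - p u = dist (p u) (p v) • d

/-- Root `G` at `z`. The edges that join `v₁` and `v₂` to their parents are coalesced: from some
common proper ancestor `x`, the chain down to `v₁` and the chain down to `v₂` are both straight,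
and lie on one common ray from `x`. -/
def Coalesced {V : Type} (G : SimpleGraph V) (z : V) (p : V → E4) (v₁ v₂ : V) : Prop :=
  ∃ (x : V) (d : E4), ‖d‖ = 1 ∧ Anc G z x v₁ ∧ x ≠ v₁ ∧ Anc G z x v₂ ∧ x ≠ v₂ ∧
    ∀ u v, IsParent G z u v → Anc G z x u → (Anc G z v v₁ ∨ Anc G z v v₂) → PointsAlong p d u v

/-- The whole tree is straightened: all edges, directed away from the root `z`, point in one and the
same direction. So the tree lies on a ray from the place of `z`, and every path from `z` is
straight. -/
def IsStraight {V : Type} (G : SimpleGraph V) (z : V) (p : V → E4) : Prop :=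
  ∃ d : E4, ‖d‖ = 1 ∧ ∀ u v, IsParent G z u v → PointsAlong p d u v

/-- `q t`, `0 ≤ t ≤ k`, is a continuous motion of the tree that keeps all edge lengths and has no
violation of simplicity except overlaps of coalesced edges; two edges that have come to overlap
stay coalesced ever after, so that no edge ever passes through another one. -/
structure IsReconfiguration {V : Type} (G : SimpleGraph V) (z : V) (k : ℝ) (q : ℝ → V → E4) :
    Prop where
  continuous : ∀ v, ContinuousOn (fun t => q t v) (Set.Icc 0 k)
  lengths : ∀ t ∈ Set.Icc 0 k, ∀ u v, G.Adj u v → dist (q t u) (q t v) = dist (q 0 u) (q 0 v)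
  noncrossing : ∀ t ∈ Set.Icc 0 k, ∀ u₁ v₁ u₂ v₂, IsParent G z u₁ v₁ → IsParent G z u₂ v₂ →
    v₁ ≠ v₂ → Clean (q t) u₁ v₁ u₂ v₂ ∨ Coalesced G z (q t) v₁ v₂
  permanent : ∀ s ∈ Set.Icc 0 k, ∀ t ∈ Set.Icc s k, ∀ u₁ v₁ u₂ v₂, IsParent G z u₁ v₁ →
    IsParent G z u₂ v₂ → v₁ ≠ v₂ → ¬ Clean (q s) u₁ v₁ u₂ v₂ → Coalesced G z (q t) v₁ v₂

/-! ### Moves -/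

/-- The data of a move: a joint `a`, a neighbour `b` of `a` that turns about `a`, a vertex `c` that
tells which part beyond `b` turns with the edge `a b` (see `Move.pos`), an orthonormal pair `e`, `f`
that spans the plane of the rotation, directed from `e` to `f`, and the cosine of its angle. -/
@[ext] structure Move (V : Type) where
  a : V
  b : V
  c : V
  e : E4
  f : E4
  cosAngle : ℝ

/-- Renaming of the vertices in a move. -/
def Move.rename {V W : Type} (g : V → W) (m : Move V) : Move W :=
  ⟨g m.a, g m.b, g m.c, m.e, m.f, m.cosAngle⟩

/-- The rotation by `θ` in the plane of the orthonormal pair `e`, `f` (it fixes the orthogonal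
complement of that plane). -/
def planeRot (e f : E4) (θ : ℝ) (x : E4) : E4 :=
  x + ((Real.cos θ - 1) * inner ℝ e x - Real.sin θ * inner ℝ f x) • e +
    (Real.sin θ * inner ℝ e x + (Real.cos θ - 1) * inner ℝ f x) • f

/-- In a tree with the edge `a b`: the vertex `v` lies on the side of `b`. -/
def Beyond {V : Type} (G : SimpleGraph V) (a b v : V) : Prop :=
  G.dist a v = G.dist b v + 1

/-- The data describe a move of the tree `G`. -/
def Move.Valid {V : Type} (G : SimpleGraph V) (m : Move V) : Prop :=
  G.Adj m.a m.b ∧ (m.c = m.b ∨ (G.Adj m.b m.c ∧ m.c ≠ m.a)) ∧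
  ‖m.e‖ = 1 ∧ ‖m.f‖ = 1 ∧ inner ℝ m.e m.f = 0 ∧ -1 ≤ m.cosAngle ∧ m.cosAngle ≤ 1

open Classical in
/-- The position of `v` at time `t ∈ [0, 1]` of the move `m` that starts from `p`. The angle grows
monotonically from `0` to `arccos m.cosAngle`. The part of the tree on the side of `a` is at rest.
* If `c = b`, all of the tree beyond `a` on the side of `b` turns rigidly about `a`.
* If `c` is a further neighbour of `b`, the edges `a b` and `b c` and all that lies beyond `c` turn
  rigidly about `a`, while the other branches at `b` are carried along by a translation. -/
def Move.pos {V : Type} (G : SimpleGraph V) (m : Move V) (p : V → E4) (t : ℝ) (v : V) : E4 :=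
  let R : E4 → E4 := planeRot m.e m.f (t * Real.arccos m.cosAngle)
  if ¬ Beyond G m.a m.b v then p v
  else if m.c = m.b ∨ Beyond G m.b m.c v then p m.a + R (p v - p m.a)
  else p v + (R (p m.b - p m.a) - (p m.b - p m.a))

/-- The moves, one after the other, straighten the tree `G` from the configuration `p`: some leaf
`z` is taken as the root, and the `i`-th move takes place in the time from `i` to `i + 1`. -/
def Straightens {V : Type} (G : SimpleGraph V) (p : V → E4) (moves : List (Move V)) : Prop :=
  ∃ z, IsLeaf G z ∧ ∃ q : ℝ → V → E4,
    q 0 = p ∧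
    IsReconfiguration G z moves.length q ∧
    (∀ (i : ℕ) (m : Move V), moves[i]? = some m →
      m.Valid G ∧ ∀ t ∈ Set.Icc (0 : ℝ) 1, q (i + t) = m.pos G (q i) t) ∧
    IsStraight G z (q moves.length)

/-! ### Algorithms: a real RAM

The memory consists of arrays of natural numbers and arrays of real numbers. A program refers to an
array by a number that is fixed in its text, so it has finitely many arrays, and to a cell of an
array by a computed index. Real arithmetic is exact, with `+ - * /`, square roots and comparisons;
there is no way from reals to integers. Programs are `while` programs, with an output that they can
only write to. -/

/-- Integer expressions; `get k i` is the content of cell `i` of the integer array `k`. -/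
inductive IExpr : Type
  | lit (k : ℕ)
  | get (k : ℕ) (i : IExpr)
  | add (x y : IExpr)
  | sub (x y : IExpr)

/-- Real expressions; `get k i` is the content of cell `i` of the real array `k`. -/
inductive RExpr : Type
  | zero
  | one
  | get (k : ℕ) (i : IExpr)
  | add (x y : RExpr)
  | sub (x y : RExpr)
  | mul (x y : RExpr)
  | div (x y : RExpr)
  | sqrt (x : RExpr)

/-- Tests. -/
inductive BExpr : Type
  | ilt (x y : IExpr)
  | rlt (x y : RExpr)
  | not (b : BExpr)
  | and (b b' : BExpr)

/-- Programs. -/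
inductive Cmd : Type
  | skip
  | setI (k : ℕ) (i : IExpr) (x : IExpr)
  | setR (k : ℕ) (i : IExpr) (x : RExpr)
  | emit (a b c : IExpr) (e f : Fin 4 → RExpr) (cosAngle : RExpr)
  | seq (s s' : Cmd)
  | ite (b : BExpr) (s s' : Cmd)
  | while (b : BExpr) (s : Cmd)

/-- Memory and output of the machine. -/
structure State where
  ints : ℕ → ℕ → ℕ
  reals : ℕ → ℕ → ℝ
  out : List (Move ℕ)

/-- Value of an integer expression (subtraction is truncated at `0`). -/
def IExpr.eval (σ : State) : IExpr → ℕ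
  | lit k => k
  | get k i => σ.ints k (i.eval σ)
  | add x y => x.eval σ + y.eval σ
  | sub x y => x.eval σ - y.eval σ

/-- Value of a real expression. -/
def RExpr.eval (σ : State) : RExpr → ℝ
  | zero => 0
  | one => 1
  | get k i => σ.reals k (i.eval σ)
  | add x y => x.eval σ + y.eval σ
  | sub x y => x.eval σ - y.eval σ
  | mul x y => x.eval σ * y.eval σ
  | div x y => x.eval σ / y.eval σ
  | sqrt x => Real.sqrt (x.eval σ)

/-- Truth of a test. -/
def BExpr.Holds (σ : State) : BExpr → Prop
  | ilt x y => x.eval σ < y.eval σ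
  | rlt x y => x.eval σ < y.eval σ
  | not b => ¬ b.Holds σ
  | and b b' => b.Holds σ ∧ b'.Holds σ

/-- Overwrite cell `i` of array `k`. -/
def update {α : Type} (mem : ℕ → ℕ → α) (k i : ℕ) (x : α) : ℕ → ℕ → α :=
  fun k' i' => if k' = k ∧ i' = i then x else mem k' i'

/-- The output of one move. -/
def emitted (σ : State) (a b c : IExpr) (e f : Fin 4 → RExpr) (cosAngle : RExpr) : Move ℕ where
  a := a.eval σ
  b := b.eval σ
  c := c.eval σ
  e := WithLp.toLp 2 fun j => (e j).eval σ
  f := WithLp.toLp 2 fun j => (f j).eval σ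
  cosAngle := cosAngle.eval σ

/-- `Exec S s σ T τ`: started in `σ`, the program `s` halts in `τ` after `T` steps, and in each of
its finitely many arrays writes only to cells with an index below `S`, and writes no integer above
`S` (the integers are words of `O(log S)` bits). An assignment, an output of a move and a test count
as one step; the expressions in them have a size that is fixed by the program. -/
inductive Exec (S : ℕ) : Cmd → State → ℕ → State → Prop
  | skip (σ : State) : Exec S .skip σ 1 σ
  | setI (σ : State) (k : ℕ) (i x : IExpr) (hi : i.eval σ < S) (hx : x.eval σ ≤ S) :
      Exec S (.setI k i x) σ 1 { σ with ints := update σ.ints k (i.eval σ) (x.eval σ) }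
  | setR (σ : State) (k : ℕ) (i : IExpr) (x : RExpr) (hi : i.eval σ < S) :
      Exec S (.setR k i x) σ 1 { σ with reals := update σ.reals k (i.eval σ) (x.eval σ) }
  | emit (σ : State) (a b c : IExpr) (e f : Fin 4 → RExpr) (cosAngle : RExpr) :
      Exec S (.emit a b c e f cosAngle) σ 1
        { σ with out := σ.out ++ [emitted σ a b c e f cosAngle] }
  | seq (s s' : Cmd) (σ τ υ : State) (T T' : ℕ) (h : Exec S s σ T τ) (h' : Exec S s' τ T' υ) :
      Exec S (.seq s s') σ (T + T') υ
  | ite_true (b : BExpr) (s s' : Cmd) (σ τ : State) (T : ℕ) (hb : b.Holds σ)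
      (h : Exec S s σ T τ) : Exec S (.ite b s s') σ (T + 1) τ
  | ite_false (b : BExpr) (s s' : Cmd) (σ τ : State) (T : ℕ) (hb : ¬ b.Holds σ)
      (h : Exec S s' σ T τ) : Exec S (.ite b s s') σ (T + 1) τ
  | while_true (b : BExpr) (s : Cmd) (σ τ υ : State) (T T' : ℕ) (hb : b.Holds σ)
      (h : Exec S s σ T τ) (h' : Exec S (.while b s) τ T' υ) :
      Exec S (.while b s) σ (T + T' + 1) υ
  | while_false (b : BExpr) (s : Cmd) (σ : State) (hb : ¬ b.Holds σ) :
      Exec S (.while b s) σ 1 σ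

/-- `edges` lists the `n` edges of `G`, in any order and each with its ends in any order. -/
def IsEdgeList {n : ℕ} (G : SimpleGraph (Fin (n + 1)))
    (edges : Fin n → Fin (n + 1) × Fin (n + 1)) : Prop :=
  ∀ u v, G.Adj u v ↔ ∃ i, edges i = (u, v) ∨ edges i = (v, u)

/-- The input: cell `0` of the integer array `0` holds the number `n` of edges, the integer arrays
`1` and `2` hold the first and the second ends of the edges, and the real arrays `0, 1, 2, 3` hold
the coordinates of the vertices. All other cells hold `0`. -/
def input {n : ℕ} (edges : Fin n → Fin (n + 1) × Fin (n + 1)) (p : Fin (n + 1) → E4) : State where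
  ints k i :=
    if k = 0 ∧ i = 0 then n
    else if h : i < n then
      if k = 1 then ((edges ⟨i, h⟩).1 : ℕ)
      else if k = 2 then ((edges ⟨i, h⟩).2 : ℕ)
      else 0
    else 0
  reals k i := if h : k < 4 ∧ i < n + 1 then p ⟨i, h.2⟩ ⟨k, h.1⟩ else 0
  out := []

end

end TreeStraightening

/-! Root the tree at a leaf, number the vertices so that parents precede children, and treat them
from the last number down to `1`. When the turn of `x` comes, all that hangs from each child of `x`
has been folded, together with the edge to that child, into a straight rod that starts at `x`. The
treatment turns every rod into the extension of the edge above `x`, so that this edge and all below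
it become one rod hanging from the parent of `x`. The set `K` records which edges extend their
parent edge, `top` finds the first edge of the chain so formed, and `Inv` says that edges with
different tops do not overlap. Edges with equal tops are coalesced, and enlarging `K` never
separates two tops (`top_top`).

Dimension four enters through one count. Seen from the joint, an edge and the old direction `s` of a
turning rod span at most three dimensions, so some direction `w` avoids this span. A rotation from
`s` to `w` then meets the edge at no positive time, because the coefficient of `w` in the moving
direction is positive (`planeRot_turn_mid`). The reverse passage, from a general direction to a
special one, is safe until the last instant (`planeRot_turn_start`).

At the last instant the extension of the edge above `x` must be free. Therefore the rods at `x` are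
first put in general position, with a linear clearance from all edges outside the broom
(`le_norm_sub_of_ball`); next the edge above `x` with its rods turns rigidly by an angle so small
that the rods hit nothing, to a direction in which its extension is free (`Inv.isStep_broom`,
`free_of_turnTo`); finally each rod goes to a general direction and from there into the extension
(`Inv.isStep_align`). That is one move for each vertex and three for each child relation, at most `4
* n` in all.

General directions are computed by keeping a ball and pushing it, edge by edge, off a hyperplane
that contains the forbidden span (`does_pick`). One such search is linear in `n`, as is the update
of the positions after a rotation (`does_rotate`), and boundedly many of them are charged to each
vertex, which gives quadratic time. The numbering is found by repeated scans of the edge list. It is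
computed twice, since the last vertex of any such numbering is a leaf and can serve as the root of
the second one. -/

namespace TreeStraightening

noncomputable section

/-! ### Linear geometry -/

/-- The unit vector in the direction of `y`; it is `0` if `y = 0`. -/
def dirVec (y : E4) : E4 := ‖y‖⁻¹ • y

/-- The component of `y` orthogonal to `d`. -/
def rej (d y : E4) : E4 := y - (inner ℝ d y / inner ℝ d d) • d

/-- A vector orthogonal to `s`, `A` and `B`, made from `y`. -/
def normalTo (s A B y : E4) : E4 :=
  rej (rej (rej s A) (rej s B)) (rej (rej s A) (rej s y))

theorem norm_dirVec {y : E4} (h : y ≠ 0) : ‖dirVec y‖ = 1 := by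
  rw [dirVec, norm_smul, norm_inv, norm_norm, inv_mul_cancel₀ (norm_ne_zero_iff.2 h)]

theorem norm_smul_dirVec (y : E4) : ‖y‖ • dirVec y = y := by
  rcases eq_or_ne y 0 with rfl | h
  · simp
  · rw [dirVec, smul_smul, mul_inv_cancel₀ (norm_ne_zero_iff.2 h), one_smul]

theorem inner_rej_self (d y : E4) : inner ℝ d (rej d y) = 0 := by
  rcases eq_or_ne d 0 with rfl | h
  · simp
  · have : inner ℝ d d ≠ 0 := inner_self_ne_zero.2 h
    rw [rej, inner_sub_right, inner_smul_right, div_mul_cancel₀ _ this, sub_self]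

theorem inner_rej_of_orth {c d : E4} (h : inner ℝ c d = 0) (y : E4) :
    inner ℝ c (rej d y) = inner ℝ c y := by
  rw [rej, inner_sub_right, inner_smul_right, h, mul_zero, sub_zero]

theorem eq_rej_add (d y : E4) : y = rej d y + (inner ℝ d y / inner ℝ d d) • d := by
  simp [rej]

theorem rej_mem {U : Submodule ℝ E4} {d y : E4} (hd : d ∈ U) : rej d y ∈ U ↔ y ∈ U := by
  rw [rej]
  exact Submodule.sub_mem_iff_left U (U.smul_mem _ hd)

/-- This is Gram–Schmidt: the vector is `y` with its components along `s`, `rej s A` and `rej (rej s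
A) (rej s B)` removed in turn. Linear dependence does no harm, because division by zero yields zero
and `rej 0` is the identity. -/
theorem inner_normalTo {s A B : E4} (y : E4) {u : E4}
    (hu : u ∈ Submodule.span ℝ ({s, A, B} : Set E4)) : inner ℝ (normalTo s A B y) u = 0 := by
  have h1 : inner ℝ s (rej s A) = 0 := inner_rej_self _ _
  have h2 : inner ℝ s (rej (rej s A) (rej s B)) = 0 := by
    rw [inner_rej_of_orth h1, inner_rej_self]
  have h3 : inner ℝ (rej s A) (rej (rej s A) (rej s B)) = 0 := inner_rej_self _ _
  have hs : inner ℝ s (normalTo s A B y) = 0 := by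
    rw [normalTo, inner_rej_of_orth h2, inner_rej_of_orth h1, inner_rej_self]
  have hA' : inner ℝ (rej s A) (normalTo s A B y) = 0 := by
    rw [normalTo, inner_rej_of_orth h3, inner_rej_self]
  have hA : inner ℝ A (normalTo s A B y) = 0 := by
    have := congrArg (fun z => inner ℝ z (normalTo s A B y)) (eq_rej_add s A)
    simpa only [inner_add_left, real_inner_smul_left, hs, hA', mul_zero, add_zero] using this
  have hB'' : inner ℝ (rej (rej s A) (rej s B)) (normalTo s A B y) = 0 := inner_rej_self _ _
  have hB' : inner ℝ (rej s B) (normalTo s A B y) = 0 := by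
    have := congrArg (fun z => inner ℝ z (normalTo s A B y)) (eq_rej_add (rej s A) (rej s B))
    simpa only [inner_add_left, real_inner_smul_left, hA', hB'', mul_zero, add_zero] using this
  have hB : inner ℝ B (normalTo s A B y) = 0 := by
    have := congrArg (fun z => inner ℝ z (normalTo s A B y)) (eq_rej_add s B)
    simpa only [inner_add_left, real_inner_smul_left, hs, hB', mul_zero, add_zero] using this
  rw [real_inner_comm]
  induction hu using Submodule.span_induction with
  | mem x hx =>
    rcases hx with rfl | rfl | rfl
    exacts [hs, hA, hB]
  | zero => simp
  | add x y _ _ hx hy => rw [inner_add_left, hx, hy, add_zero]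
  | smul a x _ hx => rw [inner_smul_left, hx, mul_zero]

/-- The only place where dimension four is used: were all four normals zero, the span of three
vectors would contain the standard basis. -/
theorem exists_normalTo_ne_zero (s A B : E4) :
    ∃ j : Fin 4, normalTo s A B (EuclideanSpace.single j 1) ≠ 0 := by
  by_contra! h
  set U := Submodule.span ℝ ({s, A, B} : Set E4) with hU
  have hs : s ∈ U := Submodule.subset_span (by simp)
  have hA : rej s A ∈ U := (rej_mem hs).2 (Submodule.subset_span (by simp))
  have hB : rej (rej s A) (rej s B) ∈ U :=
    (rej_mem hA).2 ((rej_mem hs).2 (Submodule.subset_span (by simp)))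
  -- Each projection subtracts a multiple of a vector of `U`, so membership in `U` can be traced
  -- back through all three.
  have hj : ∀ j : Fin 4, EuclideanSpace.single j (1 : ℝ) ∈ U := fun j => by
    have h0 : normalTo s A B (EuclideanSpace.single j 1) ∈ U := by
      rw [h j]; exact U.zero_mem
    exact (rej_mem hs).1 ((rej_mem hA).1 ((rej_mem hB).1 h0))
  have htop : U = ⊤ := by
    rw [eq_top_iff, ← (EuclideanSpace.basisFun (Fin 4) ℝ).toBasis.span_eq, Submodule.span_le]
    rintro _ ⟨j, rfl⟩
    simpa using hj j
  have h1 : Module.finrank ℝ U = 4 := by rw [htop, finrank_top]; simp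
  have h2 : Module.finrank ℝ U ≤ 3 := by
    classical
    have := finrank_span_finset_le_card (R := ℝ) ({s, A, B} : Finset E4)
    have h3 := Finset.card_le_three (a := s) (b := A) (c := B)
    simp only [Finset.coe_insert, Finset.coe_singleton] at this
    exact this.trans h3
  omega

/-- One step of the search for a vector in general position: move `w` away from the hyperplane
orthogonal to `h`. -/
def pushOff (h w : E4) (δ : ℝ) : E4 :=
  if |inner ℝ w h| < δ / 4 then w + (δ / 2) • h else w

/-- The centre moves by at most `δ / 2`, and `δ / 2 + δ / 8 ≤ δ`. The norm of `h` is only bounded by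
one, so that the zero normals of degenerate cases are admitted. -/
theorem ball_pushOff_subset {h w : E4} {δ : ℝ} (hh : ‖h‖ ≤ 1) (hδ : 0 < δ) :
    Metric.ball (pushOff h w δ) (δ / 8) ⊆ Metric.ball w δ := by
  apply Metric.ball_subset_ball'
  have : dist (pushOff h w δ) w ≤ δ / 2 := by
    rw [pushOff]
    split_ifs
    · rw [dist_eq_norm, add_sub_cancel_left, norm_smul, Real.norm_of_nonneg (by positivity)]
      nlinarith
    · rw [dist_self]; positivity
  linarith

/-- The new centre is at distance at least `δ / 4` from the hyperplane: either it was so before, or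
it lay within `δ / 4` and was moved by `δ / 2` along the normal. The new radius `δ / 8` is smaller.
-/
theorem inner_ne_zero_of_mem_ball_pushOff {h w y : E4} {δ : ℝ} (hh : ‖h‖ = 1)
    (hy : y ∈ Metric.ball (pushOff h w δ) (δ / 8)) : inner ℝ h y ≠ 0 := by
  intro h0
  rw [Metric.mem_ball, dist_eq_norm] at hy
  have hδ : 0 < δ := by have := norm_nonneg (y - pushOff h w δ); linarith
  have h1 : |inner ℝ (pushOff h w δ) h| ≤ ‖y - pushOff h w δ‖ := by
    have := abs_real_inner_le_norm (y - pushOff h w δ) h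
    rw [inner_sub_left, real_inner_comm, h0, zero_sub, abs_neg, hh, mul_one] at this
    exact this
  have h2 : δ / 4 ≤ |inner ℝ (pushOff h w δ) h| := by
    rw [pushOff]
    split_ifs with hc
    · rw [inner_add_left, inner_smul_left, real_inner_self_eq_norm_sq, hh]
      rw [abs_lt] at hc
      refine le_trans ?_ (le_abs_self _)
      simp
      linarith
    · exact not_lt.1 hc
  linarith

/-! ### Plane rotations -/

theorem planeRot_zero (e f x : E4) : planeRot e f 0 x = x := by simp [planeRot]

theorem planeRot_add (e f : E4) (θ : ℝ) (x y : E4) :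
    planeRot e f θ (x + y) = planeRot e f θ x + planeRot e f θ y := by
  simp only [planeRot, inner_add_right]
  module

theorem planeRot_smul (e f : E4) (θ r : ℝ) (x : E4) :
    planeRot e f θ (r • x) = r • planeRot e f θ x := by
  simp only [planeRot, inner_smul_right]
  module

theorem continuous_planeRot (e f x : E4) : Continuous fun θ => planeRot e f θ x := by
  unfold planeRot
  fun_prop

section Orthonormal

set_option linter.unusedSectionVars false

variable {e f : E4} (he : ‖e‖ = 1) (hf : ‖f‖ = 1) (hef : inner ℝ e f = 0)
include he hf hef

theorem norm_planeRot_sub_sq (θ : ℝ) (x : E4) : ‖planeRot e f θ x - x‖ ^ 2 =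
    2 * (1 - Real.cos θ) * (inner ℝ e x ^ 2 + inner ℝ f x ^ 2) := by
  have h1 : inner ℝ e e = 1 := by rw [real_inner_self_eq_norm_sq, he]; norm_num
  have h2 : inner ℝ f f = 1 := by rw [real_inner_self_eq_norm_sq, hf]; norm_num
  have h3 : inner ℝ f e = 0 := by rw [real_inner_comm, hef]
  have hs := Real.sin_sq_add_cos_sq θ
  rw [← real_inner_self_eq_norm_sq, planeRot, add_assoc, add_sub_cancel_left]
  simp only [inner_add_left, inner_add_right, real_inner_smul_left, real_inner_smul_right, h1, h2,
    h3, hef]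
  linear_combination (inner ℝ e x ^ 2 + inner ℝ f x ^ 2) * hs

theorem norm_planeRot (θ : ℝ) (x : E4) : ‖planeRot e f θ x‖ = ‖x‖ := by
  have h := norm_planeRot_sub_sq he hf hef θ x
  have h1 : inner ℝ (planeRot e f θ x) x =
      ‖x‖ ^ 2 + (Real.cos θ - 1) * (inner ℝ e x ^ 2 + inner ℝ f x ^ 2) := by
    rw [planeRot, inner_add_left, inner_add_left, real_inner_smul_left, real_inner_smul_left,
      real_inner_self_eq_norm_sq]
    ring
  rw [norm_sub_sq_real, h1] at h
  have : ‖planeRot e f θ x‖ ^ 2 = ‖x‖ ^ 2 := by linarith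
  exact (pow_left_inj₀ (norm_nonneg _) (norm_nonneg _) two_ne_zero).1 this

theorem planeRot_self (θ : ℝ) : planeRot e f θ e = Real.cos θ • e + Real.sin θ • f := by
  have h1 : inner ℝ e e = 1 := by rw [real_inner_self_eq_norm_sq, he]; norm_num
  rw [planeRot, h1, real_inner_comm, hef]
  module

/-- Only the component in the plane is displaced, and the displacement grows with the angle up to
`π`. Hence the final displacement of the unit vector `e` controls every vector at every earlier
time; this bounds how far a slightly turned broom can travel. -/
theorem norm_planeRot_sub_le {θ φ : ℝ} (h0 : 0 ≤ φ) (h : φ ≤ θ) (hπ : θ ≤ Real.pi) (y : E4) :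
    ‖planeRot e f φ y - y‖ ≤ ‖planeRot e f θ e - e‖ * ‖y‖ := by
  have h1 : inner ℝ e e = 1 := by rw [real_inner_self_eq_norm_sq, he]; norm_num
  have h3 : inner ℝ f e = 0 := by rw [real_inner_comm, hef]
  have hc : Real.cos θ ≤ Real.cos φ := Real.cos_le_cos_of_nonneg_of_le_pi h0 hπ h
  -- Bessel's inequality for the orthonormal pair `e`, `f`.
  have hb : inner ℝ e y ^ 2 + inner ℝ f y ^ 2 ≤ ‖y‖ ^ 2 := by
    have h2 : 0 ≤ inner ℝ (y - inner ℝ e y • e - inner ℝ f y • f)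
      (y - inner ℝ e y • e - inner ℝ f y • f) := real_inner_self_nonneg
    have h4 : inner ℝ y e = inner ℝ e y := real_inner_comm _ _
    have h5 : inner ℝ f f = 1 := by rw [real_inner_self_eq_norm_sq, hf]; norm_num
    have h6 : inner ℝ y f = inner ℝ f y := real_inner_comm _ _
    have h7 : inner ℝ y y = ‖y‖ ^ 2 := real_inner_self_eq_norm_sq _
    simp only [inner_sub_left, inner_sub_right, real_inner_smul_left, real_inner_smul_right, h1,
      h5, h3, hef, h4, h6, h7] at h2
    nlinarith
  apply le_of_sq_le_sq _ (by positivity)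
  rw [mul_pow, norm_planeRot_sub_sq he hf hef, norm_planeRot_sub_sq he hf hef, h1, h3]
  have : 0 ≤ 1 - Real.cos φ := by linarith [Real.cos_le_one φ]
  nlinarith [Real.cos_le_one θ, sq_nonneg ‖y‖]

end Orthonormal

/-- The data of the rotation that turns `s` to the direction of `w`. -/
def turnE (s : E4) : E4 := dirVec s
/-- See `turnE`. -/
def turnF (s w : E4) : E4 := dirVec (rej s w)
/-- See `turnE`. -/
def turnCos (s w : E4) : ℝ := inner ℝ (dirVec s) (dirVec w)

/-! ### Turning one direction into another -/

section Turn

set_option linter.unusedSectionVars false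

variable {s w : E4} (hs : s ≠ 0) (hw : w ∉ Submodule.span ℝ ({s} : Set E4))
include hs hw

theorem ne_zero_of_notMem_span : w ≠ 0 := by
  rintro rfl; exact hw (Submodule.zero_mem _)

theorem rej_ne_zero : rej s w ≠ 0 := by
  intro h
  apply hw
  rw [eq_rej_add s w, h, zero_add]
  exact Submodule.smul_mem _ _ (Submodule.mem_span_singleton_self s)

theorem norm_turnE : ‖turnE s‖ = 1 := norm_dirVec hs

theorem norm_turnF : ‖turnF s w‖ = 1 := norm_dirVec (rej_ne_zero hs hw)

theorem inner_turn : inner ℝ (turnE s) (turnF s w) = 0 := by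
  rw [turnE, turnF, dirVec, dirVec, real_inner_smul_left, real_inner_smul_right, inner_rej_self]
  simp

theorem turnCos_mem : -1 ≤ turnCos s w ∧ turnCos s w ≤ 1 := by
  have := abs_real_inner_le_norm (dirVec s) (dirVec w)
  rw [norm_dirVec hs, norm_dirVec (ne_zero_of_notMem_span hs hw), mul_one, abs_le] at this
  exact this

theorem dirVec_eq_turn : dirVec w = turnCos s w • turnE s + (‖w‖⁻¹ * ‖rej s w‖) • turnF s w := by
  have h1 : w = rej s w + inner ℝ (turnE s) w • turnE s := by
    conv_lhs => rw [eq_rej_add s w]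
    congr 1
    rw [turnE, dirVec, smul_smul, real_inner_smul_left, real_inner_self_eq_norm_sq]
    congr 1
    have := norm_ne_zero_iff.2 hs
    field_simp
  have h2 : turnCos s w = ‖w‖⁻¹ * inner ℝ (turnE s) w := by
    rw [turnCos, turnE, dirVec, dirVec, real_inner_smul_right]
  rw [h2, mul_smul, mul_smul, turnF, norm_smul_dirVec, ← smul_add, add_comm, ← h1, dirVec]

theorem sin_arccos_turnCos : Real.sin (Real.arccos (turnCos s w)) = ‖w‖⁻¹ * ‖rej s w‖ := by
  rw [Real.sin_arccos]
  have h1 := norm_turnE hs hw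
  have h2 := norm_turnF hs hw
  have h3 := inner_turn hs hw
  have h : ‖dirVec w‖ ^ 2 = turnCos s w ^ 2 + (‖w‖⁻¹ * ‖rej s w‖) ^ 2 := by
    conv_lhs => rw [dirVec_eq_turn hs hw]
    rw [norm_add_sq_real, norm_smul, norm_smul, h1, h2, real_inner_smul_left,
      real_inner_smul_right, h3, mul_one, mul_one, Real.norm_eq_abs, Real.norm_eq_abs, sq_abs,
      sq_abs]
    ring
  rw [norm_dirVec (ne_zero_of_notMem_span hs hw)] at h
  rw [show 1 - turnCos s w ^ 2 = (‖w‖⁻¹ * ‖rej s w‖) ^ 2 by linarith]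
  exact Real.sqrt_sq (by positivity)

theorem planeRot_turn_end :
    planeRot (turnE s) (turnF s w) (Real.arccos (turnCos s w)) (turnE s) = dirVec w := by
  rw [planeRot_self (norm_turnE hs hw) (norm_turnF hs hw) (inner_turn hs hw),
    Real.cos_arccos (turnCos_mem hs hw).1 (turnCos_mem hs hw).2, sin_arccos_turnCos hs hw,
    ← dirVec_eq_turn hs hw]

theorem arccos_turnCos_lt_pi : Real.arccos (turnCos s w) < Real.pi := by
  have h0 : 0 < Real.sin (Real.arccos (turnCos s w)) := by
    rw [sin_arccos_turnCos hs hw]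
    have := norm_pos_iff.2 (ne_zero_of_notMem_span hs hw)
    have := norm_pos_iff.2 (rej_ne_zero hs hw)
    positivity
  refine lt_of_le_of_ne (Real.arccos_le_pi _) fun h => ?_
  rw [h, Real.sin_pi] at h0
  exact lt_irrefl _ h0

theorem arccos_turnCos_pos : 0 < Real.arccos (turnCos s w) := by
  have h0 : 0 < Real.sin (Real.arccos (turnCos s w)) := by
    rw [sin_arccos_turnCos hs hw]
    have := norm_pos_iff.2 (ne_zero_of_notMem_span hs hw)
    have := norm_pos_iff.2 (rej_ne_zero hs hw)
    positivity
  refine lt_of_le_of_ne (Real.arccos_nonneg _) fun h => ?_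
  rw [← h, Real.sin_zero] at h0
  exact lt_irrefl _ h0

/-- The angle lies strictly between `0` and `π`, so its sine is positive. With `β ≠ 0`, a subspace
that contains `s` but not `w` is avoided as soon as the motion has begun. -/
theorem planeRot_turn_mid {t : ℝ} (h0 : 0 < t) (h1 : t ≤ 1) : ∃ α β : ℝ, 0 < β ∧
    planeRot (turnE s) (turnF s w) (t * Real.arccos (turnCos s w)) (turnE s) = α • s + β • w := by
  set θ := Real.arccos (turnCos s w) with hθ
  have hθ0 : 0 < θ := arccos_turnCos_pos hs hw
  have hθπ : θ < Real.pi := arccos_turnCos_lt_pi hs hw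
  have hsin : 0 < Real.sin (t * θ) :=
    Real.sin_pos_of_pos_of_lt_pi (by positivity) (by nlinarith)
  have hr := norm_pos_iff.2 (rej_ne_zero hs hw)
  refine ⟨Real.cos (t * θ) * ‖s‖⁻¹ - Real.sin (t * θ) * ‖rej s w‖⁻¹ *
    (inner ℝ s w / inner ℝ s s), Real.sin (t * θ) * ‖rej s w‖⁻¹, by positivity, ?_⟩
  rw [planeRot_self (norm_turnE hs hw) (norm_turnF hs hw) (inner_turn hs hw), turnE, turnF,
    dirVec, dirVec]
  set r := ‖rej s w‖⁻¹
  rw [rej]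
  module

/-- The mirror image of `planeRot_turn_mid`: a subspace that contains `w` but not `s` is avoided
until just before the end. -/
theorem planeRot_turn_start {t : ℝ} (h0 : 0 ≤ t) (h1 : t < 1) : ∃ α β : ℝ, 0 < α ∧
    planeRot (turnE s) (turnF s w) (t * Real.arccos (turnCos s w)) (turnE s) = α • s + β • w := by
  set θ := Real.arccos (turnCos s w) with hθ
  have hθ0 : 0 < θ := arccos_turnCos_pos hs hw
  have hθπ : θ < Real.pi := arccos_turnCos_lt_pi hs hw
  have hsin : 0 < Real.sin (θ - t * θ) :=
    Real.sin_pos_of_pos_of_lt_pi (by nlinarith) (by nlinarith)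
  have hsin' : 0 < Real.sin θ := Real.sin_pos_of_pos_of_lt_pi hθ0 hθπ
  have hs' := norm_pos_iff.2 hs
  have hw' := norm_pos_iff.2 (ne_zero_of_notMem_span hs hw)
  -- Spherical linear interpolation between the unit vectors along `s` and `w`.
  refine ⟨Real.sin (θ - t * θ) / Real.sin θ * ‖s‖⁻¹, Real.sin (t * θ) / Real.sin θ * ‖w‖⁻¹,
    by positivity, ?_⟩
  have key : dirVec w = Real.cos θ • turnE s + Real.sin θ • turnF s w := by
    rw [← planeRot_turn_end hs hw, planeRot_self (norm_turnE hs hw) (norm_turnF hs hw)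
      (inner_turn hs hw)]
  rw [planeRot_self (norm_turnE hs hw) (norm_turnF hs hw) (inner_turn hs hw), mul_smul, mul_smul]
  change _ = _ • turnE s + _ • dirVec w
  rw [key, Real.sin_sub, smul_add, smul_smul, smul_smul, ← add_assoc, ← add_smul]
  congr 2
  · field_simp
    ring
  · field_simp

end Turn

/-- Half the excess in the triangle inequality bounds the distance of `0` to a segment. -/
theorem excess_le_norm {A B X : E4} (h : X ∈ segment ℝ A B) :
    (‖A‖ + ‖B‖ - ‖A - B‖) / 2 ≤ ‖X‖ := by
  have h1 : dist A X + dist X B = dist A B := (mem_segment_iff_wbtw.1 h).dist_add_dist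
  rw [dist_eq_norm, dist_eq_norm, dist_eq_norm] at h1
  have h2 : ‖A‖ ≤ ‖A - X‖ + ‖X‖ := by simpa using norm_add_le (A - X) X
  have h3 : ‖B‖ ≤ ‖X - B‖ + ‖X‖ := by
    rw [norm_sub_rev]; simpa using norm_add_le (B - X) X
  linarith

/-- By strict convexity, equality in the triangle inequality would put `0` on the segment. -/
theorem excess_pos {A B : E4} (h : (0 : E4) ∉ segment ℝ A B) :
    0 < (‖A‖ + ‖B‖ - ‖A - B‖) / 2 := by
  have h1 : dist A B ≤ dist A 0 + dist 0 B := dist_triangle _ _ _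
  have h2 : dist A 0 + dist 0 B ≠ dist A B := fun h' =>
    h (mem_segment_iff_wbtw.2 (dist_add_dist_eq_iff.1 h'))
  rw [dist_zero_right, dist_zero_left, dist_eq_norm] at h1 h2
  have := lt_of_le_of_ne h1 h2.symm
  linarith

theorem segment_sub_mem {x a b X : E4} (h : X ∈ segment ℝ a b) :
    X - x ∈ segment ℝ (a - x) (b - x) := by
  obtain ⟨r, q, hr, hq, hrq, rfl⟩ := h
  refine ⟨r, q, hr, hq, hrq, ?_⟩
  have : x = (r + q) • x := by rw [hrq, one_smul]
  conv_rhs => rw [this]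
  module

theorem mem_span_of_mem_segment {A B X : E4} {T : Set E4} (hA : A ∈ T) (hB : B ∈ T)
    (h : X ∈ segment ℝ A B) : X ∈ Submodule.span ℝ T := by
  obtain ⟨r, q, -, -, -, rfl⟩ := h
  exact Submodule.add_mem _ (Submodule.smul_mem _ _ (Submodule.subset_span hA))
    (Submodule.smul_mem _ _ (Submodule.subset_span hB))

/-! ### Trees given by a parent map, and aligned vertices -/

/-- The vertices are numbered so that every vertex comes after its parent; `0` is the root. -/
structure IsParentMap (par : ℕ → ℕ) : Prop where
  lt : ∀ v, 0 < v → par v < v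
  zero : par 0 = 0

/-- `v` is `b` or a descendant of `b`. -/
def Desc (par : ℕ → ℕ) (b v : ℕ) : Prop := ∃ k, par^[k] v = b

theorem Desc.refl (par : ℕ → ℕ) (b : ℕ) : Desc par b b := ⟨0, rfl⟩

theorem Desc.of_par {par : ℕ → ℕ} {b v : ℕ} (h : Desc par b (par v)) : Desc par b v := by
  obtain ⟨k, hk⟩ := h
  exact ⟨k + 1, hk⟩

theorem Desc.eq_or_par {par : ℕ → ℕ} {b v : ℕ} (h : Desc par b v) : v = b ∨ Desc par b (par v) := by
  obtain ⟨k, hk⟩ := h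
  cases k with
  | zero => exact Or.inl hk
  | succ k => exact Or.inr ⟨k, hk⟩

theorem desc_iff {par : ℕ → ℕ} {b v : ℕ} : Desc par b v ↔ v = b ∨ Desc par b (par v) :=
  ⟨Desc.eq_or_par, fun h => h.elim (fun h => h ▸ Desc.refl _ _) Desc.of_par⟩

theorem Desc.trans {par : ℕ → ℕ} {a b v : ℕ} (h : Desc par a b) (h' : Desc par b v) :
    Desc par a v := by
  obtain ⟨k, rfl⟩ := h'
  obtain ⟨l, rfl⟩ := h
  exact ⟨l + k, Function.iterate_add_apply _ _ _ _⟩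

theorem Desc.comparable {par : ℕ → ℕ} {a b v : ℕ} (ha : Desc par a v) (hb : Desc par b v) :
    Desc par a b ∨ Desc par b a := by
  obtain ⟨k, rfl⟩ := ha
  obtain ⟨l, rfl⟩ := hb
  rcases le_total k l with h | h
  · right
    exact ⟨l - k, by rw [← Function.iterate_add_apply, Nat.sub_add_cancel h]⟩
  · left
    exact ⟨k - l, by rw [← Function.iterate_add_apply, Nat.sub_add_cancel h]⟩

/-! ### Order properties of a parent map -/

section

variable {par : ℕ → ℕ} (hp : IsParentMap par)
include hp

theorem IsParentMap.le (v : ℕ) : par v ≤ v := by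
  rcases Nat.eq_zero_or_pos v with rfl | h
  · exact hp.zero.le
  · exact (hp.lt v h).le

theorem IsParentMap.pos_of_pos {v : ℕ} (h : 0 < par v) : 0 < v := h.trans_le (hp.le v)

theorem Desc.le {b v : ℕ} (h : Desc par b v) : b ≤ v := by
  obtain ⟨k, rfl⟩ := h
  induction k generalizing v with
  | zero => exact le_rfl
  | succ k ih => exact ih.trans (hp.le v)

theorem Desc.le_par {b v : ℕ} (h : Desc par b v) (hv : v ≠ b) : b ≤ par v :=
  ((desc_iff.1 h).resolve_left hv).le hp

theorem Desc.zero (v : ℕ) : Desc par 0 v := by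
  induction v using Nat.strong_induction_on with
  | _ v ih =>
    rcases Nat.eq_zero_or_pos v with rfl | h
    · exact Desc.refl _ _
    · exact (ih _ (hp.lt v h)).of_par

theorem not_desc_par {b : ℕ} (hb : 0 < b) : ¬ Desc par b (par b) := fun h =>
  (h.le hp).not_gt (hp.lt b hb)

/-- Below a proper ancestor, one is below one of its children. -/
theorem Desc.exists_child {x v : ℕ} (h : Desc par x v) (hv : v ≠ x) :
    ∃ c, par c = x ∧ Desc par c v ∧ x < c := by
  induction v using Nat.strong_induction_on with
  | _ v ih =>
    have hv0 : 0 < v := by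
      rcases Nat.eq_zero_or_pos v with rfl | h0
      · exact absurd (Nat.le_zero.1 (h.le hp)).symm hv
      · exact h0
    have h1 := (desc_iff.1 h).resolve_left hv
    by_cases hx : par v = x
    · exact ⟨v, hx, Desc.refl _ _, hx ▸ hp.lt v hv0⟩
    · obtain ⟨c, hc, hcv, hxc⟩ := ih _ (hp.lt v hv0) h1 hx
      exact ⟨c, hc, hcv.of_par, hxc⟩

end

open Classical in
/-- The top edge of the maximal straight chain of aligned edges in which the edge above `v` lies. -/
def top (par : ℕ → ℕ) (K : Set ℕ) (v : ℕ) : ℕ :=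
  if v ∈ K ∧ par v < v then top par K (par v) else v
termination_by v
decreasing_by simp_all

/-- Only edges that do not start from the root can be aligned. -/
def IsAligned (par : ℕ → ℕ) (K : Set ℕ) : Prop := ∀ v ∈ K, 0 < par v

/-! ### Tops of chains of aligned edges -/

section

variable {par : ℕ → ℕ} (hp : IsParentMap par) {K : Set ℕ} (hK : IsAligned par K)

theorem top_of_notMem {v : ℕ} (h : v ∉ K) : top par K v = v := by
  rw [top, if_neg (fun h' => h h'.1)]

include hp hK

/-- The guard `par v < v` in `top` only secures termination; it holds for aligned vertices, since
their parents are positive. -/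
theorem top_of_mem {v : ℕ} (h : v ∈ K) : top par K v = top par K (par v) := by
  rw [top, if_pos ⟨h, hp.lt v (hp.pos_of_pos (hK v h))⟩]

theorem top_induction {motive : ℕ → Prop} (base : ∀ v, v ∉ K → motive v)
    (step : ∀ v, v ∈ K → motive (par v) → motive v) (v : ℕ) : motive v := by
  induction v using Nat.strong_induction_on with
  | _ v ih =>
    by_cases h : v ∈ K
    · exact step v h (ih _ (hp.lt v (hp.pos_of_pos (hK v h))))
    · exact base v h

theorem desc_top (v : ℕ) : Desc par (top par K v) v := by
  induction v using top_induction hp hK with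
  | base v h => rw [top_of_notMem h]; exact Desc.refl _ _
  | step v h ih => rw [top_of_mem hp hK h]; exact ih.of_par

theorem top_pos {v : ℕ} (hv : 0 < v) : 0 < top par K v := by
  induction v using top_induction hp hK with
  | base v h => rwa [top_of_notMem h]
  | step v h ih => rw [top_of_mem hp hK h]; exact ih (hK v h)

/-- Climbing with the larger set can start from where the climb with the smaller set stops. Hence
edges that share a chain keep sharing one when more edges become aligned, which is the permanence of
coalescence. -/
theorem top_top {K' : Set ℕ} (hK' : IsAligned par K') (h : K ⊆ K') (v : ℕ) :
    top par K' (top par K v) = top par K' v := by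
  induction v using top_induction hp hK with
  | base v h => rw [top_of_notMem h]
  | step v h' ih => rw [top_of_mem hp hK h', ih, top_of_mem hp hK' (h h')]

/-- An unaligned `b` blocks the climb, so a chain that starts below `b` does not leave the subtree
of `b`. -/
theorem Desc.top {b v : ℕ} (hb : b ∉ K) (h : Desc par b v) : Desc par b (top par K v) := by
  induction v using top_induction hp hK with
  | base v h' => rwa [top_of_notMem h']
  | step v h' ih =>
    rw [top_of_mem hp hK h']
    exact ih ((desc_iff.1 h).resolve_left fun e => hb (e ▸ h'))

theorem top_ne_top {b v v' : ℕ} (hb : b ∉ K) (h : Desc par b v) (h' : ¬ Desc par b v') :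
    top par K v ≠ top par K v' := fun e =>
  h' ((e ▸ h.top hp hK hb).trans (desc_top hp hK v'))

/-- If everything strictly between `b` and `v` and `v` itself is aligned, then `b` and `v` have the
same top. -/
theorem top_eq_of_desc {b v : ℕ} (h : Desc par b v)
    (hbelow : ∀ u, Desc par b u → u ≤ v → u ≠ b → u ∈ K) : top par K v = top par K b := by
  induction v using Nat.strong_induction_on with
  | _ v ih =>
    rcases eq_or_ne v b with rfl | hv
    · rfl
    · have hvK := hbelow v h le_rfl hv
      have hlt := hp.lt v (hp.pos_of_pos (hK v hvK))
      rw [top_of_mem hp hK hvK]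
      exact ih _ hlt ((desc_iff.1 h).resolve_left hv)
        fun u hu huv hub => hbelow u hu (huv.trans hlt.le) hub

end

/-- The direction of the edge from the parent of `v` to `v`. -/
def edgeDir (par : ℕ → ℕ) (P : ℕ → E4) (v : ℕ) : E4 := dirVec (P v - P (par v))

/-- The edges above the vertices `1, …, n` are proper segments, those above vertices of `K` extend
the edges above them straight on, and two edges that do not lie on a common straight chain of this
kind do not overlap. -/
structure Inv (par : ℕ → ℕ) (n : ℕ) (K : Set ℕ) (P : ℕ → E4) : Prop where
  ne : ∀ v, 0 < v → v ≤ n → P v ≠ P (par v)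
  aligned : ∀ v, v ≤ n → v ∈ K → edgeDir par P v = edgeDir par P (par v)
  clean : ∀ v₁ v₂, 0 < v₁ → v₁ ≤ n → 0 < v₂ → v₂ ≤ n → v₁ ≠ v₂ → top par K v₁ ≠ top par K v₂ →
    Clean P (par v₁) v₁ (par v₂) v₂

open Classical in
/-- Apply `R` to all that lies beyond `b`, with the parent of `b` as the centre. -/
def rotAt (par : ℕ → ℕ) (b : ℕ) (R : E4 → E4) (P : ℕ → E4) (v : ℕ) : E4 :=
  if Desc par b v then P (par b) + R (P v - P (par b)) else P v

/-- A plane rotation as a linear isometry. -/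
def planeRotL {e f : E4} (he : ‖e‖ = 1) (hf : ‖f‖ = 1) (hef : inner ℝ e f = 0) (θ : ℝ) :
    E4 →ₗᵢ[ℝ] E4 where
  toFun := planeRot e f θ
  map_add' := planeRot_add e f θ
  map_smul' r := planeRot_smul e f θ r
  norm_map' := norm_planeRot he hf hef θ

theorem coe_planeRotL {e f : E4} (he : ‖e‖ = 1) (hf : ‖f‖ = 1) (hef : inner ℝ e f = 0) (θ : ℝ) :
    ⇑(planeRotL he hf hef θ) = planeRot e f θ := rfl

/-- The isometry with linear part `R` that fixes `o`. -/
def turnAbout (R : E4 →ₗᵢ[ℝ] E4) (o : E4) : E4 →ᵃ[ℝ] E4 where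
  toFun y := o + R (y - o)
  linear := R.toLinearMap
  map_vadd' y v := by
    simp only [vadd_eq_add, LinearIsometry.coe_toLinearMap, add_sub_assoc, map_add]
    abel

theorem turnAbout_apply (R : E4 →ₗᵢ[ℝ] E4) (o y : E4) : turnAbout R o y = o + R (y - o) := rfl

theorem turnAbout_injective (R : E4 →ₗᵢ[ℝ] E4) (o : E4) : Function.Injective (turnAbout R o) := by
  intro x y h
  simpa [turnAbout_apply] using h

theorem Clean.map {P P' : ℕ → E4} {F : E4 →ᵃ[ℝ] E4} (hF : Function.Injective F) {a b c d : ℕ}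
    (h : Clean P a b c d) (ha : P' a = F (P a)) (hb : P' b = F (P b)) (hc : P' c = F (P c))
    (hd : P' d = F (P d)) : Clean P' a b c d := by
  rintro y ⟨h1, h2⟩
  rw [ha, hb, ← image_segment] at h1
  rw [hc, hd, ← image_segment] at h2
  obtain ⟨y1, hy1, rfl⟩ := h1
  obtain ⟨y2, hy2, e⟩ := h2
  obtain rfl := hF e
  obtain ⟨v, ⟨hv, hv'⟩, rfl⟩ := h ⟨hy1, hy2⟩
  refine ⟨v, ⟨hv, hv'⟩, ?_⟩
  rcases hv with rfl | rfl
  exacts [ha, hb]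

theorem Clean.symm {V : Type} {P : V → E4} {a b c d : V} (h : Clean P a b c d) :
    Clean P c d a b := by
  rintro y ⟨h1, h2⟩
  obtain ⟨v, ⟨hv, hv'⟩, rfl⟩ := h ⟨h2, h1⟩
  exact ⟨v, ⟨hv', hv⟩, rfl⟩

theorem Clean.congr {V : Type} {P P' : V → E4} {a b c d : V} (h : Clean P a b c d)
    (ha : P' a = P a) (hb : P' b = P b) (hc : P' c = P c) (hd : P' d = P d) : Clean P' a b c d := by
  rintro y ⟨h1, h2⟩
  rw [ha, hb] at h1
  rw [hc, hd] at h2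
  obtain ⟨v, ⟨hv, hv'⟩, rfl⟩ := h ⟨h1, h2⟩
  refine ⟨v, ⟨hv, hv'⟩, ?_⟩
  rcases hv with rfl | rfl
  exacts [ha, hb]

/-! ### Rotation of a subtree -/

section

variable {par : ℕ → ℕ} (hp : IsParentMap par) {n b : ℕ} (hb : 0 < b) (R : E4 →ₗᵢ[ℝ] E4)
  {P : ℕ → E4}

theorem rotAt_of_not_desc {R : E4 → E4} {v : ℕ} (h : ¬ Desc par b v) :
    rotAt par b R P v = P v := if_neg h

theorem rotAt_of_desc {R : E4 → E4} {v : ℕ} (h : Desc par b v) :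
    rotAt par b R P v = P (par b) + R (P v - P (par b)) := if_pos h

theorem rotAt_id : rotAt par b (fun y => y) P = P := by
  funext v
  by_cases h : Desc par b v
  · rw [rotAt_of_desc h, add_sub_cancel]
  · rw [rotAt_of_not_desc h]

theorem rotAt_par_not_desc {R : E4 → E4} {v : ℕ} (h : ¬ Desc par b v) :
    rotAt par b R P (par v) = P (par v) :=
  rotAt_of_not_desc fun h' => h h'.of_par

include hp hb

theorem rotAt_par_self {R : E4 → E4} : rotAt par b R P (par b) = P (par b) :=
  rotAt_of_not_desc (not_desc_par hp hb)

theorem rotAt_par_desc {v : ℕ} (h : Desc par b v) :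
    rotAt par b R P (par v) = turnAbout R (P (par b)) (P (par v)) := by
  rcases desc_iff.1 h with rfl | h'
  · rw [rotAt_par_self hp hb, turnAbout_apply, sub_self, map_zero, add_zero]
  · rw [rotAt_of_desc h', turnAbout_apply]

theorem rotAt_sub_par {v : ℕ} (h : Desc par b v) :
    rotAt par b R P v - rotAt par b R P (par v) = R (P v - P (par v)) := by
  rw [rotAt_of_desc h, rotAt_par_desc hp hb R h, turnAbout_apply, add_sub_add_left_eq_sub,
    ← map_sub, sub_sub_sub_cancel_right]

theorem dist_rotAt (v : ℕ) :
    dist (rotAt par b R P (par v)) (rotAt par b R P v) = dist (P (par v)) (P v) := by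
  rw [dist_comm, dist_eq_norm, dist_comm, dist_eq_norm]
  by_cases h : Desc par b v
  · rw [rotAt_sub_par hp hb R h, R.norm_map]
  · rw [rotAt_of_not_desc h, rotAt_par_not_desc h]

theorem edgeDir_rotAt {v : ℕ} (h : Desc par b v) :
    edgeDir par (rotAt par b R P) v = R (edgeDir par P v) := by
  rw [edgeDir, edgeDir, rotAt_sub_par hp hb R h, dirVec, dirVec, R.norm_map, map_smul]

omit hp hb in
theorem edgeDir_rotAt_of_not_desc {R : E4 → E4} {v : ℕ} (h : ¬ Desc par b v) :
    edgeDir par (rotAt par b R P) v = edgeDir par P v := by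
  rw [edgeDir, edgeDir, rotAt_of_not_desc h, rotAt_par_not_desc h]

/-- Two edges of the rotated part move by one isometry and two edges of the rest do not move, so
only pairs with one edge in each part need an argument, supplied by `cross`. The set `K'` may differ
from `K` only by `b`, since the angle at the joint is the only one that changes. -/
theorem Inv.rotate {K K' : Set ℕ} (h : Inv par n K P) (hK : IsAligned par K)
    (hK' : IsAligned par K') (hbK : b ∉ K)
    (hsub : K ⊆ K') (hsup : K' ⊆ insert b K)
    (hdir : b ∈ K' → R (edgeDir par P b) = edgeDir par P (par b))
    (cross : ∀ v₁ v₂, 0 < v₁ → v₁ ≤ n → 0 < v₂ → v₂ ≤ n → Desc par b v₁ → ¬ Desc par b v₂ →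
      top par K' v₁ ≠ top par K' v₂ → Clean (rotAt par b R P) (par v₁) v₁ (par v₂) v₂) :
    Inv par n K' (rotAt par b R P) where
  ne v hv hvn he := by
    have := dist_rotAt hp hb R (P := P) v
    rw [he, dist_self] at this
    exact h.ne v hv hvn (dist_eq_zero.1 this.symm).symm
  aligned v hvn hv := by
    by_cases hd : Desc par b v
    · rw [edgeDir_rotAt hp hb R hd]
      rcases eq_or_ne v b with rfl | hvb
      · rw [hdir hv, edgeDir_rotAt_of_not_desc (not_desc_par hp hb)]
      · rw [edgeDir_rotAt hp hb R ((desc_iff.1 hd).resolve_left hvb),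
          h.aligned v hvn ((hsup hv).resolve_left hvb)]
    · rw [edgeDir_rotAt_of_not_desc hd, edgeDir_rotAt_of_not_desc fun h' => hd h'.of_par]
      exact h.aligned v hvn ((hsup hv).resolve_left fun e => hd (e ▸ Desc.refl _ _))
  clean v₁ v₂ h1 h1n h2 h2n hne ht := by
    -- Chains for `K'` are unions of chains for `K`, so the assumption on `K'` implies the one on
    -- `K`.
    have ht' : top par K v₁ ≠ top par K v₂ := fun e => ht (by
      rw [← top_top hp hK hK' hsub v₁, e, top_top hp hK hK' hsub])
    have hc := h.clean v₁ v₂ h1 h1n h2 h2n hne ht'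
    by_cases d1 : Desc par b v₁ <;> by_cases d2 : Desc par b v₂
    · exact hc.map (turnAbout_injective R (P (par b))) (rotAt_par_desc hp hb R d1)
        (rotAt_of_desc d1) (rotAt_par_desc hp hb R d2) (rotAt_of_desc d2)
    · exact cross v₁ v₂ h1 h1n h2 h2n d1 d2 ht
    · exact (cross v₂ v₁ h2 h2n h1 h1n d2 d1 ht.symm).symm
    · exact hc.congr (rotAt_par_not_desc d1) (rotAt_of_not_desc d1) (rotAt_par_not_desc d2)
        (rotAt_of_not_desc d2)

end

/-! ### Rotations that do not create crossings -/

theorem edgeDir_smul (par : ℕ → ℕ) (P : ℕ → E4) (v : ℕ) :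
    P v = P (par v) + dist (P (par v)) (P v) • edgeDir par P v := by
  rw [edgeDir, dist_comm, dist_eq_norm, norm_smul_dirVec, add_sub_cancel]

/-- Relative to `o`, a point of the segment lies in the span of the two ends. If `α • s + β • w` lay
there too, so would `w`, after subtraction of the multiple of `s` and division by `β`. -/
theorem notMem_segment_of_notMem_span {o a b s w : E4} {α β : ℝ}
    (hw : w ∉ Submodule.span ℝ ({s, a - o, b - o} : Set E4)) (hβ : β ≠ 0) :
    o + (α • s + β • w) ∉ segment ℝ a b := by
  intro h
  have h1 := mem_span_of_mem_segment (T := {s, a - o, b - o}) (by simp) (by simp)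
    (segment_sub_mem (x := o) h)
  rw [add_sub_cancel_left] at h1
  have h2 : α • s ∈ Submodule.span ℝ ({s, a - o, b - o} : Set E4) :=
    Submodule.smul_mem _ _ (Submodule.subset_span (by simp))
  have h3 := (Submodule.add_mem_iff_right _ h2).1 h1
  exact hw ((Submodule.smul_mem_iff _ hβ).1 h3)

section

variable {par : ℕ → ℕ} (hp : IsParentMap par) {n b : ℕ} {K : Set ℕ} {P : ℕ → E4}

theorem Inv.norm_edgeDir (h : Inv par n K P) {v : ℕ} (hv : 0 < v) (hvn : v ≤ n) :
    ‖edgeDir par P v‖ = 1 := norm_dirVec (sub_ne_zero.2 (h.ne v hv hvn))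

include hp

/-- When everything strictly below `b` is aligned, directions are inherited from parent to child, so
branches as well as paths collapse onto one ray. This is what makes the subtree a rod. -/
theorem Inv.exists_ray (h : Inv par n K P) (hb : 0 < b)
    (hbelow : ∀ u, Desc par b u → u ≤ n → u ≠ b → u ∈ K) {v : ℕ} (hd : Desc par b v)
    (hv : v ≤ n) : edgeDir par P v = edgeDir par P b ∧
      ∃ τ : ℝ, 0 < τ ∧ P v = P (par b) + τ • edgeDir par P b := by
  induction v using Nat.strong_induction_on with
  | _ v ih =>
    have hv0 : 0 < v := hb.trans_le (hd.le hp)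
    have hpos := dist_pos.2 (h.ne v hv0 hv).symm
    rcases eq_or_ne v b with rfl | hvb
    · exact ⟨rfl, _, hpos, edgeDir_smul par P v⟩
    · have hlt := hp.lt v hv0
      obtain ⟨h1, τ, hτ, h2⟩ := ih _ hlt ((desc_iff.1 hd).resolve_left hvb) (hlt.le.trans hv)
      have h3 : edgeDir par P v = edgeDir par P b := by
        rw [h.aligned v hv (hbelow v hd hv hvb), h1]
      refine ⟨h3, τ + dist (P (par v)) (P v), by positivity, ?_⟩
      rw [add_smul, ← add_assoc, ← h2, ← h3]
      exact edgeDir_smul par P v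

/-- An edge that lies on a ray from the centre of the rotation is clean, if the open ray is free. -/
theorem Inv.clean_of_free (h : Inv par n K P) (hK : IsAligned par K) (hb : 0 < b) (hbn : b ≤ n)
    (hbK : b ∉ K) (R : E4 → E4) {v₁ v₂ : ℕ} (h2 : 0 < v₂) (h2n : v₂ ≤ n)
    (d2 : ¬ Desc par b v₂) {g : E4} {τ₀ τ₁ : ℝ}
    (e0 : rotAt par b R P (par v₁) = P (par b) + τ₀ • g)
    (e1 : rotAt par b R P v₁ = P (par b) + τ₁ • g) (hτ0 : 0 ≤ τ₀) (hτ1 : 0 < τ₁)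
    (h0 : τ₀ = 0 → v₁ = b)
    (free : ∀ τ : ℝ, 0 < τ → P (par b) + τ • g ∉ segment ℝ (P (par v₂)) (P v₂)) :
    Clean (rotAt par b R P) (par v₁) v₁ (par v₂) v₂ := by
  rintro y ⟨hy1, hy2⟩
  rw [rotAt_par_not_desc d2, rotAt_of_not_desc d2] at hy2
  rw [e0, e1] at hy1
  obtain ⟨r, q, hr, hq, hrq, rfl⟩ := hy1
  have hy : r • (P (par b) + τ₀ • g) + q • (P (par b) + τ₁ • g) =
      P (par b) + (r * τ₀ + q * τ₁) • g := by
    have : P (par b) = (r + q) • P (par b) := by rw [hrq, one_smul]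
    conv_rhs => rw [this]
    module
  rw [hy] at hy2 ⊢
  have hnn : 0 ≤ r * τ₀ + q * τ₁ := by positivity
  -- Away from the centre the ray is free. A common point at the centre forces the edge to be the
  -- first one of the rod.
  rcases hnn.lt_or_eq with hpos | hzero
  · exact absurd hy2 (free _ hpos)
  rw [← hzero, zero_smul, add_zero] at hy2 ⊢
  have hq0 : q = 0 := by nlinarith [mul_nonneg hr hτ0, mul_nonneg hq hτ1.le]
  have hr1 : r = 1 := by linarith
  have hτ : τ₀ = 0 := by rw [hq0, hr1] at hzero; linarith
  obtain rfl := h0 hτ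
  have hne : v₁ ≠ v₂ := fun e => d2 (e ▸ Desc.refl _ _)
  -- The centre does not move, so this contact was there before the rotation, and the old cleanness
  -- shows that it is a shared end.
  obtain ⟨y, ⟨hy, hy'⟩, hPy⟩ := h.clean v₁ v₂ hb hbn h2 h2n hne
    (top_ne_top hp hK hbK (Desc.refl _ _) d2) ⟨left_mem_segment ℝ _ _, hy2⟩
  rcases hy with rfl | rfl
  · exact ⟨par v₁, ⟨Or.inl rfl, hy'⟩, rotAt_par_self hp hb⟩
  · exact absurd hPy (h.ne _ hb hbn)

/-- All edges of the rod lie on one ray from the centre, also after the rotation, and only the first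
of them contains the centre. So a free open ray settles all of them together. -/
theorem Inv.clean_rod (h : Inv par n K P) (hK : IsAligned par K) (hb : 0 < b) (hbn : b ≤ n)
    (hbK : b ∉ K) (hbelow : ∀ u, Desc par b u → u ≤ n → u ≠ b → u ∈ K) (R : E4 →ₗᵢ[ℝ] E4)
    {v₁ v₂ : ℕ} (h1n : v₁ ≤ n) (d1 : Desc par b v₁) (h2 : 0 < v₂) (h2n : v₂ ≤ n)
    (d2 : ¬ Desc par b v₂)
    (free : ∀ τ : ℝ, 0 < τ → P (par b) + τ • R (edgeDir par P b) ∉ segment ℝ (P (par v₂)) (P v₂)) :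
    Clean (rotAt par b R P) (par v₁) v₁ (par v₂) v₂ := by
  obtain ⟨-, τ₁, hτ₁, e1⟩ := h.exists_ray hp hb hbelow d1 h1n
  have e1' : rotAt par b R P v₁ = P (par b) + τ₁ • R (edgeDir par P b) := by
    rw [rotAt_of_desc d1, e1, add_sub_cancel_left, map_smul]
  rcases eq_or_ne v₁ b with rfl | hv
  · exact h.clean_of_free hp hK hb hbn hbK R h2 h2n d2 (τ₀ := 0)
      (by rw [rotAt_par_self hp hb, zero_smul, add_zero]) e1' le_rfl hτ₁ (fun _ => rfl) free
  · have d0 := (desc_iff.1 d1).resolve_left hv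
    obtain ⟨-, τ₀, hτ₀, e0⟩ := h.exists_ray hp hb hbelow d0 ((hp.le _).trans h1n)
    exact h.clean_of_free hp hK hb hbn hbK R h2 h2n d2
      (by rw [rotAt_of_desc d0, e0, add_sub_cancel_left, map_smul]) e1' hτ₀.le hτ₁
      (fun e => absurd e hτ₀.ne') free

end

/-- The data of a rotation of all that lies beyond `b` about the parent of `b`. -/
structure Turn where
  b : ℕ
  e : E4
  f : E4
  cosAngle : ℝ

/-- The position at time `t`. -/
def Turn.pos (par : ℕ → ℕ) (m : Turn) (P : ℕ → E4) (t : ℝ) : ℕ → E4 :=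
  rotAt par m.b (planeRot m.e m.f (t * Real.arccos m.cosAngle)) P

theorem Turn.pos_zero (par : ℕ → ℕ) (m : Turn) (P : ℕ → E4) : m.pos par P 0 = P := by
  have : planeRot m.e m.f 0 = fun y => y := funext fun y => planeRot_zero _ _ _
  rw [Turn.pos, zero_mul, this, rotAt_id]

/-- The rotation that turns the edge above `b`, which points in the direction of `s`, to the
direction of `w`. -/
def turnTo (b : ℕ) (s w : E4) : Turn := ⟨b, turnE s, turnF s w, turnCos s w⟩

/-- The rotation `m` leads from `P` to `P'`; all edges aligned at the start remain so, edges come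
to overlap only at the end, and then they are aligned. -/
structure IsStep (par : ℕ → ℕ) (n : ℕ) (K K' : Set ℕ) (P : ℕ → E4) (m : Turn) (P' : ℕ → E4) :
    Prop where
  pos : 0 < m.b
  le : m.b ≤ n
  norm_e : ‖m.e‖ = 1
  norm_f : ‖m.f‖ = 1
  inner_eq : inner ℝ m.e m.f = 0
  neg_one_le : -1 ≤ m.cosAngle
  le_one : m.cosAngle ≤ 1
  isAligned : IsAligned par K
  isAligned' : IsAligned par K'
  sub : K ⊆ K'
  inv : ∀ t, 0 ≤ t → t < 1 → Inv par n K (m.pos par P t)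
  inv' : Inv par n K' P'
  eq : P' = m.pos par P 1

section

variable {par : ℕ → ℕ} (hp : IsParentMap par) {n b : ℕ} {K : Set ℕ} {P : ℕ → E4} {s w : E4}
include hp

theorem edgeDir_turnTo (hb : 0 < b) (hs : s ≠ 0) (hsb : dirVec s = edgeDir par P b)
    (hw : w ∉ Submodule.span ℝ ({s} : Set E4)) :
    edgeDir par ((turnTo b s w).pos par P 1) b = dirVec w := by
  have := edgeDir_rotAt hp hb (planeRotL (norm_turnE hs hw) (norm_turnF hs hw) (inner_turn hs hw)
    (1 * Real.arccos (turnCos s w))) (P := P) (Desc.refl par b)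
  rw [coe_planeRotL, ← hsb, one_mul] at this
  rw [Turn.pos, one_mul]
  exact this.trans (planeRot_turn_end hs hw)

/-- The set of aligned vertices changes only at the end of the motion. Accordingly `cross` may
exempt pairs with equal tops only at `t = 1`; at earlier times every pair across the joint must be
clean. -/
theorem Inv.isStep_turnTo (h : Inv par n K P) (hK : IsAligned par K) (hb : 0 < b) (hbn : b ≤ n)
    (hbK : b ∉ K) {K' : Set ℕ} (hK' : IsAligned par K') (hsub : K ⊆ K') (hsup : K' ⊆ insert b K)
    (hs : s ≠ 0) (hsb : dirVec s = edgeDir par P b)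
    (hw : w ∉ Submodule.span ℝ ({s} : Set E4))
    (hdir : b ∈ K' → dirVec w = edgeDir par P (par b))
    (cross : ∀ t, 0 < t → t ≤ 1 → ∀ v₁ v₂, 0 < v₁ → v₁ ≤ n → 0 < v₂ → v₂ ≤ n →
      Desc par b v₁ → ¬ Desc par b v₂ → (t = 1 → top par K' v₁ ≠ top par K' v₂) →
      Clean ((turnTo b s w).pos par P t) (par v₁) v₁ (par v₂) v₂) :
    IsStep par n K K' P (turnTo b s w) ((turnTo b s w).pos par P 1) where
  pos := hb
  le := hbn
  norm_e := norm_turnE hs hw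
  norm_f := norm_turnF hs hw
  inner_eq := inner_turn hs hw
  neg_one_le := (turnCos_mem hs hw).1
  le_one := (turnCos_mem hs hw).2
  isAligned := hK
  isAligned' := hK'
  sub := hsub
  inv t h0 h1 := by
    rcases h0.eq_or_lt with rfl | h0
    · rwa [Turn.pos_zero]
    · exact h.rotate hp hb (planeRotL (norm_turnE hs hw) (norm_turnF hs hw) (inner_turn hs hw)
        (t * Real.arccos (turnCos s w))) hK hK hbK subset_rfl (Set.subset_insert _ _)
        (fun h => absurd h hbK)
        fun v₁ v₂ p1 p1' p2 p2' d1 d2 _ => cross t h0 h1.le v₁ v₂ p1 p1' p2 p2' d1 d2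
          fun e => absurd e h1.ne
  inv' := h.rotate hp hb (planeRotL (norm_turnE hs hw) (norm_turnF hs hw) (inner_turn hs hw)
        (1 * Real.arccos (turnCos s w))) hK hK' hbK hsub hsup
        (fun h => by
          rw [coe_planeRotL, one_mul, ← hdir h, ← hsb]
          exact planeRot_turn_end hs hw)
        fun v₁ v₂ p1 p1' p2 p2' d1 d2 ht => cross 1 one_pos le_rfl v₁ v₂ p1 p1' p2 p2' d1 d2
          fun _ => ht
  eq := rfl

/-- Turn a straight rod into a direction in general position. -/
theorem Inv.isStep_rod (h : Inv par n K P) (hK : IsAligned par K) (hb : 0 < b) (hbn : b ≤ n)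
    (hbK : b ∉ K) (hbelow : ∀ u, Desc par b u → u ≤ n → u ≠ b → u ∈ K)
    (hs : s ≠ 0) (hsb : dirVec s = edgeDir par P b)
    (hw : ∀ v, 0 < v → v ≤ n →
      w ∉ Submodule.span ℝ ({s, P (par v) - P (par b), P v - P (par b)} : Set E4)) :
    IsStep par n K K P (turnTo b s w) ((turnTo b s w).pos par P 1) := by
  have hw' : w ∉ Submodule.span ℝ ({s} : Set E4) := fun h' =>
    hw b hb hbn (Submodule.span_mono (by simp) h')
  refine h.isStep_turnTo hp hK hb hbn hbK hK subset_rfl (Set.subset_insert _ _) hs hsb hw'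
    (fun h => absurd h hbK) ?_
  intro t t0 t1 v₁ v₂ p1 p1' p2 p2' d1 d2 _
  refine h.clean_rod hp hK hb hbn hbK hbelow (planeRotL (norm_turnE hs hw') (norm_turnF hs hw')
    (inner_turn hs hw') (t * Real.arccos (turnCos s w))) p1' d1 p2 p2' d2 fun τ hτ => ?_
  -- At every positive time the moving direction contains a positive multiple of `w`, and `w` avoids
  -- the span of `s` and of each edge seen from the joint.
  obtain ⟨α, β, hβ, e⟩ := planeRot_turn_mid hs hw' t0 t1
  rw [coe_planeRotL, ← hsb]
  change _ + τ • planeRot (turnE s) _ _ (turnE s) ∉ _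
  rw [e, smul_add, smul_smul, smul_smul]
  exact notMem_segment_of_notMem_span (hw v₂ p2 p2') (by positivity)

/-- Turn a straight rod, whose direction is in general position, into the extension of the edge
from which it hangs. -/
theorem Inv.isStep_align (h : Inv par n K P) (hK : IsAligned par K) (hb : 0 < b) (hbn : b ≤ n)
    (hbK : b ∉ K) (hx : 0 < par b) (hxK : par b ∉ K) (hKx : ∀ v, v ≤ n → par b < par v → v ∈ K)
    (hs : s ≠ 0) (hsb : dirVec s = edgeDir par P b) {g : E4} (hg : dirVec g = edgeDir par P (par b))
    (hsg' : s ∉ Submodule.span ℝ ({g} : Set E4))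
    (hsg : ∀ v, 0 < v → v ≤ n → ¬ Desc par b v →
      s ∉ Submodule.span ℝ ({g, P (par v) - P (par b), P v - P (par b)} : Set E4))
    (hfree : ∀ v, 0 < v → v ≤ n → ¬ Desc par (par b) v → ∀ τ : ℝ, 0 < τ →
      P (par b) + τ • edgeDir par P (par b) ∉ segment ℝ (P (par v)) (P v))
    (hother : ∀ c, c ≤ n → par c = par b → c ∉ K → c ≠ b →
      edgeDir par P c ≠ edgeDir par P (par b)) :
    IsStep par n K (insert b K) P (turnTo b s g) ((turnTo b s g).pos par P 1) := by
  have hxn : par b ≤ n := (hp.le b).trans hbn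
  have hnorm : ‖edgeDir par P (par b)‖ = 1 := h.norm_edgeDir hx hxn
  have hg0 : g ≠ 0 := by
    rintro rfl
    rw [← hg] at hnorm
    simp [dirVec] at hnorm
  have hg' : g ∉ Submodule.span ℝ ({s} : Set E4) := by
    intro h'
    obtain ⟨r, hr⟩ := Submodule.mem_span_singleton.1 h'
    have hr0 : r ≠ 0 := by rintro rfl; rw [zero_smul] at hr; exact hg0 hr.symm
    apply hsg'
    have : s = r⁻¹ • g := by rw [← hr, smul_smul, inv_mul_cancel₀ hr0, one_smul]
    rw [this]
    exact Submodule.smul_mem _ _ (Submodule.mem_span_singleton_self g)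
  have hbelow : ∀ u, Desc par b u → u ≤ n → u ≠ b → u ∈ K := fun u hu hun hub =>
    hKx u hun ((hp.lt b hb).trans_le (hu.le_par hp hub))
  have hKi : IsAligned par (insert b K) := by
    rintro v (rfl | hv)
    exacts [hx, hK v hv]
  refine h.isStep_turnTo hp hK hb hbn hbK hKi (Set.subset_insert _ _) subset_rfl hs hsb hg'
    (fun _ => hg) ?_
  intro t t0 t1 v₁ v₂ p1 p1' p2 p2' d1 d2 htop
  refine h.clean_rod hp hK hb hbn hbK hbelow (planeRotL (norm_turnE hs hg') (norm_turnF hs hg')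
    (inner_turn hs hg') (t * Real.arccos (turnCos s g))) p1' d1 p2 p2' d2 fun τ hτ => ?_
  rw [coe_planeRotL, ← hsb]
  change _ + τ • planeRot (turnE s) _ _ (turnE s) ∉ _
  -- Before the end `s` has a positive coefficient and plays the part of the general vector, while
  -- `g` lies in the span. At the end the rod points along the extension of the edge above `par b`.
  rcases t1.lt_or_eq with t1 | rfl
  · obtain ⟨α, β, hα, e⟩ := planeRot_turn_start hs hg' t0.le t1
    rw [e, smul_add, smul_smul, smul_smul, add_comm ((τ * α) • s)]
    exact notMem_segment_of_notMem_span (hsg v₂ p2 p2' d2) (by positivity)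
  · rw [one_mul, planeRot_turn_end hs hg', hg]
    have htop := htop rfl
    by_cases d2x : Desc par (par b) v₂
    swap
    · exact hfree v₂ p2 p2' d2x τ hτ
    have hxK' : par b ∉ insert b K := by
      rintro (e | e)
      · exact (hp.lt b hb).ne e
      · exact hxK e
    -- The whole rod now belongs to the chain of the edge above `par b`. That edge itself and the
    -- rods aligned earlier have the same top, hence are exempt.
    have htop1 : top par (insert b K) v₁ = par b := by
      rw [top_eq_of_desc hp hKi d1
        fun u hu huv hub => Or.inr (hbelow u hu (huv.trans p1') hub),
        top_of_mem hp hKi (Set.mem_insert _ _), top_of_notMem hxK']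
    rw [htop1] at htop
    have hv2 : v₂ ≠ par b := by
      rintro rfl
      exact htop (top_of_notMem hxK').symm
    obtain ⟨c, hc, hcv, hxc⟩ := d2x.exists_child hp hv2
    have hcn : c ≤ n := (hcv.le hp).trans p2'
    have hc0 : 0 < c := hx.trans hxc
    have hcb : c ≠ b := fun e => d2 (e ▸ hcv)
    have hcbelow : ∀ u, Desc par c u → u ≤ n → u ≠ c → u ∈ K := fun u hu hun huc =>
      hKx u hun (hxc.trans_le (hu.le_par hp huc))
    -- The other edge belongs to the rod of a sibling `c`. If `c` were aligned, the two edges would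
    -- be coalesced.
    have hcK : c ∉ K := by
      intro hcK
      apply htop
      rw [top_eq_of_desc hp hKi hcv
        fun u hu huv huc => Or.inr (hcbelow u hu (huv.trans p2') huc),
        top_of_mem hp hKi (Or.inr hcK), hc, top_of_notMem hxK']
    have hne := hother c hcn hc hcK hcb
    have hcnorm : ‖edgeDir par P c‖ = 1 := h.norm_edgeDir hc0 hcn
    obtain ⟨-, τ₁, hτ₁, e1⟩ := h.exists_ray hp hc0 hcbelow hcv p2'
    have e0 : ∃ τ₀ : ℝ, 0 ≤ τ₀ ∧ P (par v₂) = P (par c) + τ₀ • edgeDir par P c := by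
      rcases eq_or_ne v₂ c with rfl | hv
      · exact ⟨0, le_rfl, by simp⟩
      · obtain ⟨-, τ₀, hτ₀, e0⟩ := h.exists_ray hp hc0 hcbelow ((desc_iff.1 hcv).resolve_left hv)
          ((hp.le _).trans p2')
        exact ⟨τ₀, hτ₀.le, e0⟩
    obtain ⟨τ₀, hτ₀, e0⟩ := e0
    intro hmem
    obtain ⟨r, q, hr, hq, hrq, e⟩ := segment_sub_mem (x := P (par b)) hmem
    rw [e0, e1, hc, add_sub_cancel_left, add_sub_cancel_left, add_sub_cancel_left, smul_smul,
      smul_smul, ← add_smul] at e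
    have hnn : 0 ≤ r * τ₀ + q * τ₁ := by positivity
    -- Two rays from one point with unit directions can meet at a positive distance only if the
    -- directions agree, which `hother` excludes.
    have h1 := congrArg norm e
    rw [norm_smul, norm_smul, hcnorm, hnorm, Real.norm_of_nonneg hnn, Real.norm_of_nonneg hτ.le,
      mul_one, mul_one] at h1
    rw [h1] at e
    exact hne (smul_right_injective _ hτ.ne' e)

end

/-- Normalization moves `w` by the error of its norm, which is at most `‖w - u‖`; hence the factor
two. -/
theorem norm_dirVec_sub_le {u w : E4} (hu : ‖u‖ = 1) : ‖dirVec w - u‖ ≤ 2 * ‖w - u‖ := by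
  rcases eq_or_ne w 0 with rfl | hw
  · simp [dirVec, hu]
  have h1 : ‖dirVec w - w‖ ≤ ‖w - u‖ := by
    have h2 : dirVec w - w = (1 - ‖w‖) • dirVec w := by
      rw [sub_smul, one_smul, norm_smul_dirVec]
    rw [h2, norm_smul, norm_dirVec hw, mul_one, Real.norm_eq_abs, ← hu, norm_sub_rev w u]
    exact abs_norm_sub_norm_le u w
  calc ‖dirVec w - u‖ = ‖(dirVec w - w) + (w - u)‖ := by rw [sub_add_sub_cancel]
    _ ≤ ‖dirVec w - w‖ + ‖w - u‖ := norm_add_le _ _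
    _ ≤ 2 * ‖w - u‖ := by linarith

section

variable {par : ℕ → ℕ} (hp : IsParentMap par) {n x : ℕ} {K : Set ℕ} {P : ℕ → E4} {s w : E4}
include hp

/-- Turn an edge and the rods that hang from its lower end by a small angle. -/
theorem Inv.isStep_broom (h : Inv par n K P) (hK : IsAligned par K) (hx : 0 < x) (hxn : x ≤ n)
    (hxK : x ∉ K) (hKx : ∀ v, v ≤ n → x < par v → v ∈ K)
    (hs : s ≠ 0) (hsx : dirVec s = edgeDir par P x)
    (hw : ∀ v, 0 < v → v ≤ n →
      w ∉ Submodule.span ℝ ({s, P (par v) - P (par x), P v - P (par x)} : Set E4))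
    {κ ρ : ℝ} (hκ : 0 < κ) (hκ1 : κ ≤ 1) (hρ : 0 < ρ)
    (hclear : ∀ c, c ≤ n → par c = x → ∀ v, 0 < v → v ≤ n → ¬ Desc par x v →
      ∀ Y ∈ segment ℝ (P (par v) - P x) (P v - P x), ∀ τ : ℝ, 0 ≤ τ →
        κ * τ ≤ ‖Y - τ • edgeDir par P c‖)
    (hdist : ∀ v, 0 < v → v ≤ n → ¬ Desc par x v →
      ∀ Y ∈ segment ℝ (P (par v) - P x) (P v - P x), ρ ≤ ‖Y‖)
    (hnear : ‖w - edgeDir par P x‖ < κ * ρ / (8 * ‖P x - P (par x)‖ + 4 * ρ)) :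
    IsStep par n K K P (turnTo x s w) ((turnTo x s w).pos par P 1) := by
  have hw' : w ∉ Submodule.span ℝ ({s} : Set E4) := fun h' =>
    hw x hx hxn (Submodule.span_mono (by simp) h')
  have hu : ‖edgeDir par P x‖ = 1 := h.norm_edgeDir hx hxn
  refine h.isStep_turnTo hp hK hx hxn hxK hK subset_rfl (Set.subset_insert _ _) hs hsx hw'
    (fun h => absurd h hxK) ?_
  intro t t0 t1 v₁ v₂ p1 p1' p2 p2' d1 d2 _
  set R := planeRotL (norm_turnE hs hw') (norm_turnF hs hw')
    (inner_turn hs hw') (t * Real.arccos (turnCos s w)) with hR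
  have hpos : (turnTo x s w).pos par P t = rotAt par x R P := rfl
  rw [hpos]
  -- The handle of the broom may share an end with resting edges, and is treated by general
  -- position. The rods must stay off these edges entirely, and are treated by distances.
  rcases eq_or_ne v₁ x with rfl | hv
  · refine h.clean_of_free hp hK hx hxn hxK R p2 p2' d2 (τ₀ := 0) (g := R (edgeDir par P v₁))
      (τ₁ := dist (P (par v₁)) (P v₁))
      (by rw [rotAt_par_self hp hx, zero_smul, add_zero]) ?_ le_rfl
      (dist_pos.2 (h.ne _ hx hxn).symm) (fun _ => rfl) fun τ hτ => ?_
    · rw [rotAt_of_desc d1, ← map_smul]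
      conv_lhs => rw [edgeDir_smul par P v₁, add_sub_cancel_left]
    · obtain ⟨α, β, hβ, e⟩ := planeRot_turn_mid hs hw' t0 t1
      rw [hR, coe_planeRotL, ← hsx]
      change _ + τ • planeRot (turnE s) _ _ (turnE s) ∉ _
      rw [e, smul_add, smul_smul, smul_smul]
      exact notMem_segment_of_notMem_span (hw v₂ p2 p2') (by positivity)
  obtain ⟨c, rfl, hcv, hxc⟩ := d1.exists_child hp hv
  set x := par c with hxdef
  have hcn : c ≤ n := (hcv.le hp).trans p1'
  have hc0 : 0 < c := hx.trans hxc
  have hcbelow : ∀ u, Desc par c u → u ≤ n → u ≠ c → u ∈ K := fun u hu hun huc =>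
    hKx u hun (hxc.trans_le (hu.le_par hp huc))
  have hcnorm : ‖edgeDir par P c‖ = 1 := h.norm_edgeDir hc0 hcn
  obtain ⟨-, τ₁, hτ₁, e1⟩ := h.exists_ray hp hc0 hcbelow hcv p1'
  have e0 : ∃ τ₀ : ℝ, 0 ≤ τ₀ ∧ P (par v₁) = P x + τ₀ • edgeDir par P c := by
    rcases eq_or_ne v₁ c with rfl | hv
    · exact ⟨0, le_rfl, by simp [hxdef]⟩
    · obtain ⟨-, τ₀, hτ₀, e0⟩ := h.exists_ray hp hc0 hcbelow ((desc_iff.1 hcv).resolve_left hv)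
        ((hp.le _).trans p1')
      exact ⟨τ₀, hτ₀.le, e0⟩
  obtain ⟨τ₀, hτ₀, e0⟩ := e0
  rw [← hxdef] at e1
  rintro y ⟨hy1, hy2⟩
  exfalso
  rw [rotAt_par_not_desc d2, rotAt_of_not_desc d2] at hy2
  rw [rotAt_par_desc hp hx R d1, rotAt_of_desc d1, ← turnAbout_apply, ← image_segment] at hy1
  obtain ⟨z, hz, rfl⟩ := hy1
  obtain ⟨r, q, hr, hq, hrq, rfl⟩ := hz
  have hz : r • P (par v₁) + q • P v₁ = P x + (r * τ₀ + q * τ₁) • edgeDir par P c := by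
    rw [e0, e1]
    have : P x = (r + q) • P x := by rw [hrq, one_smul]
    conv_rhs => rw [this]
    module
  have hτ : 0 ≤ r * τ₀ + q * τ₁ := by positivity
  rw [hz] at hy2
  clear hz
  set τ := r * τ₀ + q * τ₁
  have hY := segment_sub_mem (x := P x) hy2
  set d := edgeDir par P c
  have b1 := hclear c hcn rfl v₂ p2 p2' d2 _ hY τ hτ
  have b2 := hdist v₂ p2 p2' d2 _ hY
  set Y := (turnAbout R (P (par x))) (P x + τ • d) - P x with hYdef
  set l := ‖P x - P (par x)‖
  -- If a rod point originally at distance `τ` from `x` hits an edge, its displacement is at least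
  -- `κ * τ` by clearance of the ray, and at least `ρ - τ` by the distance of `x` from the edge.
  have b3 : ρ - τ ≤ ‖Y - τ • d‖ := by
    have := norm_sub_norm_le Y (τ • d)
    rw [norm_smul, hcnorm, Real.norm_of_nonneg hτ, mul_one] at this
    linarith
  set φ := ‖dirVec w - edgeDir par P x‖
  -- On the other hand, the point is at distance at most `l + τ` from the joint, and `φ` is the
  -- final displacement of a unit vector of the plane.
  have b4 : ‖Y - τ • d‖ ≤ φ * (l + τ) := by
    have e : Y - τ • d = R ((P x - P (par x)) + τ • d) - ((P x - P (par x)) + τ • d) := by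
      rw [hYdef, turnAbout_apply, show P x + τ • d - P (par x) = P x - P (par x) + τ • d by abel]
      abel
    rw [e, hR, coe_planeRotL]
    refine (norm_planeRot_sub_le (norm_turnE hs hw') (norm_turnF hs hw') (inner_turn hs hw')
      (by have := Real.arccos_nonneg (turnCos s w); positivity)
      (mul_le_of_le_one_left (Real.arccos_nonneg _) t1) (Real.arccos_le_pi _) _).trans ?_
    rw [planeRot_turn_end hs hw', turnE, hsx]
    refine mul_le_mul_of_nonneg_left ?_ (norm_nonneg _)
    refine (norm_add_le _ _).trans ?_
    rw [norm_smul, hcnorm, Real.norm_of_nonneg hτ, mul_one]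
  have b5 : φ ≤ 2 * ‖w - edgeDir par P x‖ := norm_dirVec_sub_le hu
  have hl : 0 ≤ l := norm_nonneg _
  rw [lt_div_iff₀ (by positivity)] at hnear
  -- The assumed radius is chosen for this: normalization costs a factor two, whence the constants
  -- `8` and `4` there.
  have b6 : φ * (4 * l + 2 * ρ) < κ * ρ := by nlinarith
  have hφ : 0 ≤ φ := norm_nonneg _
  have b7 : 2 * φ ≤ κ := by
    by_contra! hc
    nlinarith [mul_nonneg hφ hl]
  have b8 : κ * ρ ≤ (1 + κ) * ‖Y - τ • d‖ := by nlinarith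
  have b9 : (1 + κ) * ‖Y - τ • d‖ ≤ 2 * ‖Y - τ • d‖ := by
    nlinarith [norm_nonneg (Y - τ • d)]
  -- Let `D` be the displacement. As `φ * τ ≤ κ * τ / 2 ≤ D / 2`, the bound `b4` gives `D ≤ 2 * φ *
  -- l`. Then `κ * ρ ≤ 2 * D ≤ 4 * φ * l`, against `b6`.
  nlinarith [mul_nonneg hφ hτ, mul_nonneg hφ hρ.le, mul_le_mul_of_nonneg_right b7 hτ]

/-- After such a rotation the extension of the edge is free. -/
theorem free_of_turnTo (h : Inv par n K P) (hx : 0 < x) (hxn : x ≤ n)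
    (hs : s ≠ 0) (hsx : dirVec s = edgeDir par P x)
    (hw : ∀ v, 0 < v → v ≤ n →
      w ∉ Submodule.span ℝ ({s, P (par v) - P (par x), P v - P (par x)} : Set E4))
    {v : ℕ} (hv : 0 < v) (hvn : v ≤ n) (hd : ¬ Desc par x v) {τ : ℝ} (hτ : 0 < τ) :
    (turnTo x s w).pos par P 1 x + τ • edgeDir par ((turnTo x s w).pos par P 1) x ∉
      segment ℝ ((turnTo x s w).pos par P 1 (par v)) ((turnTo x s w).pos par P 1 v) := by
  have hw' : w ∉ Submodule.span ℝ ({s} : Set E4) := fun h' =>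
    hw x hx hxn (Submodule.span_mono (by simp) h')
  have e : (turnTo x s w).pos par P 1 x =
      P (par x) + dist (P (par x)) (P x) • dirVec w := by
    rw [edgeDir_smul par ((turnTo x s w).pos par P 1) x, edgeDir_turnTo hp hx hs hsx hw']
    have h1 := dist_rotAt hp hx (planeRotL (norm_turnE hs hw') (norm_turnF hs hw')
      (inner_turn hs hw') (1 * Real.arccos (turnCos s w))) (P := P) x
    have h2 := rotAt_par_self hp hx (P := P) (R := planeRotL (norm_turnE hs hw')
      (norm_turnF hs hw') (inner_turn hs hw') (1 * Real.arccos (turnCos s w)))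
    rw [coe_planeRotL] at h1 h2
    change dist ((turnTo x s w).pos par P 1 (par x)) ((turnTo x s w).pos par P 1 x) = _ at h1
    change (turnTo x s w).pos par P 1 (par x) = _ at h2
    rw [h1, h2]
  rw [edgeDir_turnTo hp hx hs hsx hw', e, Turn.pos, rotAt_par_not_desc (b := (turnTo x s w).b) hd,
    rotAt_of_not_desc (b := (turnTo x s w).b) hd, add_assoc, ← add_smul, dirVec, smul_smul]
  -- Seen from the joint, the extension of the turned edge lies on the ray along `w` alone, so the
  -- coefficient of `s` is zero.
  have h3 := notMem_segment_of_notMem_span (hw v hv hvn) (α := 0)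
    (β := (dist (P (par x)) (P x) + τ) * ‖w‖⁻¹)
    (by
      have := norm_pos_iff.2 (ne_zero_of_notMem_span hs hw')
      have := dist_pos.2 (h.ne x hx hxn)
      positivity)
  rwa [zero_smul, zero_add] at h3

end

/-! ### Sequences of rotations -/

/-- The rotations `ms`, one after the other, lead from `P` to `P'`. -/
inductive Reach (par : ℕ → ℕ) (n : ℕ) : Set ℕ → (ℕ → E4) → List Turn → Set ℕ → (ℕ → E4) → Prop
  | nil (K : Set ℕ) (P : ℕ → E4) : Reach par n K P [] K P
  | cons {K K' K'' : Set ℕ} {P P' P'' : ℕ → E4} {m : Turn} {ms : List Turn}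
      (h : IsStep par n K K' P m P') (h' : Reach par n K' P' ms K'' P'') :
      Reach par n K P (m :: ms) K'' P''

theorem Reach.append {par : ℕ → ℕ} {n : ℕ} {K K' K'' : Set ℕ} {P P' P'' : ℕ → E4}
    {ms ms' : List Turn} (h : Reach par n K P ms K' P') (h' : Reach par n K' P' ms' K'' P'') :
    Reach par n K P (ms ++ ms') K'' P'' := by
  induction h with
  | nil => exact h'
  | cons h _ ih => exact .cons h (ih h')

theorem IsStep.reach {par : ℕ → ℕ} {n : ℕ} {K K' : Set ℕ} {P P' : ℕ → E4} {m : Turn}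
    (h : IsStep par n K K' P m P') : Reach par n K P [m] K' P' := .cons h (.nil _ _)

section

variable {par : ℕ → ℕ} (hp : IsParentMap par) {n : ℕ}
include hp

theorem IsStep.dist_eq {K K' : Set ℕ} {P P' : ℕ → E4} {m : Turn} (h : IsStep par n K K' P m P')
    (t : ℝ) (v : ℕ) :
    dist (m.pos par P t (par v)) (m.pos par P t v) = dist (P (par v)) (P v) :=
  dist_rotAt hp h.pos (planeRotL h.norm_e h.norm_f h.inner_eq (t * Real.arccos m.cosAngle)) v

omit hp in
theorem Turn.continuous_pos (m : Turn) (P : ℕ → E4) (v : ℕ) :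
    Continuous fun t => m.pos par P t v := by
  by_cases h : Desc par m.b v
  · simp only [Turn.pos, rotAt_of_desc h]
    exact continuous_const.add
      ((continuous_planeRot _ _ _).comp (continuous_id.mul continuous_const))
  · simp only [Turn.pos, rotAt_of_not_desc h]
    exact continuous_const

/-- The motion that belongs to a sequence of rotations. -/
theorem Reach.exists_motion {K K' : Set ℕ} {P P' : ℕ → E4} {ms : List Turn}
    (h : Reach par n K P ms K' P') (hK : IsAligned par K) (hP : Inv par n K P) :
    ∃ (q : ℝ → ℕ → E4) (κ : ℝ → Set ℕ), q 0 = P ∧ q ms.length = P' ∧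
      (∀ (i : ℕ) (m : Turn), ms[i]? = some m →
        (0 < m.b ∧ m.b ≤ n ∧ ‖m.e‖ = 1 ∧ ‖m.f‖ = 1 ∧ inner ℝ m.e m.f = 0 ∧
          -1 ≤ m.cosAngle ∧ m.cosAngle ≤ 1) ∧
        ∀ t ∈ Set.Icc (0 : ℝ) 1, q (i + t) = m.pos par (q i) t) ∧
      (∀ v, ContinuousOn (fun t => q t v) (Set.Icc 0 ms.length)) ∧
      (∀ t ∈ Set.Icc (0 : ℝ) ms.length, ∀ v,
        dist (q t (par v)) (q t v) = dist (P (par v)) (P v)) ∧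
      (∀ s ∈ Set.Icc (0 : ℝ) ms.length, ∀ t ∈ Set.Icc s ms.length, κ s ⊆ κ t) ∧
      (∀ t ∈ Set.Icc (0 : ℝ) ms.length,
        K ⊆ κ t ∧ IsAligned par (κ t) ∧ Inv par n (κ t) (q t)) ∧ κ ms.length = K' := by
  induction h with
  | nil K P =>
    refine ⟨fun _ => P, fun _ => K, rfl, rfl, by simp, fun v => continuousOn_const, by simp,
      by simp, fun t _ => ⟨subset_rfl, hK, hP⟩, rfl⟩
  | @cons K K₁ K' P P₁ P' m ms hs h' ih =>
    obtain ⟨q, κ, q0, q1, hm, hc, hd, hκ, hI, κ1⟩ := ih hs.isAligned' hs.inv'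
    have hP1 : m.pos par P 1 = P₁ := hs.eq.symm
    set Q : ℝ → ℕ → E4 := fun t => if t < 1 then m.pos par P t else q (t - 1) with hQ
    -- The aligned set jumps at the end of a move: at time `1` the new set is already in force,
    -- since `IsStep.inv` covers only times before `1`.
    set L : ℝ → Set ℕ := fun t => if t < 1 then K else κ (t - 1) with hL
    have Qlt : ∀ t, t ≤ 1 → Q t = m.pos par P t := by
      intro t ht
      rcases ht.lt_or_eq with ht | rfl
      · exact if_pos ht
      · rw [hQ]; dsimp only; rw [if_neg (lt_irrefl _), sub_self, q0, hP1]
    have Qge : ∀ t, 1 ≤ t → Q t = q (t - 1) := fun t ht => if_neg ht.not_gt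
    have Llt : ∀ t, t < 1 → L t = K := fun t ht => if_pos ht
    have Lge : ∀ t, 1 ≤ t → L t = κ (t - 1) := fun t ht => if_neg ht.not_gt
    have hlen : ((m :: ms).length : ℝ) = ms.length + 1 := by push_cast [List.length_cons]; ring
    have hlen0 : (0 : ℝ) ≤ ms.length := Nat.cast_nonneg _
    rw [hlen]
    have sh : ∀ t, t ∈ Set.Icc (0 : ℝ) (ms.length + 1) → 1 ≤ t →
        t - 1 ∈ Set.Icc (0 : ℝ) ms.length := fun t ht h1 => ⟨by linarith, by linarith [ht.2]⟩
    refine ⟨Q, L, ?_, ?_, ?_, ?_, ?_, ?_, ?_, ?_⟩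
    · rw [Qlt 0 zero_le_one, Turn.pos_zero]
    · rw [Qge _ (by linarith), add_sub_cancel_right, q1]
    · intro i m' hi
      cases i with
      | zero =>
        simp only [List.getElem?_cons_zero, Option.some.injEq] at hi
        subst hi
        refine ⟨⟨hs.pos, hs.le, hs.norm_e, hs.norm_f, hs.inner_eq, hs.neg_one_le, hs.le_one⟩,
          fun t ht => ?_⟩
        rw [Nat.cast_zero, zero_add, Qlt t ht.2, Qlt 0 zero_le_one, Turn.pos_zero]
      | succ i =>
        simp only [List.getElem?_cons_succ] at hi
        obtain ⟨h1, h2⟩ := hm i m' hi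
        refine ⟨h1, fun t ht => ?_⟩
        have hi0 : (0 : ℝ) ≤ i := Nat.cast_nonneg _
        rw [Qge _ (by push_cast; linarith [ht.1]), Qge _ (by push_cast; linarith), Nat.cast_succ,
          add_sub_cancel_right, ← h2 t ht]
        congr 1
        ring
    · intro v
      have e : Set.Icc (0 : ℝ) (ms.length + 1) =
          Set.Icc (0 : ℝ) 1 ∪ Set.Icc (1 : ℝ) ((ms.length : ℝ) + 1) :=
        (Set.Icc_union_Icc_eq_Icc zero_le_one (by linarith)).symm
      rw [e]
      refine ContinuousOn.union_of_isClosed ?_ ?_ isClosed_Icc isClosed_Icc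
      · exact (m.continuous_pos P v).continuousOn.congr fun t ht => by rw [Qlt t ht.2]
      · have : ContinuousOn (fun t => q (t - 1) v) (Set.Icc (1 : ℝ) (ms.length + 1)) :=
          (hc v).comp (by fun_prop) fun t ht => ⟨by linarith [ht.1], by linarith [ht.2]⟩
        exact this.congr fun t ht => by rw [Qge t ht.1]
    · intro t ht v
      rcases lt_or_ge t 1 with h1 | h1
      · rw [Qlt t h1.le, hs.dist_eq hp]
      · rw [Qge t h1, hd _ (sh t ht h1), ← hP1, hs.dist_eq hp]
    · intro s hs' t ht
      rcases lt_or_ge t 1 with h1 | h1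
      · rw [Llt t h1, Llt s (ht.1.trans_lt h1)]
      · rw [Lge t h1]
        have ht' := sh t ⟨hs'.1.trans ht.1, ht.2⟩ h1
        rcases lt_or_ge s 1 with h2 | h2
        · rw [Llt s h2]
          exact hs.sub.trans (hI _ ht').1
        · rw [Lge s h2]
          exact hκ _ (sh s hs' h2) _ ⟨by linarith [ht.1], ht'.2⟩
    · intro t ht
      rcases lt_or_ge t 1 with h1 | h1
      · rw [Llt t h1, Qlt t h1.le]
        exact ⟨subset_rfl, hs.isAligned, hs.inv t ht.1 h1⟩
      · rw [Lge t h1, Qge t h1]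
        obtain ⟨i1, i2, i3⟩ := hI _ (sh t ht h1)
        exact ⟨hs.sub.trans i1, i2, i3⟩
    · rw [Lge _ (by linarith), add_sub_cancel_right, κ1]

end

/-! ### The tree as a graph -/

/-- The depth of a vertex. -/
def depth (par : ℕ → ℕ) (v : ℕ) : ℕ := if par v < v then depth par (par v) + 1 else 0
termination_by v

theorem depth_zero (par : ℕ → ℕ) : depth par 0 = 0 := by rw [depth, if_neg (Nat.not_lt_zero _)]

theorem depth_of_pos {par : ℕ → ℕ} (hp : IsParentMap par) {v : ℕ} (hv : 0 < v) :
    depth par v = depth par (par v) + 1 := by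
  rw [depth, if_pos (hp.lt v hv)]

/-- The vertices of the graph `G` are numbered by `num`, and `par` is the parent map of the tree in
terms of the numbers; `ord` is the inverse of `num`. -/
structure IsNumbering {n : ℕ} (G : SimpleGraph (Fin (n + 1))) (par : ℕ → ℕ)
    (ord : ℕ → Fin (n + 1)) (num : Fin (n + 1) → ℕ) : Prop where
  isParentMap : IsParentMap par
  num_ord : ∀ i, i ≤ n → num (ord i) = i
  ord_num : ∀ v, ord (num v) = v
  num_le : ∀ v, num v ≤ n
  adj : ∀ u v, G.Adj u v ↔
    (0 < num v ∧ par (num v) = num u) ∨ (0 < num u ∧ par (num u) = num v)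

/-! ### Distances in the graph and the parent map -/

section

variable {n : ℕ} {G : SimpleGraph (Fin (n + 1))} {par : ℕ → ℕ} {ord : ℕ → Fin (n + 1)}
  {num : Fin (n + 1) → ℕ} (hN : IsNumbering G par ord num)
include hN

theorem IsNumbering.injective : Function.Injective num :=
  Function.LeftInverse.injective hN.ord_num

theorem IsNumbering.adj_ord_par {i : ℕ} (hi : 0 < i) (hin : i ≤ n) :
    G.Adj (ord (par i)) (ord i) := by
  rw [hN.adj, hN.num_ord i hin, hN.num_ord _ ((hN.isParentMap.le i).trans hin)]
  exact Or.inl ⟨hi, rfl⟩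

/-- One step of a walk raises the depth by at most one. If the bound is attained, every step goes
from a parent to a child, so the walk descends. -/
theorem IsNumbering.depth_le {u v : Fin (n + 1)} (w : G.Walk u v) :
    depth par (num v) ≤ depth par (num u) + w.length ∧
      (depth par (num v) = depth par (num u) + w.length → Desc par (num u) (num v)) := by
  induction w with
  | nil => exact ⟨le_rfl, fun _ => Desc.refl _ _⟩
  | @cons a b c hab w ih =>
    rw [SimpleGraph.Walk.length_cons]
    rcases (hN.adj a b).1 hab with ⟨h0, h1⟩ | ⟨h0, h1⟩
    · have := depth_of_pos hN.isParentMap h0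
      rw [h1] at this
      refine ⟨by omega, fun h => ?_⟩
      have h2 := ih.2 (by omega)
      refine Desc.trans ?_ h2
      rw [← h1]
      exact (Desc.refl _ _).of_par
    · have := depth_of_pos hN.isParentMap h0
      rw [h1] at this
      exact ⟨by omega, fun h => by omega⟩

variable (hG : G.Connected)
include hG

/-- The path of parents gives the upper bound, and `depth_le` the lower one. -/
theorem IsNumbering.dist_of_desc {u v : Fin (n + 1)} (h : Desc par (num u) (num v)) :
    G.dist u v + depth par (num u) = depth par (num v) := by
  apply le_antisymm
  · generalize hi : num v = i at h
    induction i using Nat.strong_induction_on generalizing v with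
    | _ i ih =>
      rcases eq_or_ne i (num u) with rfl | hne
      · rw [hN.injective hi, SimpleGraph.dist_self, zero_add]
      · have hi0 : 0 < i := by
          rcases Nat.eq_zero_or_pos i with rfl | h0
          · exact absurd (Nat.le_zero.1 (h.le hN.isParentMap)).symm hne
          · exact h0
        have hin : i ≤ n := hi ▸ hN.num_le v
        have hlt := hN.isParentMap.lt i hi0
        have h1 := ih _ hlt (v := ord (par i)) (hN.num_ord _ (hlt.le.trans hin))
          ((desc_iff.1 h).resolve_left hne)
        have h2 : G.Adj (ord (par i)) v := by
          have := hN.adj_ord_par hi0 hin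
          rwa [← hi, hN.ord_num, hi] at this
        have h3 := hG.dist_triangle (u := u) (v := ord (par i)) (w := v)
        rw [SimpleGraph.dist_eq_one_iff_adj.2 h2] at h3
        rw [depth_of_pos hN.isParentMap hi0]
        omega
  · obtain ⟨w, hw⟩ := hG.exists_walk_length_eq_dist u v
    have := (hN.depth_le w).1
    omega

theorem IsNumbering.dist_root (v : Fin (n + 1)) : G.dist (ord 0) v = depth par (num v) := by
  have h0 : num (ord 0) = 0 := hN.num_ord 0 (Nat.zero_le _)
  have := hN.dist_of_desc hG (u := ord 0) (v := v) (by rw [h0]; exact Desc.zero hN.isParentMap _)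
  rwa [h0, depth_zero, add_zero] at this

theorem IsNumbering.anc_iff {u v : Fin (n + 1)} :
    Anc G (ord 0) u v ↔ Desc par (num u) (num v) := by
  rw [Anc, hN.dist_root hG, hN.dist_root hG]
  constructor
  · intro h
    obtain ⟨w, hw⟩ := hG.exists_walk_length_eq_dist u v
    exact (hN.depth_le w).2 (by omega)
  · intro h
    have := hN.dist_of_desc hG h
    omega

theorem IsNumbering.isParent_iff {u v : Fin (n + 1)} :
    IsParent G (ord 0) u v ↔ 0 < num v ∧ par (num v) = num u := by
  rw [IsParent, hN.dist_root hG, hN.dist_root hG, hN.adj]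
  constructor
  · rintro ⟨h | ⟨h0, h1⟩, hd⟩
    · exact h
    · have := depth_of_pos hN.isParentMap h0
      rw [h1] at this
      omega
  · rintro ⟨h0, h1⟩
    have := depth_of_pos hN.isParentMap h0
    rw [h1] at this
    exact ⟨Or.inl ⟨h0, h1⟩, this⟩

theorem IsNumbering.beyond_iff {a b v : Fin (n + 1)} (hb : 0 < num b) (hab : par (num b) = num a) :
    Beyond G a b v ↔ Desc par (num b) (num v) := by
  rw [Beyond]
  constructor
  · intro h
    by_contra hd
    -- A walk that leaves the subtree of `b` has to pass through `a`, so it is longer than the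
    -- distance from `a` to its end.
    have key : ∀ {y v : Fin (n + 1)} (w : G.Walk y v), Desc par (num b) (num y) →
        ¬ Desc par (num b) (num v) → G.dist a v + 1 ≤ w.length := by
      intro y v w
      induction w with
      | nil => intro h h'; exact absurd h h'
      | @cons c d v hcd w ih =>
        intro h h'
        rw [SimpleGraph.Walk.length_cons]
        by_cases hd : Desc par (num b) (num d)
        · have := ih hd h'
          omega
        · have hda : d = a := by
            rcases (hN.adj c d).1 hcd with ⟨h0, h1⟩ | ⟨h0, h1⟩
            · exact absurd (Desc.of_par (h1 ▸ h)) hd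
            · rcases desc_iff.1 h with e | e
              · apply hN.injective
                rw [← h1, e, hab]
              · exact absurd (h1 ▸ e) hd
          subst hda
          have := SimpleGraph.dist_le w
          omega
    obtain ⟨w, hw⟩ := hG.exists_walk_length_eq_dist b v
    have := key w (Desc.refl _ _) hd
    omega
  · intro h
    have h1 := hN.dist_of_desc hG h
    have h2 := hN.dist_of_desc hG (u := a) (v := v) (by
      rw [← hab]
      exact Desc.trans (Desc.of_par (Desc.refl _ _)) h)
    have h3 := depth_of_pos hN.isParentMap hb
    rw [hab] at h3
    omega

end

/-! ### From sequences of rotations to moves -/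

/-- A rotation as a move. -/
def Turn.toMove {V : Type} (par : ℕ → ℕ) (ord : ℕ → V) (m : Turn) : Move V :=
  ⟨ord (par m.b), ord m.b, ord m.b, m.e, m.f, m.cosAngle⟩

section

variable {n : ℕ} {G : SimpleGraph (Fin (n + 1))} {par : ℕ → ℕ} {ord : ℕ → Fin (n + 1)}
  {num : Fin (n + 1) → ℕ} (hN : IsNumbering G par ord num)
include hN

/-- With no aligned vertex every vertex is its own top, so `Inv` for `∅` asks for all pairs of edges
to be clean, as simplicity provides. -/
theorem IsNumbering.inv_of_isSimple {p : Fin (n + 1) → E4} (hs : IsSimple G p) {P : ℕ → E4}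
    (hP : ∀ v, P (num v) = p v) : Inv par n ∅ P := by
  have hord : ∀ i, i ≤ n → P i = p (ord i) := fun i hi => by rw [← hP, hN.num_ord i hi]
  refine ⟨fun v hv hvn => ?_, fun v _ h => absurd h (Set.notMem_empty _), ?_⟩
  · rw [hord v hvn, hord _ ((hN.isParentMap.le v).trans hvn)]
    exact (hs.1 _ _ (hN.adj_ord_par hv hvn)).symm
  · intro v₁ v₂ h1 h1n h2 h2n hne _
    have h1p := (hN.isParentMap.le v₁).trans h1n
    have h2p := (hN.isParentMap.le v₂).trans h2n
    have hinj : ∀ i j, i ≤ n → j ≤ n → ord i = ord j → i = j := fun i j hi hj h => by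
      rw [← hN.num_ord i hi, h, hN.num_ord j hj]
    -- Two vertices cannot be each other's parents, as parents have smaller numbers; so different
    -- lower ends give different edges.
    have hc := hs.2 _ _ _ _ (hN.adj_ord_par h1 h1n) (hN.adj_ord_par h2 h2n) (by
      rw [Ne, Sym2.eq_iff]
      rintro (⟨-, h⟩ | ⟨h, h'⟩)
      · exact hne (hinj _ _ h1n h2n h)
      · have e1 := hinj _ _ h1p h2n h
        have e2 := hinj _ _ h1n h2p h'
        have := hN.isParentMap.lt _ h1
        have := hN.isParentMap.lt _ h2
        omega)
    rintro y ⟨hy1, hy2⟩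
    rw [hord _ h1n, hord _ h1p] at hy1
    rw [hord _ h2n, hord _ h2p] at hy2
    obtain ⟨u, ⟨hu, hu'⟩, rfl⟩ := hc ⟨hy1, hy2⟩
    refine ⟨num u, ⟨?_, ?_⟩, hP u⟩
    · rcases hu with rfl | rfl
      · exact Or.inl (hN.num_ord _ h1p)
      · exact Or.inr (hN.num_ord _ h1n)
    · rcases hu' with rfl | rfl
      · exact Or.inl (hN.num_ord _ h2p)
      · exact Or.inr (hN.num_ord _ h2n)

theorem IsNumbering.clean_comp {P : ℕ → E4} {u₁ v₁ u₂ v₂ : Fin (n + 1)}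
    (h : Clean P (num u₁) (num v₁) (num u₂) (num v₂)) :
    Clean (fun v => P (num v)) u₁ v₁ u₂ v₂ := by
  intro y hy
  obtain ⟨i, ⟨hi, hi'⟩, rfl⟩ := h hy
  have hmem : ∀ {a b : Fin (n + 1)}, i ∈ ({num a, num b} : Set ℕ) → ord i ∈ ({a, b} : Set _) ∧
      num (ord i) = i := by
    rintro a b (rfl | rfl)
    · rw [hN.ord_num]; exact ⟨Or.inl rfl, rfl⟩
    · rw [hN.ord_num]; exact ⟨Or.inr rfl, rfl⟩
  exact ⟨ord i, ⟨(hmem hi).1, (hmem hi').1⟩, by dsimp only; rw [(hmem hi).2]⟩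

variable (hG : G.Connected)
include hG

/-- The common ancestor is the upper end of the common top edge, and the common ray is that of this
edge: all edges from there down to `v₁` and to `v₂` belong to the chain. -/
theorem IsNumbering.coalesced {K : Set ℕ} {P : ℕ → E4} (hK : IsAligned par K)
    (hP : Inv par n K P) {v₁ v₂ : Fin (n + 1)} (h1 : 0 < num v₁)
    (h : top par K (num v₁) = top par K (num v₂)) :
    Coalesced G (ord 0) (fun v => P (num v)) v₁ v₂ := by
  have hp := hN.isParentMap
  obtain ⟨t, ht⟩ : ∃ t, t = top par K (num v₁) := ⟨_, rfl⟩
  rw [← ht] at h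
  have ht0 : 0 < t := ht ▸ top_pos hp hK h1
  have d1 : Desc par t (num v₁) := ht ▸ desc_top hp hK _
  have d2 : Desc par t (num v₂) := by rw [h]; exact desc_top hp hK _
  have htn : t ≤ n := (d1.le hp).trans (hN.num_le _)
  have hx : num (ord (par t)) = par t := hN.num_ord _ ((hp.le t).trans htn)
  have dt : Desc par (par t) t := (Desc.refl _ _).of_par
  have hdir : ∀ i, i ≤ n → edgeDir par P i = edgeDir par P (top par K i) := by
    intro i
    induction i using top_induction hp hK with
    | base v hv => intro _; rw [top_of_notMem hv]
    | step v hv ih =>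
      intro hvn
      rw [top_of_mem hp hK hv, hP.aligned v hvn hv, ih ((hp.le v).trans hvn)]
  have hne : ∀ v : Fin (n + 1), Desc par t (num v) → ord (par t) ≠ v := by
    rintro v hd rfl
    rw [hx] at hd
    exact not_desc_par hp ht0 hd
  refine ⟨ord (par t), edgeDir par P t, hP.norm_edgeDir ht0 htn, ?_, hne _ d1, ?_, hne _ d2, ?_⟩
  · rw [hN.anc_iff hG, hx]; exact dt.trans d1
  · rw [hN.anc_iff hG, hx]; exact dt.trans d2
  · intro u v huv hxu hv
    rw [hN.isParent_iff hG] at huv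
    rw [hN.anc_iff hG, hx] at hxu
    have key : ∀ w, Desc par t w → top par K w = t → Desc par (num v) w →
        edgeDir par P (num v) = edgeDir par P t := by
      intro w hw htw hvw
      have htv : Desc par t (num v) := by
        rcases hw.comparable hvw with h | h
        · exact h
        · rcases desc_iff.1 h with h | h
          · rw [h]; exact Desc.refl _ _
          -- An edge above the top edge would have its upper end strictly above `par t`, against
          -- `hxu`.
          · exfalso
            have e1 := h.le hp
            have e2 := hxu.le hp
            have e3 := hp.lt _ huv.1
            rw [huv.2] at e3
            omega
      have htop : top par K (num v) = t := by
        have : ∀ w, Desc par (num v) w → top par K w = t → Desc par t (num v) →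
            top par K (num v) = t := by
          intro w
          induction w using Nat.strong_induction_on with
          | _ w ih =>
            intro h1 h2 h3
            rcases desc_iff.1 h1 with rfl | h4
            · exact h2
            · by_cases hwK : w ∈ K
              · rw [top_of_mem hp hK hwK] at h2
                exact ih _ (hp.lt w (hp.pos_of_pos (hK w hwK))) h4 h2 h3
              · rw [top_of_notMem hwK] at h2
                have e1 := h1.le hp
                have e2 := h3.le hp
                have e3 : num v = t := by omega
                rw [e3]
                exact top_of_notMem (h2 ▸ hwK)
        exact this w hvw htw htv
      rw [hdir _ (hN.num_le v), htop]
    have hd : edgeDir par P (num v) = edgeDir par P t := by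
      rcases hv with hv | hv
      · exact key _ d1 ht.symm ((hN.anc_iff hG).1 hv)
      · exact key _ d2 h.symm ((hN.anc_iff hG).1 hv)
    rw [PointsAlong, ← hd, ← huv.2]
    conv_lhs => rw [edgeDir_smul par P (num v)]
    rw [add_sub_cancel_left]

theorem IsNumbering.toMove_pos {m : Turn} (h0 : 0 < m.b) (hn : m.b ≤ n) (P : ℕ → E4) (t : ℝ)
    (v : Fin (n + 1)) :
    (m.toMove par ord).pos G (fun v => P (num v)) t v = m.pos par P t (num v) := by
  have e1 : num (ord m.b) = m.b := hN.num_ord _ hn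
  have e2 : num (ord (par m.b)) = par m.b := hN.num_ord _ ((hN.isParentMap.le _).trans hn)
  have hb : Beyond G (ord (par m.b)) (ord m.b) v ↔ Desc par m.b (num v) := by
    have := hN.beyond_iff hG (a := ord (par m.b)) (b := ord m.b) (v := v) (by rwa [e1])
      (by rw [e1, e2])
    rwa [e1] at this
  by_cases h : Desc par m.b (num v)
  · have hB : Beyond G (m.toMove par ord).a (m.toMove par ord).b v := hb.2 h
    rw [Move.pos, if_neg (not_not.2 hB),
      if_pos (show (m.toMove par ord).c = (m.toMove par ord).b ∨ _ from Or.inl rfl), Turn.pos,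
      rotAt_of_desc h, ← e2]
    rfl
  · have hB : ¬ Beyond G (m.toMove par ord).a (m.toMove par ord).b v := fun h' => h (hb.1 h')
    rw [Move.pos, if_pos hB, Turn.pos, rotAt_of_not_desc h]

theorem IsNumbering.straightens (hleaf : IsLeaf G (ord 0)) {p : Fin (n + 1) → E4}
    {P P' : ℕ → E4} (hs : IsSimple G p) (hP : ∀ v, P (num v) = p v) {ms : List Turn} {K : Set ℕ}
    (h : Reach par n ∅ P ms K P') (hK : ∀ v, v ≤ n → 0 < par v → v ∈ K) :
    Straightens G p (ms.map (Turn.toMove par ord)) := by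
  have hp := hN.isParentMap
  obtain ⟨q, κ, q0, q1, hm, hc, hd, hκ, hI, κ1⟩ :=
    h.exists_motion hp (fun v hv => absurd hv (Set.notMem_empty v)) (hN.inv_of_isSimple hs hP)
  refine ⟨ord 0, hleaf, fun t v => q t (num v), ?_, ⟨?_, ?_, ?_, ?_⟩, ?_, ?_⟩
  · funext v
    dsimp only
    rw [q0, hP]
  · intro v
    rw [List.length_map]
    exact hc (num v)
  · intro t ht u v huv
    rw [List.length_map] at ht
    rw [q0]
    rcases (hN.adj u v).1 huv with ⟨-, h1⟩ | ⟨-, h1⟩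
    · rw [← h1]; exact hd t ht _
    · rw [← h1, dist_comm, hd t ht, dist_comm]
  · intro t ht u₁ v₁ u₂ v₂ h1 h2 hne
    rw [List.length_map] at ht
    rw [hN.isParent_iff hG] at h1 h2
    obtain ⟨-, hA, hIn⟩ := hI t ht
    by_cases htop : top par (κ t) (num v₁) = top par (κ t) (num v₂)
    · exact Or.inr (hN.coalesced hG hA hIn h1.1 htop)
    · left
      apply hN.clean_comp
      rw [← h1.2, ← h2.2]
      exact hIn.clean _ _ h1.1 (hN.num_le _) h2.1 (hN.num_le _)
        (fun e => hne (hN.injective e)) htop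
  · intro s hs' t ht u₁ v₁ u₂ v₂ h1 h2 hne hncl
    rw [List.length_map] at hs' ht
    rw [hN.isParent_iff hG] at h1 h2
    obtain ⟨-, hA, hIn⟩ := hI s hs'
    obtain ⟨-, hA', hIn'⟩ := hI t ⟨hs'.1.trans ht.1, ht.2⟩
    have htop : top par (κ s) (num v₁) = top par (κ s) (num v₂) := by
      by_contra htop
      apply hncl
      apply hN.clean_comp
      rw [← h1.2, ← h2.2]
      exact hIn.clean _ _ h1.1 (hN.num_le _) h2.1 (hN.num_le _)
        (fun e => hne (hN.injective e)) htop
    refine hN.coalesced hG hA' hIn' h1.1 ?_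
    -- The aligned sets grow with time, so equal tops at time `s` remain equal at time `t`.
    have hsub := hκ s hs' t ht
    rw [← top_top hp hA hA' hsub, htop, top_top hp hA hA' hsub]
  · intro i m hi
    rw [List.getElem?_map, Option.map_eq_some_iff] at hi
    obtain ⟨m', hi, rfl⟩ := hi
    obtain ⟨⟨h0, hn, he, hf, hef, hc1, hc2⟩, hpos⟩ := hm i m' hi
    refine ⟨⟨hN.adj_ord_par h0 hn, Or.inl rfl, he, hf, hef, hc1, hc2⟩, fun t ht => ?_⟩
    funext v
    dsimp only
    rw [hN.toMove_pos hG h0 hn, hpos t ht]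
  · obtain ⟨-, hA, hIn⟩ := hI ms.length ⟨Nat.cast_nonneg _, le_rfl⟩
    rw [List.length_map]
    obtain ⟨w, hw, huniq⟩ := hleaf
    have hz : num (ord 0) = 0 := hN.num_ord 0 (Nat.zero_le _)
    have hw0 : 0 < num w := by
      rw [hN.adj, hz] at hw
      rcases hw with h | h
      · exact h.1
      · exact absurd h.1 (lt_irrefl _)
    refine ⟨edgeDir par (q ms.length) (num w), hIn.norm_edgeDir hw0 (hN.num_le w), ?_⟩
    have hdir : ∀ i, 0 < i → i ≤ n →
        edgeDir par (q ms.length) i = edgeDir par (q ms.length) (num w) := by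
      intro i
      induction i using Nat.strong_induction_on with
      | _ i ih =>
        intro hi hin
        -- Because the root is a leaf, only one edge starts from it. Every other edge is aligned and
        -- inherits the direction of its parent edge.
        rcases Nat.eq_zero_or_pos (par i) with h0 | h0
        · have : ord i = w := huniq _ (by
            have := hN.adj_ord_par hi hin
            rwa [h0] at this)
          rw [← this, hN.num_ord i hin]
        · rw [hIn.aligned i hin (κ1 ▸ hK i hin h0)]
          exact ih _ (hp.lt i hi) h0 ((hp.le i).trans hin)
    intro u v huv
    rw [hN.isParent_iff hG] at huv
    rw [PointsAlong, ← hdir _ huv.1 (hN.num_le v)]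
    beta_reduce
    rw [← huv.2]
    conv_lhs => rw [edgeDir_smul par (q ms.length) (num v)]
    rw [add_sub_cancel_left]

end

/-! ### A program logic for the real RAM -/

/-- Started in `σ`, the program `c` halts after at most `T` steps in a state that satisfies `Q`. -/
def Does (S : ℕ) (c : Cmd) (σ : State) (T : ℕ) (Q : State → Prop) : Prop :=
  ∃ T' τ, Exec S c σ T' τ ∧ T' ≤ T ∧ Q τ

/-- Overwrite a cell of an integer array. -/
def State.setInt (σ : State) (k i x : ℕ) : State := { σ with ints := update σ.ints k i x }

/-- Overwrite a cell of a real array. -/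
def State.setReal (σ : State) (k i : ℕ) (x : ℝ) : State := { σ with reals := update σ.reals k i x }

@[simp] theorem State.setInt_reals (σ : State) (k i x : ℕ) : (σ.setInt k i x).reals = σ.reals := rfl
@[simp] theorem State.setInt_out (σ : State) (k i x : ℕ) : (σ.setInt k i x).out = σ.out := rfl
@[simp] theorem State.setReal_ints (σ : State) (k i : ℕ) (x : ℝ) :
    (σ.setReal k i x).ints = σ.ints := rfl
@[simp] theorem State.setReal_out (σ : State) (k i : ℕ) (x : ℝ) :
    (σ.setReal k i x).out = σ.out := rfl

theorem State.setInt_ints_self (σ : State) (k i x : ℕ) : (σ.setInt k i x).ints k i = x := by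
  simp [State.setInt, update]

theorem State.setInt_ints_of_ne (σ : State) {k i x k' : ℕ} (h : k' ≠ k) :
    (σ.setInt k i x).ints k' = σ.ints k' := by
  funext i'
  simp [State.setInt, update, h]

theorem State.setInt_ints_of_ne' (σ : State) {k i x i' : ℕ} (h : i' ≠ i) :
    (σ.setInt k i x).ints k i' = σ.ints k i' := by
  simp [State.setInt, update, h]

theorem State.setReal_reals_self (σ : State) (k i : ℕ) (x : ℝ) :
    (σ.setReal k i x).reals k i = x := by
  simp [State.setReal, update]

theorem State.setReal_reals_of_ne (σ : State) {k i k' : ℕ} {x : ℝ} (h : k' ≠ k) :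
    (σ.setReal k i x).reals k' = σ.reals k' := by
  funext i'
  simp [State.setReal, update, h]

/-! ### Rules for the single commands and for loops -/

section

variable {S : ℕ} {σ : State} {Q : State → Prop}

theorem Does.mono {c : Cmd} {T T' : ℕ} {Q' : State → Prop} (h : Does S c σ T Q) (hT : T ≤ T')
    (hQ : ∀ τ, Q τ → Q' τ) : Does S c σ T' Q' := by
  obtain ⟨t, τ, he, ht, hq⟩ := h
  exact ⟨t, τ, he, ht.trans hT, hQ τ hq⟩

theorem does_skip (h : Q σ) : Does S .skip σ 1 Q := ⟨1, σ, .skip σ, le_rfl, h⟩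

theorem does_setI {k : ℕ} {i x : IExpr} (hi : i.eval σ < S) (hx : x.eval σ ≤ S)
    (h : Q (σ.setInt k (i.eval σ) (x.eval σ))) : Does S (.setI k i x) σ 1 Q :=
  ⟨1, _, .setI σ k i x hi hx, le_rfl, h⟩

theorem does_setR {k : ℕ} {i : IExpr} {x : RExpr} (hi : i.eval σ < S)
    (h : Q (σ.setReal k (i.eval σ) (x.eval σ))) : Does S (.setR k i x) σ 1 Q :=
  ⟨1, _, .setR σ k i x hi, le_rfl, h⟩

theorem does_emit {a b c : IExpr} {e f : Fin 4 → RExpr} {x : RExpr}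
    (h : Q { σ with out := σ.out ++ [emitted σ a b c e f x] }) :
    Does S (.emit a b c e f x) σ 1 Q :=
  ⟨1, _, .emit σ a b c e f x, le_rfl, h⟩

theorem Does.seq {c c' : Cmd} {T T' : ℕ} {Q' : State → Prop} (h : Does S c σ T Q')
    (h' : ∀ τ, Q' τ → Does S c' τ T' Q) : Does S (.seq c c') σ (T + T') Q := by
  obtain ⟨t, τ, he, ht, hq⟩ := h
  obtain ⟨t', υ, he', ht', hq'⟩ := h' τ hq
  exact ⟨t + t', υ, .seq _ _ _ _ _ _ _ he he', add_le_add ht ht', hq'⟩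

theorem does_ite {b : BExpr} {c c' : Cmd} {T : ℕ} (h : b.Holds σ → Does S c σ T Q)
    (h' : ¬ b.Holds σ → Does S c' σ T Q) : Does S (.ite b c c') σ (T + 1) Q := by
  by_cases hb : b.Holds σ
  · obtain ⟨t, τ, he, ht, hq⟩ := h hb
    exact ⟨t + 1, τ, .ite_true _ _ _ _ _ _ hb he, by omega, hq⟩
  · obtain ⟨t, τ, he, ht, hq⟩ := h' hb
    exact ⟨t + 1, τ, .ite_false _ _ _ _ _ _ hb he, by omega, hq⟩

/-- The scalar integer variable `k` is cell `0` of the integer array `k`. -/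
def ivar (k : ℕ) : IExpr := .get k (.lit 0)

/-- The scalar real variable `k` is cell `0` of the real array `k`. -/
def rvar (k : ℕ) : RExpr := .get k (.lit 0)

@[simp] theorem eval_lit (x : ℕ) : (IExpr.lit x).eval σ = x := rfl
@[simp] theorem eval_ivar (k : ℕ) : (ivar k).eval σ = σ.ints k 0 := rfl
@[simp] theorem eval_rvar (k : ℕ) : (rvar k).eval σ = σ.reals k 0 := rfl

/-- Run `body` with the variable `k` from `lo` to `hi - 1`. -/
def forLoop (k : ℕ) (lo hi : IExpr) (body : Cmd) : Cmd :=
  .seq (.setI k (.lit 0) lo)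
    (.while (.ilt (ivar k) hi) (.seq body (.setI k (.lit 0) (.add (ivar k) (.lit 1)))))

/-- `I j` holds at the head of the loop when the counter has just been set to `j`. Each round pays
`2` beyond the body, for a test and an increment; the final `2` pays for the initialization and the
failing test. The upper bound is evaluated anew in each round, hence `hhi`. -/
theorem does_forLoop {I : ℕ → State → Prop} {k a N : ℕ} {lo hi : IExpr} {body : Cmd}
    (cost : ℕ → ℕ) (hlo : lo.eval σ = a) (haN : a ≤ N) (hN : N ≤ S) (hS : 0 < S)
    (hhi : ∀ j τ, I j τ → hi.eval τ = N) (h0 : I a (σ.setInt k 0 a))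
    (step : ∀ j τ, a ≤ j → j < N → I j τ → τ.ints k 0 = j →
      Does S body τ (cost j) (fun υ => υ.ints k 0 = j ∧ I (j + 1) (υ.setInt k 0 (j + 1))))
    (hQ : ∀ τ, I N τ → Q τ) :
    Does S (forLoop k lo hi body) σ (∑ j ∈ Finset.Ico a N, (cost j + 2) + 2) Q := by
  have main : ∀ d j τ, a ≤ j → j + d = N → I j τ → τ.ints k 0 = j →
      Does S (.while (.ilt (ivar k) hi) (.seq body (.setI k (.lit 0) (.add (ivar k) (.lit 1)))))
        τ (∑ j ∈ Finset.Ico j N, (cost j + 2) + 1) Q := by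
    intro d
    induction d with
    | zero =>
      intro j τ _ hj hI hk
      have hjN : j = N := by omega
      subst hjN
      refine ⟨1, τ, .while_false _ _ _ ?_, by simp, hQ τ hI⟩
      simp only [BExpr.Holds, eval_ivar, hk, hhi _ _ hI, lt_irrefl, not_false_eq_true]
    | succ d ih =>
      intro j τ ha hj hI hk
      have hjN : j < N := by omega
      obtain ⟨t, υ, he, ht, hυk, hυI⟩ := step j τ ha hjN hI hk
      obtain ⟨t', ω, he', ht', hω⟩ := ih (j + 1) _ (by omega) (by omega) hυI
        (State.setInt_ints_self _ _ _ _)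
      have hset : Exec S (.setI k (.lit 0) (.add (ivar k) (.lit 1))) υ 1
          (υ.setInt k 0 (j + 1)) := by
        have := Exec.setI (S := S) υ k (.lit 0) (.add (ivar k) (.lit 1)) hS
          (by simp only [IExpr.eval, eval_ivar, hυk]; omega)
        simpa only [IExpr.eval, eval_ivar, hυk, State.setInt] using this
      refine ⟨t + 1 + t' + 1, ω, .while_true _ _ _ _ _ _ _ ?_ (.seq _ _ _ _ _ _ _ he hset) he',
        ?_, hω⟩
      · simp only [BExpr.Holds, eval_ivar, hk, hhi _ _ hI, hjN]
      · rw [Finset.sum_eq_sum_Ico_succ_bot hjN]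
        omega
  refine (Does.seq (Q' := fun τ => τ = σ.setInt k 0 a) (T := 1)
    (does_setI hS (by rw [hlo]; exact haN.trans hN) (by rw [hlo]; rfl)) ?_).mono
    (T := 1 + (∑ j ∈ Finset.Ico a N, (cost j + 2) + 1)) (by omega) (fun _ h => h)
  rintro τ rfl
  exact main (N - a) a _ le_rfl (by omega) h0 (State.setInt_ints_self _ _ _ _)

theorem does_forLoop_const {I : ℕ → State → Prop} {k a N : ℕ} {lo hi : IExpr} {body : Cmd}
    (c : ℕ) (hlo : lo.eval σ = a) (haN : a ≤ N) (hN : N ≤ S) (hS : 0 < S)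
    (hhi : ∀ j τ, I j τ → hi.eval τ = N) (h0 : I a (σ.setInt k 0 a))
    (step : ∀ j τ, a ≤ j → j < N → I j τ → τ.ints k 0 = j →
      Does S body τ c (fun υ => υ.ints k 0 = j ∧ I (j + 1) (υ.setInt k 0 (j + 1))))
    (hQ : ∀ τ, I N τ → Q τ) :
    Does S (forLoop k lo hi body) σ ((N - a) * (c + 2) + 2) Q := by
  have := does_forLoop (Q := Q) (fun _ => c) hlo haN hN hS hhi h0 step hQ
  simpa using this

end

/-! ### Vectors -/

/-- Expressions for vectors. -/
abbrev VExpr : Type := Fin 4 → RExpr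

/-- The vector in cell `i` of the real arrays `k, …, k + 3`. -/
def vecAt (σ : State) (k i : ℕ) : E4 := WithLp.toLp 2 fun j : Fin 4 => σ.reals (k + j) i

/-- Value of a vector expression. -/
def VExpr.eval (σ : State) (V : VExpr) : E4 := WithLp.toLp 2 fun j => (V j).eval σ

/-- See `vecAt`. -/
def vget (k : ℕ) (i : IExpr) : VExpr := fun j => .get (k + j) i

/-- The vector variable `k`. -/
def vvar (k : ℕ) : VExpr := vget k (.lit 0)

/-- Sum. -/
def VExpr.add (V W : VExpr) : VExpr := fun j => .add (V j) (W j)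

/-- Difference. -/
def VExpr.sub (V W : VExpr) : VExpr := fun j => .sub (V j) (W j)

/-- Scalar multiple. -/
def VExpr.smul (r : RExpr) (V : VExpr) : VExpr := fun j => .mul r (V j)

/-- Inner product. -/
def VExpr.dot (V W : VExpr) : RExpr :=
  .add (.add (.add (.mul (V 0) (W 0)) (.mul (V 1) (W 1))) (.mul (V 2) (W 2))) (.mul (V 3) (W 3))

/-- Norm. -/
def VExpr.norm (V : VExpr) : RExpr := .sqrt (V.dot V)

/-- A standard basis vector. -/
def VExpr.axis (i : Fin 4) : VExpr := fun j => if j = i then .one else .zero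

/-- The zero vector. -/
def VExpr.zero : VExpr := fun _ => .zero

/-- See `dirVec`. -/
def VExpr.dir (V : VExpr) : VExpr := .smul (.div .one V.norm) V

/-- See `rej`. -/
def VExpr.rej (d y : VExpr) : VExpr := y.sub (.smul (.div (d.dot y) (d.dot d)) d)

/-- See `planeRot`. -/
def VExpr.planeRot (e f : VExpr) (c : RExpr) (x : VExpr) : VExpr :=
  (x.add (.smul (.sub (.mul (.sub c .one) (e.dot x))
    (.mul (.sqrt (.sub .one (.mul c c))) (f.dot x))) e)).add
  (.smul (.add (.mul (.sqrt (.sub .one (.mul c c))) (e.dot x)) (.mul (.sub c .one) (f.dot x))) f)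

/-! ### Values of vector expressions -/

section

variable (σ : State)

@[simp] theorem eval_vget (k : ℕ) (i : IExpr) : (vget k i).eval σ = vecAt σ k (i.eval σ) := rfl

@[simp] theorem eval_vvar (k : ℕ) : (vvar k).eval σ = vecAt σ k 0 := rfl

@[simp] theorem VExpr.eval_add (V W : VExpr) : (V.add W).eval σ = V.eval σ + W.eval σ := rfl

@[simp] theorem VExpr.eval_sub (V W : VExpr) : (V.sub W).eval σ = V.eval σ - W.eval σ := rfl

@[simp] theorem VExpr.eval_smul (r : RExpr) (V : VExpr) :
    (VExpr.smul r V).eval σ = r.eval σ • V.eval σ := rfl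

@[simp] theorem VExpr.eval_zero : VExpr.zero.eval σ = 0 := rfl

@[simp] theorem VExpr.eval_dot (V W : VExpr) :
    (V.dot W).eval σ = inner ℝ (V.eval σ) (W.eval σ) := by
  rw [PiLp.inner_apply, Fin.sum_univ_four]
  simp only [VExpr.dot, RExpr.eval, VExpr.eval]
  simp only [RCLike.inner_apply, conj_trivial]
  ring

@[simp] theorem VExpr.eval_norm (V : VExpr) : V.norm.eval σ = ‖V.eval σ‖ := by
  rw [VExpr.norm, RExpr.eval, VExpr.eval_dot, norm_eq_sqrt_real_inner]

@[simp] theorem VExpr.eval_axis (i : Fin 4) :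
    (VExpr.axis i).eval σ = EuclideanSpace.single i 1 := by
  ext j
  by_cases h : j = i <;> simp [VExpr.axis, VExpr.eval, RExpr.eval, h]

@[simp] theorem VExpr.eval_dir (V : VExpr) : V.dir.eval σ = dirVec (V.eval σ) := by
  rw [VExpr.dir, VExpr.eval_smul, RExpr.eval, VExpr.eval_norm, RExpr.eval, dirVec, one_div]

@[simp] theorem VExpr.eval_rej (V W : VExpr) :
    (V.rej W).eval σ = TreeStraightening.rej (V.eval σ) (W.eval σ) := by
  simp only [VExpr.rej, VExpr.eval_sub, VExpr.eval_smul, RExpr.eval, VExpr.eval_dot,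
    TreeStraightening.rej]

/-- An angle in `[0, π]` has a nonnegative sine, so the machine can recover it as a square root from
the cosine, without trigonometry. -/
theorem VExpr.eval_planeRot (e f x : VExpr) (c : RExpr) (h1 : -1 ≤ c.eval σ)
    (h2 : c.eval σ ≤ 1) : (VExpr.planeRot e f c x).eval σ =
      TreeStraightening.planeRot (e.eval σ) (f.eval σ) (Real.arccos (c.eval σ)) (x.eval σ) := by
  simp only [VExpr.planeRot, VExpr.eval_add, VExpr.eval_smul, RExpr.eval, VExpr.eval_dot,
    TreeStraightening.planeRot, Real.cos_arccos h1 h2, Real.sin_arccos, sq]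

end

/-- From `σ` to `τ`, the vector `y` was written to cell `i` of the real arrays `k, …, k + 3`;
nothing else was changed, save real arrays from number `1000` on. -/
structure WroteV (σ τ : State) (k i : ℕ) (y : E4) : Prop where
  ints : τ.ints = σ.ints
  out : τ.out = σ.out
  vec : vecAt τ k i = y
  reals : ∀ k', k' < 1000 → (k' < k ∨ k + 4 ≤ k') → τ.reals k' = σ.reals k'
  vec_ne : ∀ i', i' ≠ i → vecAt τ k i' = vecAt σ k i'

theorem WroteV.vecAt {σ τ : State} {k i : ℕ} {y : E4} (h : WroteV σ τ k i y) (k' i' : ℕ)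
    (hk : k' + 4 ≤ 1000) (hk' : k' + 4 ≤ k ∨ k + 4 ≤ k') : vecAt τ k' i' = vecAt σ k' i' := by
  ext j
  change τ.reals _ _ = σ.reals _ _
  rw [h.reals _ (by omega) (by omega)]

/-- Write a vector. The new value is put together in the real arrays `1000, …, 1003`. -/
def setV (k : ℕ) (i : IExpr) (V : VExpr) : Cmd :=
  .seq (.seq (.seq (.setR 1000 (.lit 0) (V 0)) (.setR 1001 (.lit 0) (V 1)))
    (.seq (.setR 1002 (.lit 0) (V 2)) (.setR 1003 (.lit 0) (V 3))))
  (.seq (.seq (.setR k i (rvar 1000)) (.setR (k + 1) i (rvar 1001)))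
    (.seq (.setR (k + 2) i (rvar 1002)) (.setR (k + 3) i (rvar 1003))))

theorem IExpr.eval_congr {σ τ : State} (h : τ.ints = σ.ints) (i : IExpr) :
    i.eval τ = i.eval σ := by
  induction i with
  | lit k => rfl
  | get k i ih => simp only [IExpr.eval, ih, h]
  | add x y hx hy => simp only [IExpr.eval, hx, hy]
  | sub x y hx hy => simp only [IExpr.eval, hx, hy]

/-- The vector expression does not read real arrays from number `1000` on. -/
def VExpr.IsLow (V : VExpr) : Prop :=
  ∀ σ τ : State, τ.ints = σ.ints → (∀ k, k < 1000 → τ.reals k = σ.reals k) →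
    ∀ j, (V j).eval τ = (V j).eval σ

/-- The condition is restated for values of scalar and vector variables, where the evaluation lemmas
apply and no component has to be unfolded. -/
theorem VExpr.isLow_of_eval {V : VExpr} (h : ∀ σ τ : State, τ.ints = σ.ints →
    (∀ k, k < 1000 → τ.reals k 0 = σ.reals k 0) →
    (∀ k i, k + 4 ≤ 1000 → vecAt τ k i = vecAt σ k i) → V.eval τ = V.eval σ) : V.IsLow := by
  intro σ τ h1 h2 j
  have := h σ τ h1 (fun k hk => by rw [h2 k hk]) (fun k i hk => by
    ext j
    change τ.reals _ _ = σ.reals _ _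
    rw [h2 _ (by omega)])
  exact congrArg (fun y : E4 => y j) this

theorem does_setV {S : ℕ} {σ : State} {Q : State → Prop} {k : ℕ} {i : IExpr} {V : VExpr}
    (hV : V.IsLow) (hk : k + 4 ≤ 1000) (hi : i.eval σ < S)
    (h : ∀ τ, WroteV σ τ k (i.eval σ) (V.eval σ) → Q τ) : Does S (setV k i V) σ 8 Q := by
  have hS : 0 < S := by omega
  set a := i.eval σ with ha
  set y : Fin 4 → ℝ := fun j => (V j).eval σ with hy
  let σ₁ := σ.setReal 1000 0 (y 0)
  let σ₂ := σ₁.setReal 1001 0 (y 1)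
  let σ₃ := σ₂.setReal 1002 0 (y 2)
  let σ₄ := σ₃.setReal 1003 0 (y 3)
  let σ₅ := σ₄.setReal k a (y 0)
  let σ₆ := σ₅.setReal (k + 1) a (y 1)
  let σ₇ := σ₆.setReal (k + 2) a (y 2)
  let σ₈ := σ₇.setReal (k + 3) a (y 3)
  have low : ∀ τ, τ.ints = σ.ints → (∀ k, k < 1000 → τ.reals k = σ.reals k) →
      ∀ j, (V j).eval τ = y j := fun τ => hV σ τ
  have step : ∀ (τ : State) (k : ℕ) (i : IExpr) (x : RExpr) (b : ℕ) (z : ℝ), i.eval τ = b → b < S →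
      x.eval τ = z → Exec S (.setR k i x) τ 1 (τ.setReal k b z) := by
    rintro τ k i x b z rfl hb rfl
    exact .setR τ k i x hb
  have hia : ∀ τ : State, τ.ints = σ.ints → i.eval τ = a := fun τ h => IExpr.eval_congr h i
  have hi' : i.eval σ < S := hi
  refine ⟨8, σ₈, ?_, le_rfl, h σ₈ ⟨rfl, rfl, ?_, ?_, ?_⟩⟩
  · have e1 : Exec S _ σ 1 σ₁ := step σ 1000 (.lit 0) (V 0) 0 (y 0) rfl hS rfl
    have e2 : Exec S _ σ₁ 1 σ₂ := step σ₁ 1001 (.lit 0) (V 1) 0 (y 1) rfl hS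
      (low σ₁ rfl (fun k hk => by
        funext i; simp only [σ₁, State.setReal, update]
        rw [if_neg (by omega)]) 1)
    have e3 : Exec S _ σ₂ 1 σ₃ := step σ₂ 1002 (.lit 0) (V 2) 0 (y 2) rfl hS
      (low σ₂ rfl (fun k hk => by
        funext i; simp only [σ₁, σ₂, State.setReal, update]
        rw [if_neg (by omega), if_neg (by omega)]) 2)
    have e4 : Exec S _ σ₃ 1 σ₄ := step σ₃ 1003 (.lit 0) (V 3) 0 (y 3) rfl hS
      (low σ₃ rfl (fun k hk => by
        funext i; simp only [σ₁, σ₂, σ₃, State.setReal, update]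
        rw [if_neg (by omega), if_neg (by omega), if_neg (by omega)]) 3)
    have e5 : Exec S _ σ₄ 1 σ₅ := step σ₄ k i (rvar 1000) a (y 0) (hia _ rfl) hi' (by
      simp [σ₁, σ₂, σ₃, σ₄, State.setReal, update])
    have e6 : Exec S _ σ₅ 1 σ₆ := step σ₅ (k + 1) i (rvar 1001) a (y 1) (hia _ rfl) hi' (by
      simp only [σ₁, σ₂, σ₃, σ₄, σ₅, State.setReal, update, eval_rvar]
      rw [if_neg (by omega)]; simp)
    have e7 : Exec S _ σ₆ 1 σ₇ := step σ₆ (k + 2) i (rvar 1002) a (y 2) (hia _ rfl) hi' (by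
      simp only [σ₁, σ₂, σ₃, σ₄, σ₅, σ₆, State.setReal, update, eval_rvar]
      rw [if_neg (by omega), if_neg (by omega)]; simp)
    have e8 : Exec S _ σ₇ 1 σ₈ := step σ₇ (k + 3) i (rvar 1003) a (y 3) (hia _ rfl) hi' (by
      simp only [σ₁, σ₂, σ₃, σ₄, σ₅, σ₆, σ₇, State.setReal, update, eval_rvar]
      rw [if_neg (by omega), if_neg (by omega), if_neg (by omega)]; simp)
    exact .seq _ _ _ _ _ _ _ (.seq _ _ _ _ _ _ _ (.seq _ _ _ _ _ _ _ e1 e2)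
      (.seq _ _ _ _ _ _ _ e3 e4)) (.seq _ _ _ _ _ _ _ (.seq _ _ _ _ _ _ _ e5 e6)
      (.seq _ _ _ _ _ _ _ e7 e8))
  · ext j
    change σ₈.reals (k + j) a = y j
    fin_cases j <;> simp [σ₈, σ₇, σ₆, σ₅, State.setReal, update]
  · intro k' hk' hne
    funext i'
    simp only [σ₁, σ₂, σ₃, σ₄, σ₅, σ₆, σ₇, σ₈, State.setReal, update]
    rw [if_neg (by omega), if_neg (by omega), if_neg (by omega), if_neg (by omega),
      if_neg (by omega), if_neg (by omega), if_neg (by omega), if_neg (by omega)]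
  · intro i' hne
    ext j
    change σ₈.reals (k + j) i' = σ.reals (k + j) i'
    simp only [σ₁, σ₂, σ₃, σ₄, σ₅, σ₆, σ₇, σ₈, State.setReal, update]
    rw [if_neg (by omega), if_neg (by omega), if_neg (by omega), if_neg (by omega),
      if_neg (by omega), if_neg (by omega), if_neg (by omega), if_neg (by omega)]

/-! ### The search for a vector in general position -/

/-- From `σ` to `τ`, no array with number below `L` and no output was changed. -/
structure Keep (L : ℕ) (σ τ : State) : Prop where
  ints : ∀ k, k < L → τ.ints k = σ.ints k
  reals : ∀ k, k < L → τ.reals k = σ.reals k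
  out : τ.out = σ.out

theorem Keep.refl (L : ℕ) (σ : State) : Keep L σ σ := ⟨fun _ _ => rfl, fun _ _ => rfl, rfl⟩

theorem Keep.trans {L : ℕ} {σ τ υ : State} (h : Keep L σ τ) (h' : Keep L τ υ) : Keep L σ υ :=
  ⟨fun k hk => (h'.ints k hk).trans (h.ints k hk), fun k hk => (h'.reals k hk).trans (h.reals k hk),
    h'.out.trans h.out⟩

theorem Keep.vecAt {L : ℕ} {σ τ : State} (h : Keep L σ τ) (k i : ℕ) (hk : k + 4 ≤ L) :
    vecAt τ k i = vecAt σ k i := by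
  ext j
  change τ.reals _ _ = σ.reals _ _
  rw [h.reals _ (by omega)]

theorem Keep.setInt {L : ℕ} {σ τ : State} (h : Keep L σ τ) {k i x : ℕ} (hk : L ≤ k) :
    Keep L σ (τ.setInt k i x) :=
  ⟨fun k' hk' => by rw [State.setInt_ints_of_ne _ (by omega), h.ints k' hk'], h.reals, h.out⟩

theorem Keep.setReal {L : ℕ} {σ τ : State} (h : Keep L σ τ) {k i : ℕ} {x : ℝ} (hk : L ≤ k) :
    Keep L σ (τ.setReal k i x) :=
  ⟨h.ints, fun k' hk' => by rw [State.setReal_reals_of_ne _ (by omega), h.reals k' hk'], h.out⟩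

theorem WroteV.keep {σ τ : State} {k i : ℕ} {y : E4} (h : WroteV σ τ k i y) {L : ℕ} (hL : L ≤ k)
    (hL' : L ≤ 1000) : Keep L σ τ :=
  ⟨fun k' _ => by rw [h.ints], fun k' hk' => h.reals k' (by omega) (by omega), h.out⟩

/-- The number of vertices. -/
def nPlusOne : IExpr := .add (ivar 0) (.lit 1)

/-- The constants `2`, `4` and `8`. -/
def rTwo : RExpr := .add .one .one
/-- See `rTwo`. -/
def rFour : RExpr := .add rTwo rTwo
/-- See `rTwo`. -/
def rEight : RExpr := .add rFour rFour

@[simp] theorem eval_rTwo (σ : State) : rTwo.eval σ = 2 := by norm_num [rTwo, RExpr.eval]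
@[simp] theorem eval_rFour (σ : State) : rFour.eval σ = 4 := by norm_num [rFour, RExpr.eval]
@[simp] theorem eval_rEight (σ : State) : rEight.eval σ = 8 := by norm_num [rEight, RExpr.eval]

/-- Move the centre `50` of the ball with radius `54` off the hyperplane that is orthogonal to a
vector made from the `j`-th standard basis vector, and adjust the radius. -/
def pickAxis (j : Fin 4) : Cmd :=
  .seq (setV 68 (.lit 0) ((vvar 64).rej ((vvar 60).rej ((vvar 20).rej (.axis j)))).dir)
  (.seq (.ite (.and (.rlt ((vvar 50).dot (vvar 68)) (.div (rvar 54) rFour))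
      (.rlt (.sub .zero (.div (rvar 54) rFour)) ((vvar 50).dot (vvar 68))))
    (setV 50 (.lit 0) ((vvar 50).add (.smul (.div (rvar 54) rTwo) (vvar 68)))) .skip)
  (.setR 54 (.lit 0) (.div (rvar 54) rEight)))

/-- Move the ball off the span of the vector `20` and of the two vectors that lead from the point
`24` to the ends of the edge above vertex `55`. -/
def pickEdge : Cmd :=
  .seq (setV 60 (.lit 0) ((vvar 20).rej ((vget 40 (.get 5 (ivar 55))).sub (vvar 24))))
  (.seq (setV 64 (.lit 0) ((vvar 60).rej ((vvar 20).rej ((vget 40 (ivar 55)).sub (vvar 24)))))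
  (.seq (pickAxis 0) (.seq (pickAxis 1) (.seq (pickAxis 2) (pickAxis 3)))))

/-- Move the ball off all these spans. -/
def pick : Cmd := forLoop 55 (.lit 1) nPlusOne pickEdge

/-- The ball of `pick`. -/
def pickBall (σ : State) : Set E4 := Metric.ball (vecAt σ 50 0) (σ.reals 54 0)

theorem does_pickAxis {S : ℕ} (hS : 0 < S) (j : Fin 4) (σ : State) :
    Does S (pickAxis j) σ 18 fun τ => Keep 50 σ τ ∧ τ.ints = σ.ints ∧
      vecAt τ 60 0 = vecAt σ 60 0 ∧ vecAt τ 64 0 = vecAt σ 64 0 ∧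
      vecAt τ 50 0 = pushOff (dirVec (rej (vecAt σ 64 0) (rej (vecAt σ 60 0) (rej (vecAt σ 20 0)
        (EuclideanSpace.single j 1))))) (vecAt σ 50 0) (σ.reals 54 0) ∧
      τ.reals 54 0 = σ.reals 54 0 / 8 := by
  refine (Does.seq (does_setV (Q := fun τ => WroteV σ τ 68 0 (dirVec (rej (vecAt σ 64 0)
      (rej (vecAt σ 60 0) (rej (vecAt σ 20 0) (EuclideanSpace.single j 1)))))) ?_ (by norm_num)
      (by simpa using hS) (fun τ h => by simpa using h)) ?_).mono (T := 8 + (9 + 1)) (by norm_num)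
      fun _ h => h
  · refine VExpr.isLow_of_eval fun σ τ _ _ h => ?_
    simp [h]
  intro τ hτ
  set h := dirVec (rej (vecAt σ 64 0)
      (rej (vecAt σ 60 0) (rej (vecAt σ 20 0) (EuclideanSpace.single j 1))))
  have h50 : vecAt τ 50 0 = vecAt σ 50 0 := hτ.vecAt 50 0 (by norm_num) (by norm_num)
  have h54 : τ.reals 54 0 = σ.reals 54 0 := by rw [hτ.reals 54 (by norm_num) (by norm_num)]
  have k1 : Keep 50 σ τ := hτ.keep (by norm_num) (by norm_num)
  refine Does.seq (Q' := fun υ => Keep 50 σ υ ∧ υ.ints = σ.ints ∧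
      vecAt υ 60 0 = vecAt σ 60 0 ∧ vecAt υ 64 0 = vecAt σ 64 0 ∧
      vecAt υ 50 0 = pushOff h (vecAt σ 50 0) (σ.reals 54 0) ∧
      υ.reals 54 0 = σ.reals 54 0) (does_ite (T := 8) ?_ ?_) ?_
  · intro hc
    simp only [BExpr.Holds, VExpr.eval_dot, eval_vvar, RExpr.eval, eval_rvar, eval_rFour, zero_sub,
      h50, h54, hτ.vec] at hc
    refine does_setV ?_ (by norm_num) (by simpa using hS) fun υ hυ => ?_
    · refine VExpr.isLow_of_eval fun σ τ _ h1 h => ?_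
      simp [h, h1, RExpr.eval]
    refine ⟨k1.trans (hυ.keep (by norm_num) (by norm_num)), hυ.ints.trans hτ.ints, ?_, ?_, ?_, ?_⟩
    · rw [hυ.vecAt _ _ (by norm_num) (by simp), hτ.vecAt _ _ (by norm_num) (by norm_num)]
    · rw [hυ.vecAt _ _ (by norm_num) (by simp), hτ.vecAt _ _ (by norm_num) (by norm_num)]
    · have := hυ.vec
      simp only [IExpr.eval, VExpr.eval_add, eval_vvar, VExpr.eval_smul, RExpr.eval, eval_rvar,
        eval_rTwo, h50, h54, hτ.vec] at this
      rw [this, pushOff, if_pos (abs_lt.2 ⟨hc.2, hc.1⟩)]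
    · rw [hυ.reals 54 (by norm_num) (by norm_num), h54]
  · intro hc
    simp only [BExpr.Holds, VExpr.eval_dot, eval_vvar, RExpr.eval, eval_rvar, eval_rFour, zero_sub,
      h50, h54, hτ.vec] at hc
    refine (does_skip ?_).mono (by norm_num) fun _ h => h
    refine ⟨k1, hτ.ints, hτ.vecAt _ _ (by norm_num) (by norm_num),
      hτ.vecAt _ _ (by norm_num) (by norm_num), ?_, h54⟩
    rw [h50, pushOff, if_neg fun h' => hc ⟨(abs_lt.1 h').2, (abs_lt.1 h').1⟩]
  · rintro υ ⟨i1, i2, i3, i4, i5, i6⟩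
    refine does_setR (by simpa [IExpr.eval] using hS) ?_
    have hv : ∀ k, k + 4 ≤ 54 ∨ 54 < k → vecAt (υ.setReal 54 0 ((RExpr.div (rvar 54)
        rEight).eval υ)) k 0 = vecAt υ k 0 := fun k hk => by
      simp only [vecAt]
      congr 1
      funext j
      rw [State.setReal_reals_of_ne _ (by omega)]
    refine ⟨i1.setReal (by norm_num), i2, ?_, ?_, ?_, ?_⟩
    · simp only [IExpr.eval]; rw [hv 60 (by norm_num), i3]
    · simp only [IExpr.eval]; rw [hv 64 (by norm_num), i4]
    · simp only [IExpr.eval]; rw [hv 50 (by norm_num), i5]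
    · simp only [IExpr.eval]
      rw [State.setReal_reals_self]
      simp [RExpr.eval, i6]

theorem norm_dirVec_le (y : E4) : ‖dirVec y‖ ≤ 1 := by
  rcases eq_or_ne y 0 with rfl | h
  · simp [dirVec]
  · rw [norm_dirVec h]

/-- The four candidate normals are orthogonal to the forbidden span and one of them is nonzero, so
the ball ends up off a hyperplane that contains the span. -/
theorem does_pickEdge {S : ℕ} (hS : 0 < S) (σ : State) (hδ : 0 < σ.reals 54 0) :
    Does S pickEdge σ 88 fun τ => Keep 50 σ τ ∧ τ.ints = σ.ints ∧ 0 < τ.reals 54 0 ∧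
      pickBall τ ⊆ pickBall σ ∧ ∀ y ∈ pickBall τ, y ∉ Submodule.span ℝ ({vecAt σ 20 0,
        vecAt σ 40 (σ.ints 5 (σ.ints 55 0)) - vecAt σ 24 0,
        vecAt σ 40 (σ.ints 55 0) - vecAt σ 24 0} : Set E4) := by
  obtain ⟨s, hs⟩ : ∃ s, s = vecAt σ 20 0 := ⟨_, rfl⟩
  obtain ⟨A, hA⟩ : ∃ A, A = vecAt σ 40 (σ.ints 5 (σ.ints 55 0)) - vecAt σ 24 0 := ⟨_, rfl⟩
  obtain ⟨B, hB⟩ : ∃ B, B = vecAt σ 40 (σ.ints 55 0) - vecAt σ 24 0 := ⟨_, rfl⟩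
  rw [← hs, ← hA, ← hB]
  let N : Fin 4 → E4 := fun j => normalTo s A B (EuclideanSpace.single j 1)
  let M : ℕ → State → Prop := fun i τ => Keep 50 σ τ ∧ τ.ints = σ.ints ∧
    vecAt τ 60 0 = rej s A ∧ vecAt τ 64 0 = rej (rej s A) (rej s B) ∧ 0 < τ.reals 54 0 ∧
    pickBall τ ⊆ pickBall σ ∧
    ∀ j : Fin 4, (j : ℕ) < i → N j ≠ 0 → ∀ y ∈ pickBall τ, inner ℝ (dirVec (N j)) y ≠ 0
  have axis : ∀ (j : Fin 4) (τ : State), M j τ → Does S (pickAxis j) τ 18 (M (j + 1)) := by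
    rintro j τ ⟨m1, m2, m3, m4, m5, m6, m7⟩
    refine (does_pickAxis hS j τ).mono le_rfl ?_
    rintro υ ⟨i1, i2, i3, i4, i5, i6⟩
    have h20 : vecAt τ 20 0 = s := by rw [hs, m1.vecAt _ _ (by norm_num)]
    have hN : rej (vecAt τ 64 0) (rej (vecAt τ 60 0) (rej (vecAt τ 20 0)
        (EuclideanSpace.single j 1))) = N j := by rw [m3, m4, h20]; rfl
    rw [hN] at i5
    -- The balls are nested, so what was achieved for earlier axes is kept.
    have hsub : pickBall υ ⊆ pickBall τ := by
      rw [pickBall, pickBall, i5, i6]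
      exact ball_pushOff_subset (norm_dirVec_le _) m5
    refine ⟨m1.trans i1, i2.trans m2, i3.trans m3, i4.trans m4, by rw [i6]; positivity,
      hsub.trans m6, fun j' hj' hj0 y hy => ?_⟩
    rcases Nat.lt_succ_iff_lt_or_eq.1 hj' with h | h
    · exact m7 j' h hj0 y (hsub hy)
    · obtain rfl : j' = j := Fin.ext h
      rw [pickBall, i5, i6] at hy
      exact inner_ne_zero_of_mem_ball_pushOff (norm_dirVec hj0) hy
  refine (Does.seq (does_setV (Q := fun τ => WroteV σ τ 60 0 (rej s A)) ?_ (by norm_num)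
    (by simpa using hS) (fun τ h => ?_)) fun τ hτ => ?_).mono
    (T := 8 + (8 + (18 + (18 + (18 + 18))))) (by norm_num) fun _ h => h
  · refine VExpr.isLow_of_eval fun σ τ hi _ h => ?_
    simp [h, IExpr.eval, hi]
  · rw [hs, hA]
    simpa [IExpr.eval] using h
  refine Does.seq (Q' := M 0) (does_setV ?_ (by norm_num) (by simpa using hS) fun υ hυ => ?_) ?_
  · refine VExpr.isLow_of_eval fun σ τ hi _ h => ?_
    simp [h, hi]
  · have k1 : Keep 50 σ τ := hτ.keep (by norm_num) (by norm_num)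
    have k2 : Keep 50 τ υ := hυ.keep (by norm_num) (by norm_num)
    have h50 : vecAt υ 50 0 = vecAt σ 50 0 := by
      rw [hυ.vecAt _ _ (by norm_num) (by norm_num), hτ.vecAt _ _ (by norm_num) (by norm_num)]
    have h54 : υ.reals 54 0 = σ.reals 54 0 := by
      rw [hυ.reals 54 (by norm_num) (by norm_num), hτ.reals 54 (by norm_num) (by norm_num)]
    refine ⟨k1.trans k2, hυ.ints.trans hτ.ints, ?_, ?_, h54 ▸ hδ, ?_, fun j hj => absurd hj
      (Nat.not_lt_zero _)⟩
    · rw [hυ.vecAt _ _ (by norm_num) (by simp), hτ.vec]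
    · have := hυ.vec
      simp only [IExpr.eval, VExpr.eval_rej, eval_vvar, VExpr.eval_sub, eval_vget, eval_ivar,
        hτ.vec, hτ.ints, k1.vecAt _ _ (show 20 + 4 ≤ 50 by norm_num),
        k1.vecAt _ _ (show 24 + 4 ≤ 50 by norm_num),
        k1.vecAt _ _ (show 40 + 4 ≤ 50 by norm_num)] at this
      rw [this, hs, hB]
    · rw [pickBall, pickBall, h50, h54]
  intro υ hυ
  refine Does.seq (axis 0 υ hυ) fun υ hυ => Does.seq (axis 1 υ hυ) fun υ hυ =>
    Does.seq (axis 2 υ hυ) fun υ hυ => (axis 3 υ hυ).mono le_rfl ?_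
  rintro ω ⟨m1, m2, -, -, m5, m6, m7⟩
  refine ⟨m1, m2, m5, m6, fun y hy hmem => ?_⟩
  obtain ⟨j, hj⟩ := exists_normalTo_ne_zero s A B
  apply m7 j j.2 hj y hy
  rw [dirVec, real_inner_smul_left, inner_normalTo _ hmem, mul_zero]

/-- Avoidance is claimed for the entire final ball, not only for its centre: the radius serves later
as a clearance, and a second search may start inside this ball. -/
theorem does_pick {S n : ℕ} (σ : State) (hn : σ.ints 0 0 = n) (hS : n + 1 ≤ S)
    (hδ : 0 < σ.reals 54 0) :
    Does S pick σ (90 * n + 2) fun τ => Keep 50 σ τ ∧ 0 < τ.reals 54 0 ∧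
      pickBall τ ⊆ pickBall σ ∧ ∀ v, 0 < v → v ≤ n → ∀ y ∈ pickBall τ,
        y ∉ Submodule.span ℝ ({vecAt σ 20 0, vecAt σ 40 (σ.ints 5 v) - vecAt σ 24 0,
          vecAt σ 40 v - vecAt σ 24 0} : Set E4) := by
  have hS0 : 0 < S := by omega
  let I : ℕ → State → Prop := fun j τ => Keep 50 σ τ ∧ 0 < τ.reals 54 0 ∧
      pickBall τ ⊆ pickBall σ ∧ ∀ v, 0 < v → v < j → ∀ y ∈ pickBall τ,
        y ∉ Submodule.span ℝ ({vecAt σ 20 0, vecAt σ 40 (σ.ints 5 v) - vecAt σ 24 0,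
          vecAt σ 40 v - vecAt σ 24 0} : Set E4)
  refine (does_forLoop_const (I := I) (a := 1) (N := n + 1) 88 rfl (by omega) hS hS0 ?_ ?_ ?_
    (fun τ h => ?_)).mono (T := (n + 1 - 1) * (88 + 2) + 2) (by simp; omega) fun _ h => h
  · rintro j τ ⟨k, -⟩
    simp [nPlusOne, IExpr.eval, k.ints 0 (by norm_num), hn]
  · exact ⟨(Keep.refl _ _).setInt (by norm_num), hδ, subset_rfl, fun v h0 h1 => by omega⟩
  · rintro j τ h1 hj ⟨k, hδ', hb, hv⟩ hk
    refine (does_pickEdge hS0 τ hδ').mono le_rfl ?_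
    rintro υ ⟨k', hi, hδ'', hb', hs⟩
    refine ⟨by rw [hi, hk], (k.trans k').setInt (by norm_num), hδ'', hb'.trans hb,
      fun v h0 hvj y hy => ?_⟩
    rcases Nat.lt_succ_iff_lt_or_eq.1 hvj with h | rfl
    · exact hv v h0 h y (hb' hy)
    · have := hs y hy
      rwa [hk, k.vecAt _ _ (by norm_num), k.vecAt _ _ (by norm_num), k.vecAt _ _ (by norm_num),
        k.vecAt _ _ (by norm_num), k.ints 5 (by norm_num)] at this
  · exact ⟨h.1, h.2.1, h.2.2.1, fun v h0 hv => h.2.2.2 v h0 (by omega)⟩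

/-! ### Execution of a rotation -/

/-- Output the rotation of all that lies beyond the vertex in the variable `kb` that turns the
vector `20` to the direction of the vector `50`, and update the positions `40`. -/
def rotate (kb : ℕ) : Cmd :=
  .seq (.emit (.get 4 (.get 5 (ivar kb))) (.get 4 (ivar kb)) (.get 4 (ivar kb)) (vvar 20).dir
    ((vvar 20).rej (vvar 50)).dir ((vvar 20).dir.dot (vvar 50).dir))
  (.seq (.setI 45 (.lit 0) (.lit 0))
  (forLoop 44 (.lit 1) nPlusOne
    (.seq (.ite (.and (.not (.ilt (ivar 44) (ivar kb))) (.not (.ilt (ivar kb) (ivar 44))))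
      (.setI 45 (ivar 44) (.lit 1)) (.setI 45 (ivar 44) (.get 45 (.get 5 (ivar 44)))))
    (.ite (.ilt (.lit 0) (.get 45 (ivar 44)))
      (setV 40 (ivar 44) ((vget 40 (.get 5 (ivar kb))).add (VExpr.planeRot (vvar 20).dir
        ((vvar 20).rej (vvar 50)).dir ((vvar 20).dir.dot (vvar 50).dir)
        ((vget 40 (ivar 44)).sub (vget 40 (.get 5 (ivar kb)))))))
      .skip))))

/-- Unlike `turnCos_mem`, this needs no nondegeneracy, which matters because `VExpr.IsLow`
quantifies over arbitrary states. -/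
theorem turnCos_abs_le (s w : E4) : -1 ≤ turnCos s w ∧ turnCos s w ≤ 1 := by
  have h := abs_real_inner_le_norm (dirVec s) (dirVec w)
  have h1 := norm_dirVec_le s
  have h2 := norm_dirVec_le w
  rw [← abs_le]
  exact h.trans (by nlinarith [norm_nonneg (dirVec s), norm_nonneg (dirVec w)])

/-- A single pass in increasing order both marks the descendants of `b`, in the integer array `45`,
and updates the positions in place. It works because parents precede children and the centre of the
rotation stays at rest. -/
theorem does_rotate {S n kb b : ℕ} (hkb : kb < 40) (σ : State) (hn : σ.ints 0 0 = n)
    (hS : n + 1 ≤ S) (hb : σ.ints kb 0 = b) (hb0 : 0 < b) (hbn : b ≤ n)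
    (hp : IsParentMap (σ.ints 5)) (hpn : ∀ v, n < v → σ.ints 5 v = 0) :
    Does S (rotate kb) σ (13 * n + 4) fun τ => (∀ k, k < 40 → τ.ints k = σ.ints k) ∧
      (∀ k, k < 40 ∨ 44 ≤ k → k < 1000 → τ.reals k = σ.reals k) ∧
      τ.out = σ.out ++ [(turnTo b (vecAt σ 20 0) (vecAt σ 50 0)).toMove (σ.ints 5) (σ.ints 4)] ∧
      vecAt τ 40 = (turnTo b (vecAt σ 20 0) (vecAt σ 50 0)).pos (σ.ints 5) (vecAt σ 40) 1 := by
  have hS0 : 0 < S := by omega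
  obtain ⟨m, hm⟩ : ∃ m, m = turnTo b (vecAt σ 20 0) (vecAt σ 50 0) := ⟨_, rfl⟩
  rw [← hm]
  have hmb : m.b = b := by rw [hm]; rfl
  let I : ℕ → State → Prop := fun j τ => (∀ k, k < 40 → τ.ints k = σ.ints k) ∧
      (∀ k, k < 40 ∨ 44 ≤ k → k < 1000 → τ.reals k = σ.reals k) ∧
      τ.out = σ.out ++ [m.toMove (σ.ints 5) (σ.ints 4)] ∧
      (∀ v, v < j → τ.ints 45 v ≤ 1 ∧ (0 < τ.ints 45 v ↔ Desc (σ.ints 5) b v)) ∧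
      (∀ v, v < j → vecAt τ 40 v = m.pos (σ.ints 5) (vecAt σ 40) 1 v) ∧
      (∀ v, j ≤ v → vecAt τ 40 v = vecAt σ 40 v)
  have hpos0 : m.pos (σ.ints 5) (vecAt σ 40) 1 0 = vecAt σ 40 0 := by
    rw [Turn.pos, rotAt_of_not_desc]
    intro h
    have := h.le hp
    omega
  refine (Does.seq (T := 1) (Q' := fun τ => τ.ints = σ.ints ∧ τ.reals = σ.reals ∧
    τ.out = σ.out ++ [m.toMove (σ.ints 5) (σ.ints 4)]) (does_emit ⟨rfl, rfl, ?_⟩) ?_).mono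
    (T := 1 + (1 + ((n + 1 - 1) * (11 + 2) + 2))) (by simp; omega) fun _ h => h
  · simp only [emitted, IExpr.eval, eval_ivar, hb, VExpr.eval_dot, VExpr.eval_dir, eval_vvar]
    congr 2
    rw [hm]
    simp only [Turn.toMove, turnTo, turnE, turnF, turnCos, Move.mk.injEq, true_and, and_true]
    refine ⟨VExpr.eval_dir σ _, ?_⟩
    have := VExpr.eval_dir σ ((vvar 20).rej (vvar 50))
    rw [VExpr.eval_rej] at this
    exact this
  rintro τ ⟨t1, t2, t3⟩
  refine Does.seq (T := 1) (Q' := fun υ => υ = τ.setInt 45 0 0)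
    (does_setI hS0 (Nat.zero_le _) rfl) ?_
  rintro _ rfl
  refine does_forLoop_const (I := I) (a := 1) (N := n + 1) 11 rfl (by omega) hS hS0 ?_ ?_ ?_ ?_
  · rintro j τ ⟨k, -⟩
    simp [nPlusOne, IExpr.eval, k 0 (by norm_num), hn]
  · refine ⟨fun k hk => ?_, fun k _ _ => ?_, t3, ?_, ?_, ?_⟩
    · rw [State.setInt_ints_of_ne _ (by omega), State.setInt_ints_of_ne _ (by omega), t1]
    · rw [State.setInt_reals, State.setInt_reals, t2]
    · intro v hv
      obtain rfl : v = 0 := by omega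
      rw [State.setInt_ints_of_ne _ (by norm_num), State.setInt_ints_self]
      refine ⟨Nat.zero_le _, ⟨fun h => absurd h (lt_irrefl _), fun h => ?_⟩⟩
      have := h.le hp
      omega
    · intro v hv
      obtain rfl : v = 0 := by omega
      rw [hpos0]
      simp only [vecAt, State.setInt_reals, t2]
    · intro v hv
      simp only [vecAt, State.setInt_reals, t2]
  · rintro j τ h1 hj ⟨i1, i2, i3, i4, i5, i6⟩ hk
    have e5 : τ.ints 5 = σ.ints 5 := i1 5 (by norm_num)
    have eb : τ.ints kb 0 = b := by rw [i1 kb hkb, hb]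
    have hpj : σ.ints 5 j < j := hp.lt j (by omega)
    refine Does.seq (T := 2) (T' := 9) (Q' := fun υ => (∀ k, k ≠ 45 → υ.ints k = τ.ints k) ∧
      υ.reals = τ.reals ∧ υ.out = τ.out ∧ ∀ v, v < j + 1 → υ.ints 45 v ≤ 1 ∧
      (0 < υ.ints 45 v ↔ Desc (σ.ints 5) b v)) (does_ite (T := 1) ?_ ?_) ?_
    · intro hc
      simp only [BExpr.Holds, eval_ivar, hk, eb, not_lt] at hc
      have hjb : j = b := by omega
      refine does_setI (by simpa [hk] using by omega) (by simp [IExpr.eval]; omega) ?_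
      simp only [eval_ivar, hk, IExpr.eval]
      refine ⟨fun k hk => State.setInt_ints_of_ne _ hk, rfl, rfl, fun v hv => ?_⟩
      by_cases hvj : v = j
      · subst hvj
        rw [State.setInt_ints_self]
        exact ⟨le_rfl, fun _ => hjb ▸ Desc.refl _ _, fun _ => one_pos⟩
      · rw [State.setInt_ints_of_ne' _ hvj]
        exact i4 v (by omega)
    · intro hc
      simp only [BExpr.Holds, eval_ivar, hk, eb, not_lt] at hc
      have hjb : j ≠ b := by omega
      -- The parent of `j` was visited earlier, so its mark is already correct and can be copied.
      have hpar := i4 _ hpj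
      refine does_setI (by simpa [hk] using by omega)
        (by simp only [IExpr.eval, eval_ivar, hk, e5]; omega) ?_
      simp only [eval_ivar, hk, IExpr.eval, e5]
      refine ⟨fun k hk => State.setInt_ints_of_ne _ hk, rfl, rfl, fun v hv => ?_⟩
      by_cases hvj : v = j
      · subst hvj
        rw [State.setInt_ints_self, hpar.2]
        exact ⟨hpar.1, ⟨Desc.of_par, fun h => (desc_iff.1 h).resolve_left hjb⟩⟩
      · rw [State.setInt_ints_of_ne' _ hvj]
        exact i4 v (by omega)
    · rintro υ ⟨u1, u2, u3, u4⟩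
      have uv : ∀ k i, vecAt υ k i = vecAt τ k i := fun k i => by simp only [vecAt, u2]
      have hkυ : υ.ints 44 0 = j := by rw [u1 44 (by norm_num), hk]
      have ebυ : υ.ints kb 0 = b := by rw [u1 kb (by omega), eb]
      have e5υ : υ.ints 5 = σ.ints 5 := by rw [u1 5 (by norm_num), e5]
      refine does_ite (T := 8) ?_ ?_
      · intro hc
        simp only [BExpr.Holds, eval_ivar, hkυ, IExpr.eval] at hc
        have hd := (u4 j (by omega)).2.1 hc
        have hbj := hd.le hp
        have hpb : σ.ints 5 b < j := (hp.lt b hb0).trans_le hbj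
        refine does_setV ?_ (by norm_num) (by simpa [hkυ] using by omega) fun ω hω => ?_
        · refine VExpr.isLow_of_eval fun σ τ hi _ h => ?_
          simp only [VExpr.eval_add, eval_vget, IExpr.eval, eval_ivar, hi, h 40 _ (by norm_num)]
          congr 1
          have hc : ∀ υ : State, -1 ≤ ((vvar 20).dir.dot (vvar 50).dir).eval υ ∧
              ((vvar 20).dir.dot (vvar 50).dir).eval υ ≤ 1 := fun υ => by
            simp only [VExpr.eval_dot, VExpr.eval_dir, eval_vvar]
            exact turnCos_abs_le _ _
          rw [VExpr.eval_planeRot _ _ _ _ _ (hc _).1 (hc _).2,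
            VExpr.eval_planeRot _ _ _ _ _ (hc _).1 (hc _).2]
          simp [h, hi, IExpr.eval]
        have hvec := hω.vec
        have hc : -1 ≤ ((vvar 20).dir.dot (vvar 50).dir).eval υ ∧
            ((vvar 20).dir.dot (vvar 50).dir).eval υ ≤ 1 := by
          simp only [VExpr.eval_dot, VExpr.eval_dir, eval_vvar]
          exact turnCos_abs_le _ _
        have e20 : vecAt υ 20 0 = vecAt σ 20 0 := by
          rw [uv]; ext j'
          change τ.reals _ _ = _
          rw [i2 _ (by omega) (by omega)]; rfl
        have e50 : vecAt υ 50 0 = vecAt σ 50 0 := by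
          rw [uv]; ext j'
          change τ.reals _ _ = _
          rw [i2 _ (by omega) (by omega)]; rfl
        have ej : vecAt υ 40 j = vecAt σ 40 j := by rw [uv, i6 j le_rfl]
        -- The centre may have been visited already, but its position was not changed, since it is
        -- not below `b`.
        have ep : vecAt υ 40 (σ.ints 5 b) = vecAt σ 40 (σ.ints 5 b) := by
          rw [uv, i5 _ hpb, Turn.pos, hmb, rotAt_of_not_desc (not_desc_par hp hb0)]
        rw [VExpr.eval_add, VExpr.eval_planeRot _ _ _ _ _ hc.1 hc.2] at hvec
        simp only [eval_ivar, eval_vget, IExpr.eval, VExpr.eval_dir, VExpr.eval_rej, eval_vvar,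
          VExpr.eval_dot, VExpr.eval_sub, hkυ, ebυ, e5υ, e20, e50, ej, ep] at hvec
        have hpos : m.pos (σ.ints 5) (vecAt σ 40) 1 j = vecAt ω 40 j := by
          rw [hvec, Turn.pos, hmb, rotAt_of_desc hd, one_mul, hm]
          rfl
        simp only [eval_ivar, hkυ] at hω
        refine ⟨by rw [hω.ints, hkυ], fun k hk => ?_, fun k hk hk' => ?_, ?_, ?_, ?_, ?_⟩
        · rw [State.setInt_ints_of_ne _ (by omega), hω.ints, u1 k (by omega), i1 k hk]
        · rw [State.setInt_reals, hω.reals k hk' (by omega), u2, i2 k hk hk']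
        · rw [State.setInt_out, hω.out, u3, i3]
        · rw [State.setInt_ints_of_ne _ (by norm_num), hω.ints]
          exact u4
        · intro v hv
          change vecAt ω 40 v = _
          by_cases hvj : v = j
          · rw [hvj, hpos]
          · rw [hω.vec_ne v hvj, uv, i5 v (by omega)]
        · intro v hv
          change vecAt ω 40 v = _
          rw [hω.vec_ne v (by omega), uv, i6 v (by omega)]
      · intro hc
        simp only [BExpr.Holds, eval_ivar, hkυ, IExpr.eval] at hc
        have hd : ¬ Desc (σ.ints 5) b j := fun h => hc ((u4 j (by omega)).2.2 h)
        refine (does_skip ?_).mono (T' := 8) (by norm_num) fun _ h => h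
        refine ⟨hkυ, fun k hk => ?_, fun k hk hk' => ?_, ?_, ?_, ?_, ?_⟩
        · rw [State.setInt_ints_of_ne _ (by omega), u1 k (by omega), i1 k hk]
        · rw [State.setInt_reals, u2, i2 k hk hk']
        · rw [State.setInt_out, u3, i3]
        · rw [State.setInt_ints_of_ne _ (by norm_num)]
          exact u4
        · intro v hv
          change vecAt υ 40 v = _
          rw [uv]
          by_cases hvj : v = j
          · rw [hvj, i6 j le_rfl, Turn.pos, hmb, rotAt_of_not_desc hd]
          · exact i5 v (by omega)
        · intro v hv
          change vecAt υ 40 v = _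
          rw [uv, i6 v (by omega)]
  · rintro τ ⟨i1, i2, i3, i4, i5, i6⟩
    refine ⟨i1, i2, i3, ?_⟩
    funext v
    rcases Nat.lt_or_ge v (n + 1) with hv | hv
    · exact i5 v hv
    -- The cells beyond `n` are not touched; there the parent is `0`, so they do not count as
    -- descendants of `b`.
    · rw [i6 v hv, Turn.pos, hmb, rotAt_of_not_desc]
      intro hd
      rcases desc_iff.1 hd with rfl | hd
      · omega
      · rw [hpn v (by omega)] at hd
        have := hd.le hp
        omega

/-! ### The effect of the rotations on what stays at rest -/

section

variable {par : ℕ → ℕ} (hp : IsParentMap par) {n b : ℕ} {K : Set ℕ} {P : ℕ → E4} {s w : E4}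

theorem turnTo_pos_of_not_desc {v : ℕ} (h : ¬ Desc par b v) :
    (turnTo b s w).pos par P 1 v = P v := rotAt_of_not_desc (b := (turnTo b s w).b) h

theorem edgeDir_turnTo_of_not_desc {v : ℕ} (h : ¬ Desc par b v) :
    edgeDir par ((turnTo b s w).pos par P 1) v = edgeDir par P v :=
  edgeDir_rotAt_of_not_desc (b := (turnTo b s w).b) h

include hp

theorem edgeDir_turnTo_ne (hb : 0 < b) (hs : s ≠ 0) (hw : w ∉ Submodule.span ℝ ({s} : Set E4))
    {u v : ℕ} (hu : Desc par b u) (hv : Desc par b v) (h : edgeDir par P u ≠ edgeDir par P v) :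
    edgeDir par ((turnTo b s w).pos par P 1) u ≠ edgeDir par ((turnTo b s w).pos par P 1) v := by
  let R := planeRotL (norm_turnE hs hw) (norm_turnF hs hw) (inner_turn hs hw)
    (1 * Real.arccos (turnCos s w))
  have e1 : edgeDir par ((turnTo b s w).pos par P 1) u = R (edgeDir par P u) :=
    edgeDir_rotAt hp hb R hu
  have e2 : edgeDir par ((turnTo b s w).pos par P 1) v = R (edgeDir par P v) :=
    edgeDir_rotAt hp hb R hv
  rw [e1, e2]
  exact fun e => h (R.injective e)

theorem not_desc_of_par_eq {x c c' : ℕ} (hx : x < c) (h : par c = x) (h' : par c' = x)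
    (hne : c' ≠ c) : ¬ Desc par c c' := by
  intro hd
  have := ((desc_iff.1 hd).resolve_left hne).le hp
  omega

omit hp in
theorem not_desc_child {x c v : ℕ} (h : par c = x) (hv : ¬ Desc par x v) : ¬ Desc par c v :=
  fun h' => hv (Desc.trans (h ▸ Desc.of_par (Desc.refl par _)) h')

end

/-- The extension of the edge above `x` is free of the edges that do not lie below `x`. -/
def IsFree (par : ℕ → ℕ) (n x : ℕ) (P : ℕ → E4) : Prop :=
  ∀ v, 0 < v → v ≤ n → ¬ Desc par x v → ∀ τ : ℝ, 0 < τ →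
    P x + τ • edgeDir par P x ∉ segment ℝ (P (par v)) (P v)

/-- The ray from `x` along the edge above `c` stays clear of the edges that do not lie below `x`. -/
def IsClear (par : ℕ → ℕ) (n x c : ℕ) (P : ℕ → E4) (κ : ℝ) : Prop :=
  ∀ v, 0 < v → v ≤ n → ¬ Desc par x v → ∀ Y ∈ segment ℝ (P (par v) - P x) (P v - P x),
    ∀ τ : ℝ, 0 ≤ τ → κ * τ ≤ ‖Y - τ • edgeDir par P c‖

theorem IsClear.mono {par : ℕ → ℕ} {n x c : ℕ} {P : ℕ → E4} {κ κ' : ℝ}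
    (h : IsClear par n x c P κ) (hκ : κ' ≤ κ) : IsClear par n x c P κ' :=
  fun v h0 hn hd Y hY τ hτ => (mul_le_mul_of_nonneg_right hκ hτ).trans (h v h0 hn hd Y hY τ hτ)

/-- A point `Y` of `U` nearer than `δ * τ` to the ray point could be scaled by `‖w‖ / τ`; it would
stay in `U` and come into the ball. Thus the radius of the ball is a rate of clearance along the
ray. -/
theorem le_norm_sub_of_ball {U : Submodule ℝ E4} {w : E4} {δ : ℝ} (hw : w ≠ 0) (hw1 : ‖w‖ ≤ 1)
    (h : ∀ y ∈ Metric.ball w δ, y ∉ U) {Y : E4} (hY : Y ∈ U) {τ : ℝ} (hτ : 0 ≤ τ) :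
    δ * τ ≤ ‖Y - τ • dirVec w‖ := by
  rcases hτ.eq_or_lt with rfl | hτ
  · simp
  by_contra! hlt
  have hw0 := norm_pos_iff.2 hw
  refine h ((‖w‖ / τ) • Y) ?_ (U.smul_mem _ hY)
  rw [Metric.mem_ball, dist_eq_norm]
  have e : (‖w‖ / τ) • Y - w = (‖w‖ / τ) • (Y - τ • dirVec w) := by
    rw [smul_sub, smul_smul, div_mul_cancel₀ _ hτ.ne', norm_smul_dirVec]
  rw [e, norm_smul, Real.norm_of_nonneg (by positivity)]
  calc ‖w‖ / τ * ‖Y - τ • dirVec w‖ < ‖w‖ / τ * (δ * τ) := by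
        apply mul_lt_mul_of_pos_left hlt; positivity
    _ = ‖w‖ * δ := by field_simp
    _ ≤ δ := by
        have : 0 ≤ δ := by
          have := norm_nonneg (Y - τ • dirVec w)
          by_contra! hneg
          nlinarith
        nlinarith

/-- The state of the algorithm: `K` is the set of aligned vertices, and at most `B` moves were made
so far, from the positions `P₀`. -/
structure Cur (n : ℕ) (par ord : ℕ → ℕ) (P₀ : ℕ → E4) (K : Set ℕ) (B : ℕ) (σ : State) : Prop where
  n_eq : σ.ints 0 0 = n
  par_eq : σ.ints 5 = par
  ord_eq : σ.ints 4 = ord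
  reach : ∃ ms, Reach par n ∅ P₀ ms K (vecAt σ 40) ∧ ms.length ≤ B ∧
    σ.out = ms.map (Turn.toMove par ord)
  isAligned : IsAligned par K
  inv : Inv par n K (vecAt σ 40)

/-- From `σ` to `τ`, only registers were changed. -/
structure Frame (σ τ : State) : Prop where
  ints : ∀ k, k < 40 → τ.ints k = σ.ints k
  reals : ∀ k, k < 20 → τ.reals k = σ.reals k
  pos : vecAt τ 40 = vecAt σ 40
  out : τ.out = σ.out

theorem Frame.trans {σ τ υ : State} (h : Frame σ τ) (h' : Frame τ υ) : Frame σ υ :=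
  ⟨fun k hk => (h'.ints k hk).trans (h.ints k hk), fun k hk => (h'.reals k hk).trans (h.reals k hk),
    h'.pos.trans h.pos, h'.out.trans h.out⟩

theorem Frame.vecAt {σ τ : State} (h : Frame σ τ) (v : ℕ) : vecAt τ 40 v = vecAt σ 40 v :=
  congrFun h.pos v

theorem Keep.frame {L : ℕ} {σ τ : State} (h : Keep L σ τ) (hL : 44 ≤ L) : Frame σ τ :=
  ⟨fun k hk => h.ints k (by omega), fun k hk => h.reals k (by omega),
    funext fun v => h.vecAt 40 v (by omega), h.out⟩

theorem WroteV.frame {σ τ : State} {k i : ℕ} {y : E4} (h : WroteV σ τ k i y) (h1 : 20 ≤ k)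
    (h2 : k + 4 ≤ 40 ∨ 44 ≤ k) : Frame σ τ :=
  ⟨fun k _ => by rw [h.ints], fun k' hk' => h.reals k' (by omega) (by omega),
    funext fun v => h.vecAt 40 v (by norm_num) (by omega), h.out⟩

theorem Cur.frame {n : ℕ} {par ord : ℕ → ℕ} {P₀ : ℕ → E4} {K : Set ℕ} {B : ℕ} {σ τ : State}
    (h : Cur n par ord P₀ K B σ) (hf : Frame σ τ) : Cur n par ord P₀ K B τ := by
  obtain ⟨h1, h2, h3, h4, h5, h6⟩ := h
  refine ⟨?_, ?_, ?_, ?_, h5, ?_⟩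
  · rw [hf.ints 0 (by norm_num), h1]
  · rw [hf.ints 5 (by norm_num), h2]
  · rw [hf.ints 4 (by norm_num), h3]
  · rw [hf.pos, hf.out]; exact h4
  · rw [hf.pos]; exact h6

theorem Cur.setInt {n : ℕ} {par ord : ℕ → ℕ} {P₀ : ℕ → E4} {K : Set ℕ} {B : ℕ} {σ : State}
    (h : Cur n par ord P₀ K B σ) {k i x : ℕ} (hk : 5 < k) :
    Cur n par ord P₀ K B (σ.setInt k i x) := by
  obtain ⟨h1, h2, h3, h4, h5, h6⟩ := h
  refine ⟨?_, ?_, ?_, h4, h5, h6⟩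
  · rw [State.setInt_ints_of_ne _ (by omega), h1]
  · rw [State.setInt_ints_of_ne _ (by omega), h2]
  · rw [State.setInt_ints_of_ne _ (by omega), h3]

theorem vecAt_setReal {σ : State} {k i k' i' : ℕ} {x : ℝ} (h : k < k' ∨ k' + 4 ≤ k) :
    vecAt (σ.setReal k i x) k' i' = vecAt σ k' i' := by
  simp only [vecAt]
  congr 1
  funext j
  rw [State.setReal_reals_of_ne _ (by omega)]

theorem Cur.setReal {n : ℕ} {par ord : ℕ → ℕ} {P₀ : ℕ → E4} {K : Set ℕ} {B : ℕ} {σ : State}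
    (h : Cur n par ord P₀ K B σ) {k i : ℕ} {x : ℝ} (hk : k < 40) :
    Cur n par ord P₀ K B (σ.setReal k i x) := by
  obtain ⟨h1, h2, h3, h4, h5, h6⟩ := h
  have : vecAt (σ.setReal k i x) 40 = vecAt σ 40 := funext fun v => vecAt_setReal (by omega)
  refine ⟨h1, h2, h3, ?_, h5, ?_⟩
  · rw [this]; exact h4
  · rw [this]; exact h6

theorem Cur.mono {n : ℕ} {par ord : ℕ → ℕ} {P₀ : ℕ → E4} {K : Set ℕ} {B B' : ℕ} {σ : State}
    (h : Cur n par ord P₀ K B σ) (hB : B ≤ B') : Cur n par ord P₀ K B' σ := by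
  obtain ⟨h1, h2, h3, ⟨ms, h4, h4', h4''⟩, h5, h6⟩ := h
  exact ⟨h1, h2, h3, ⟨ms, h4, h4'.trans hB, h4''⟩, h5, h6⟩

/-- From `σ` to `τ`, only positions, outputs and registers of the rotation were changed. -/
structure Turned (σ τ : State) : Prop where
  ints : ∀ k, k < 40 → τ.ints k = σ.ints k
  reals : ∀ k, k < 40 ∨ 44 ≤ k → k < 1000 → τ.reals k = σ.reals k

theorem Turned.vecAt {σ τ : State} (h : Turned σ τ) (k i : ℕ) (hk : k + 4 ≤ 40 ∨ 44 ≤ k)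
    (hk' : k + 4 ≤ 1000) : vecAt τ k i = vecAt σ k i := by
  ext j
  change τ.reals _ _ = σ.reals _ _
  rw [h.reals _ (by omega) (by omega)]

theorem Cur.does_rotate {S n : ℕ} {par ord : ℕ → ℕ} {P₀ : ℕ → E4} {K K' : Set ℕ} {B kb b : ℕ}
    {σ : State} (h : Cur n par ord P₀ K B σ) (hS : n + 1 ≤ S) (hp : IsParentMap par)
    (hpn : ∀ v, n < v → par v = 0) (hkb : kb < 40) (hb : σ.ints kb 0 = b)
    (hstep : IsStep par n K K' (vecAt σ 40) (turnTo b (vecAt σ 20 0) (vecAt σ 50 0))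
      ((turnTo b (vecAt σ 20 0) (vecAt σ 50 0)).pos par (vecAt σ 40) 1)) :
    Does S (rotate kb) σ (13 * n + 4) fun τ => Cur n par ord P₀ K' (B + 1) τ ∧ Turned σ τ ∧
      TreeStraightening.vecAt τ 40 =
        (turnTo b (vecAt σ 20 0) (vecAt σ 50 0)).pos par (vecAt σ 40) 1 := by
  obtain ⟨h1, h2, h3, ⟨ms, h4, h4', h4''⟩, h5, h6⟩ := h
  refine (TreeStraightening.does_rotate hkb σ h1 hS hb hstep.pos hstep.le (by rwa [h2])
    (by rwa [h2])).mono le_rfl ?_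
  rw [h2, h3]
  rintro τ ⟨t1, t2, t3, t4⟩
  refine ⟨⟨?_, ?_, ?_, ⟨ms ++ [turnTo b (vecAt σ 20 0) (vecAt σ 50 0)], ?_, ?_, ?_⟩,
    hstep.isAligned', ?_⟩, ⟨t1, t2⟩, t4⟩
  · rw [t1 0 (by norm_num), h1]
  · rw [t1 5 (by norm_num), h2]
  · rw [t1 4 (by norm_num), h3]
  · rw [t4]
    exact h4.append hstep.reach
  · rw [List.length_append]
    simp
    omega
  · rw [t3, h4'', List.map_append]
    rfl
  · rw [t4]
    exact hstep.inv'

/-! ### Loops over the children of a vertex -/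

/-- Run `body` with the variable `13` over all children of the vertex in the variable `10`. -/
def forChildren (body : Cmd) : Cmd :=
  forLoop 13 (.lit 1) nPlusOne (.ite (.and (.not (.ilt (.get 5 (ivar 13)) (ivar 10)))
    (.not (.ilt (ivar 10) (.get 5 (ivar 13))))) body .skip)

/-- The number of children of `x` among the vertices `1, …, j - 1`. -/
def numChildren (par : ℕ → ℕ) (x j : ℕ) : ℕ := ∑ c ∈ Finset.Ico 1 j, if par c = x then 1 else 0

theorem numChildren_succ (par : ℕ → ℕ) (x : ℕ) {j : ℕ} (hj : 1 ≤ j) :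
    numChildren par x (j + 1) = numChildren par x j + if par j = x then 1 else 0 :=
  Finset.sum_Ico_succ_top hj _

/-- Each vertex has one parent and is counted at most once. -/
theorem sum_numChildren_le (par : ℕ → ℕ) (n : ℕ) :
    ∑ i ∈ Finset.range n, numChildren par (n - i) (n + 1) ≤ n := by
  simp only [numChildren]
  rw [Finset.sum_comm]
  calc _ ≤ ∑ c ∈ Finset.Ico 1 (n + 1), 1 := by
        refine Finset.sum_le_sum fun c _ => ?_
        rw [Finset.sum_boole, Nat.cast_id, Finset.card_le_one]
        intro a ha b hb
        simp only [Finset.mem_filter, Finset.mem_range] at ha hb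
        omega
    _ = n := by simp

/-- A vertex that is no child costs `4` steps: the skip, the test of the branch, and the test and
increment of the loop. A child costs at most `T` more, which keeps the sum over all `x` quadratic
when `T` is linear. -/
theorem does_forChildren {S n x : ℕ} {par : ℕ → ℕ} {σ : State} {Q : State → Prop}
    {I : ℕ → State → Prop} {body : Cmd} (T : ℕ) (hS : n + 1 ≤ S)
    (hI : ∀ j τ, I j τ → τ.ints 0 0 = n ∧ τ.ints 5 = par ∧ τ.ints 10 0 = x)
    (h0 : I 1 (σ.setInt 13 0 1))
    (skip : ∀ j τ, 1 ≤ j → j ≤ n → par j ≠ x → I j τ → I (j + 1) (τ.setInt 13 0 (j + 1)))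
    (step : ∀ j τ, 1 ≤ j → j ≤ n → par j = x → I j τ → τ.ints 13 0 = j →
      Does S body τ T fun υ => υ.ints 13 0 = j ∧ I (j + 1) (υ.setInt 13 0 (j + 1)))
    (hQ : ∀ τ, I (n + 1) τ → Q τ) :
    Does S (forChildren body) σ (T * numChildren par x (n + 1) + 4 * n + 2) Q := by
  refine (does_forLoop (I := I) (a := 1) (N := n + 1)
    (fun j => (if par j = x then T else 1) + 1) rfl (by omega) hS (by omega) ?_ h0 ?_ hQ).mono
    ?_ fun _ h => h
  · intro j τ h
    obtain ⟨h1, -, -⟩ := hI j τ h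
    simp [nPlusOne, IExpr.eval, h1]
  · intro j τ h1 hj hIj hk
    obtain ⟨e1, e2, e3⟩ := hI j τ hIj
    by_cases hx : par j = x
    · rw [if_pos hx]
      refine does_ite (fun _ => step j τ h1 (by omega) hx hIj hk) fun hc => ?_
      exfalso
      apply hc
      simp only [BExpr.Holds, IExpr.eval, eval_ivar, hk, e2, e3, hx]
      omega
    · rw [if_neg hx]
      refine does_ite (fun hc => ?_) fun _ =>
        does_skip ⟨hk, skip j τ h1 (by omega) hx hIj⟩
      exfalso
      simp only [BExpr.Holds, IExpr.eval, eval_ivar, hk, e2, e3] at hc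
      omega
  · have : ∀ j ∈ Finset.Ico 1 (n + 1), (if par j = x then T else 1) + 1 + 2 ≤
        T * (if par j = x then 1 else 0) + 4 := fun j _ => by
      split_ifs <;> omega
    refine (Nat.add_le_add_right (Finset.sum_le_sum this) 2).trans ?_
    rw [Finset.sum_add_distrib, ← Finset.mul_sum]
    simp [numChildren]
    omega

/-! ### The three phases of the treatment of a vertex -/

/-- Choose a direction in general position for the edge above the vertex `13`. -/
def aim : Cmd :=
  .seq (setV 20 (.lit 0) ((vget 40 (ivar 13)).sub (vget 40 (ivar 10))))
  (.seq (setV 24 (.lit 0) (vget 40 (ivar 10)))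
  (.seq (setV 50 (.lit 0) .zero)
  (.seq (.setR 54 (.lit 0) .one) pick)))

theorem does_aim {S n c x : ℕ} {par : ℕ → ℕ} {σ : State} (hS : n + 1 ≤ S) (hn : σ.ints 0 0 = n)
    (hpar : σ.ints 5 = par) (hx : σ.ints 10 0 = x) (hc : σ.ints 13 0 = c) :
    Does S aim σ (90 * n + 27) fun τ => Frame σ τ ∧ vecAt τ 20 0 = vecAt σ 40 c - vecAt σ 40 x ∧
      vecAt τ 24 0 = vecAt σ 40 x ∧ 0 < τ.reals 54 0 ∧ pickBall τ ⊆ Metric.ball 0 1 ∧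
      ∀ v, 0 < v → v ≤ n → ∀ y ∈ pickBall τ, y ∉ Submodule.span ℝ
        ({vecAt σ 40 c - vecAt σ 40 x, vecAt σ 40 (par v) - vecAt σ 40 x,
          vecAt σ 40 v - vecAt σ 40 x} : Set E4) := by
  have hS0 : 0 < S := by omega
  refine (Does.seq (T := 8) (does_setV (Q := fun τ => WroteV σ τ 20 0 (vecAt σ 40 c - vecAt σ 40 x))
    ?_ (by norm_num) hS0 (fun τ h => ?_)) ?_).mono
    (T := 8 + (8 + (8 + (1 + (90 * n + 2))))) (by omega) fun _ h => h
  · refine VExpr.isLow_of_eval fun σ τ hi _ h => ?_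
    simp [h, hi]
  · simpa [hx, hc] using h
  intro τ hτ
  have f1 : Frame σ τ := hτ.frame (by norm_num) (by norm_num)
  refine Does.seq (Q' := fun υ => Frame σ υ ∧ vecAt υ 20 0 = vecAt σ 40 c - vecAt σ 40 x ∧
    vecAt υ 24 0 = vecAt σ 40 x) (does_setV ?_ (by norm_num) hS0 fun υ hυ => ?_) ?_
  · refine VExpr.isLow_of_eval fun σ τ hi _ h => ?_
    simp [h, hi]
  · refine ⟨f1.trans (hυ.frame (by norm_num) (by norm_num)), ?_, ?_⟩
    · rw [hυ.vecAt _ _ (by norm_num) (by norm_num), hτ.vec]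
    · have := hυ.vec
      simpa [f1.ints 10, hx, f1.vecAt] using this
  rintro υ ⟨u1, u2, u3⟩
  refine Does.seq (Q' := fun ω => Frame σ ω ∧ vecAt ω 20 0 = vecAt σ 40 c - vecAt σ 40 x ∧
    vecAt ω 24 0 = vecAt σ 40 x ∧ vecAt ω 50 0 = 0)
    (does_setV ?_ (by norm_num) hS0 fun ω hω => ?_) ?_
  · refine VExpr.isLow_of_eval fun σ τ hi _ h => ?_
    simp
  · refine ⟨u1.trans (hω.frame (by norm_num) (by norm_num)), ?_, ?_, ?_⟩
    · rw [hω.vecAt _ _ (by norm_num) (by norm_num), u2]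
    · rw [hω.vecAt _ _ (by norm_num) (by norm_num), u3]
    · have := hω.vec
      simpa using this
  rintro ω ⟨w1, w2, w3, w4⟩
  have hk : Keep 54 ω (ω.setReal 54 0 1) := (Keep.refl _ _).setReal le_rfl
  refine Does.seq (Q' := fun υ => υ = ω.setReal 54 0 1) (does_setR hS0 rfl) ?_
  rintro _ rfl
  have f2 : Frame σ (ω.setReal 54 0 1) := w1.trans (hk.frame (by norm_num))
  refine (does_pick (n := n) _ (by rw [f2.ints 0 (by norm_num), hn]) hS
    (by rw [State.setReal_reals_self]; exact one_pos)).mono le_rfl ?_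
  rintro υ ⟨k, hδ, hb, hv⟩
  refine ⟨f2.trans (k.frame (by norm_num)), ?_, ?_, hδ, ?_, ?_⟩
  · rw [k.vecAt _ _ (by norm_num), hk.vecAt _ _ (by norm_num), w2]
  · rw [k.vecAt _ _ (by norm_num), hk.vecAt _ _ (by norm_num), w3]
  · refine hb.trans ?_
    rw [pickBall, hk.vecAt _ _ (by norm_num), w4, State.setReal_reals_self]
  · intro v h0 h1 y hy
    have := hv v h0 h1 y hy
    rwa [hk.vecAt 20 _ (by norm_num), hk.vecAt 24 _ (by norm_num), w2, w3, f2.vecAt, f2.vecAt,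
      f2.ints 5 (by norm_num), hpar] at this

theorem State.setReal_self (σ : State) (k i : ℕ) : σ.setReal k i (σ.reals k i) = σ := by
  simp only [State.setReal]
  congr
  funext k' i'
  simp only [update]
  split_ifs with h
  · rw [h.1, h.2]
  · rfl

theorem not_desc_par_of_not_desc {par : ℕ → ℕ} {x v : ℕ} (h : ¬ Desc par x v) :
    ¬ Desc par x (par v) := fun h' => h h'.of_par

theorem IsClear.congr {par : ℕ → ℕ} {n x c : ℕ} {P P' : ℕ → E4} {κ : ℝ}
    (h : IsClear par n x c P κ) (hx : P' x = P x) (hv : ∀ v, ¬ Desc par x v → P' v = P v)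
    (hc : edgeDir par P' c = edgeDir par P c) : IsClear par n x c P' κ := by
  intro v h0 hn hd
  rw [hx, hv v hd, hv _ (not_desc_par_of_not_desc hd), hc]
  exact h v h0 hn hd

theorem IsFree.congr {par : ℕ → ℕ} {n x : ℕ} {P P' : ℕ → E4}
    (h : IsFree par n x P) (hx : P' x = P x) (hv : ∀ v, ¬ Desc par x v → P' v = P v)
    (hc : edgeDir par P' x = edgeDir par P x) : IsFree par n x P' := by
  intro v h0 hn hd
  rw [hx, hv v hd, hv _ (not_desc_par_of_not_desc hd), hc]
  exact h v h0 hn hd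

/-- First phase: turn the rods that hang from the vertex `10` into general position, and compute in
`12` a bound for how clear they are of other edges. -/
def phaseA : Cmd :=
  .seq (.setR 12 (.lit 0) .one)
  (forChildren (.seq aim (.seq
    (.ite (.rlt (rvar 54) (rvar 12)) (.setR 12 (.lit 0) (rvar 54)) .skip) (rotate 13))))

section

variable {S n x B : ℕ} {par ord : ℕ → ℕ} {P₀ : ℕ → E4} (hS : n + 1 ≤ S)
  (hp : IsParentMap par) (hpn : ∀ v, n < v → par v = 0)
include hS hp hpn

/-- The rods already treated are at rest while the next one turns, so their clearance persists; the
recorded bound is the minimum of the radii found, and can only decrease. -/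
theorem does_phaseA {σ : State} (hx : 0 < x) (hxn : x ≤ n)
    (h : Cur n par ord P₀ {v | x < par v} B σ) (hσ : σ.ints 10 0 = x) :
    Does S phaseA σ ((103 * n + 33) * numChildren par x (n + 1) + 4 * n + 3) fun τ =>
      Cur n par ord P₀ {v | x < par v} (B + numChildren par x (n + 1)) τ ∧
      (∀ k, k < 13 → τ.ints k = σ.ints k) ∧ 0 < τ.reals 12 0 ∧ τ.reals 12 0 ≤ 1 ∧
      ∀ c, c ≤ n → par c = x → edgeDir par (vecAt τ 40) c ≠ edgeDir par (vecAt τ 40) x ∧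
        IsClear par n x c (vecAt τ 40) (τ.reals 12 0) := by
  have hS0 : 0 < S := by omega
  set K : Set ℕ := {v | x < par v} with hK
  let I : ℕ → State → Prop := fun j τ => Cur n par ord P₀ K (B + numChildren par x j) τ ∧
      (∀ k, k < 13 → τ.ints k = σ.ints k) ∧ 0 < τ.reals 12 0 ∧ τ.reals 12 0 ≤ 1 ∧
      ∀ c, c ≤ n → par c = x → c < j →
        edgeDir par (vecAt τ 40) c ≠ edgeDir par (vecAt τ 40) x ∧
        IsClear par n x c (vecAt τ 40) (τ.reals 12 0)
  refine (Does.seq (T := 1) (Q' := fun τ => τ = σ.setReal 12 0 1) (does_setR hS0 rfl) ?_).mono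
    (T := 1 + ((103 * n + 33) * numChildren par x (n + 1) + 4 * n + 2)) (by omega) fun _ h => h
  rintro _ rfl
  have hpos : ∀ c, par c = x → 0 < c := fun c hc => hp.pos_of_pos (hc ▸ hx)
  refine does_forChildren (I := I) (par := par) (x := x) (103 * n + 33) hS ?_ ?_ ?_ ?_ ?_
  · rintro j τ ⟨h1, h2, -⟩
    exact ⟨h1.n_eq, h1.par_eq, by rw [h2 10 (by norm_num), hσ]⟩
  · refine ⟨?_, fun k hk => ?_, ?_, ?_, fun c _ hc hc1 => ?_⟩
    · exact ((h.setReal (by norm_num)).setInt (by norm_num)).mono (by omega)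
    · rw [State.setInt_ints_of_ne _ (by omega)]; rfl
    · rw [State.setInt_reals, State.setReal_reals_self]; exact one_pos
    · rw [State.setInt_reals, State.setReal_reals_self]
    · have := hpos c hc
      omega
  · rintro j τ hj hjn hne ⟨h1, h2, h3, h4, h5⟩
    refine ⟨?_, fun k hk => ?_, h3, h4, fun c hcn hc hcj => ?_⟩
    · rw [numChildren_succ _ _ hj]
      exact (h1.setInt (by norm_num)).mono (by omega)
    · rw [State.setInt_ints_of_ne _ (by omega), h2 k hk]
    · refine h5 c hcn hc ?_
      rcases Nat.lt_succ_iff_lt_or_eq.1 hcj with h | rfl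
      · exact h
      · exact absurd hc hne
  · rintro c τ hc1 hcn hcx ⟨h1, h2, h3, h4, h5⟩ hk
    have hxc : x < c := hcx ▸ hp.lt c hc1
    refine (Does.seq (does_aim hS h1.n_eq h1.par_eq (by rw [h2 10 (by norm_num), hσ]) hk)
      ?_).mono (T := (90 * n + 27) + (2 + (13 * n + 4))) (by omega) fun _ h => h
    rintro υ ⟨f, u20, -, uδ, ub, uv⟩
    obtain ⟨P, hP⟩ : ∃ P, P = vecAt τ 40 := ⟨_, rfl⟩
    have hPυ : vecAt υ 40 = P := by rw [f.pos, hP]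
    rw [← hP] at uv u20 h5
    obtain ⟨w, hw⟩ : ∃ w, w = vecAt υ 50 0 := ⟨_, rfl⟩
    have hwb : w ∈ pickBall υ := by rw [hw]; exact Metric.mem_ball_self uδ
    have hw1 : ‖w‖ ≤ 1 := by
      have := ub hwb
      rw [mem_ball_zero_iff] at this
      exact this.le
    obtain ⟨δ, hδ⟩ : ∃ δ, δ = υ.reals 54 0 := ⟨_, rfl⟩
    rw [← hδ] at uδ
    have e12 : υ.reals 12 = τ.reals 12 := f.reals 12 (by norm_num)
    -- Variable `12` becomes the smaller of its old value and the new radius `δ`.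
    refine Does.seq (T := 2) (Q' := fun ω => (∃ r, ω = υ.setReal 12 0 r) ∧
      0 < ω.reals 12 0 ∧ ω.reals 12 0 ≤ δ ∧ ω.reals 12 0 ≤ τ.reals 12 0)
      (does_ite (T := 1) (fun hc => ?_) fun hc => ?_) ?_
    · refine does_setR hS0 ⟨⟨δ, by rw [eval_lit, eval_rvar, hδ]⟩, ?_⟩
      simp only [BExpr.Holds, eval_rvar, e12, ← hδ] at hc
      rw [eval_lit, eval_rvar, State.setReal_reals_self, ← hδ]
      exact ⟨uδ, le_rfl, hc.le⟩
    · refine does_skip ⟨⟨υ.reals 12 0, (State.setReal_self _ _ _).symm⟩, ?_⟩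
      simp only [BExpr.Holds, eval_rvar, e12, ← hδ] at hc
      rw [e12]
      exact ⟨h3, not_lt.1 hc, le_rfl⟩
    rintro ω ⟨⟨r, hr⟩, ω0, ωδ, ωτ⟩
    have hcur : Cur n par ord P₀ K (B + numChildren par x c) ω := by
      rw [hr]
      exact (h1.frame f).setReal (by norm_num)
    have hPω : vecAt ω 40 = P := by
      rw [← hPυ, hr]
      exact funext fun v => vecAt_setReal (by omega)
    have h20 : vecAt ω 20 0 = P c - P x := by rw [hr, vecAt_setReal (by omega), u20]
    have h50 : vecAt ω 50 0 = w := by rw [hr, vecAt_setReal (by omega), hw]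
    have hinv : Inv par n K P := hP ▸ h1.inv
    have hs0 : P c - P x ≠ 0 := sub_ne_zero.2 (hcx ▸ hinv.ne c hc1 hcn)
    have hwv : ∀ v, 0 < v → v ≤ n →
        w ∉ Submodule.span ℝ ({P c - P x, P (par v) - P (par c), P v - P (par c)} : Set E4) :=
      fun v h0 hn => hcx.symm ▸ uv v h0 hn w hwb
    have hw' : w ∉ Submodule.span ℝ ({P c - P x} : Set E4) := fun h =>
      hwv c hc1 hcn (Submodule.span_mono (by simp) h)
    have hsc : dirVec (P c - P x) = edgeDir par P c := by rw [edgeDir, hcx]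
    have hstep := hinv.isStep_rod hp h1.isAligned hc1 hcn (b := c) (s := P c - P x) (w := w)
      (by simp [hK, hcx]) (fun u hd _ hne => lt_of_lt_of_le hxc (hd.le_par hp hne)) hs0 hsc hwv
    have hdir := edgeDir_turnTo hp (P := P) hc1 hs0 hsc hw'
    have hxd : ¬ Desc par c x := fun hd => (hd.le hp).not_gt hxc
    have hkω : ω.ints 13 0 = c := by rw [hr, State.setReal_ints, f.ints 13 (by norm_num), hk]
    refine (hcur.does_rotate hS hp hpn (kb := 13) (b := c) (by norm_num) hkω
      (by rw [hPω, h20, h50]; exact hstep)).mono le_rfl ?_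
    rw [hPω, h20, h50]
    rintro φ ⟨v1, v2, v3⟩
    have e12' : φ.reals 12 0 = ω.reals 12 0 := by rw [v2.reals 12 (by norm_num) (by norm_num)]
    have hφ : vecAt (φ.setInt 13 0 (c + 1)) 40 =
        (turnTo c (P c - P x) w).pos par P 1 := v3
    refine ⟨by rw [v2.ints 13 (by norm_num), hkω], ?_, fun k hk => ?_, ?_, ?_, ?_⟩
    · rw [numChildren_succ _ _ hc1, if_pos hcx]
      exact v1.setInt (by norm_num)
    · rw [State.setInt_ints_of_ne _ (by omega), v2.ints k (by omega), hr, State.setReal_ints,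
        f.ints k (by omega), h2 k hk]
    · rw [State.setInt_reals, e12']; exact ω0
    · rw [State.setInt_reals, e12']; exact ωτ.trans h4
    rw [hφ, State.setInt_reals, e12']
    intro c' hc'n hc' hc'c
    rcases Nat.lt_succ_iff_lt_or_eq.1 hc'c with hlt | rfl
    · obtain ⟨g1, g2⟩ := h5 c' hc'n hc' hlt
      have hd : ¬ Desc par c c' := not_desc_of_par_eq hp hxc hcx hc' hlt.ne
      refine ⟨?_, (g2.mono ωτ).congr (turnTo_pos_of_not_desc hxd)
        (fun v hv => turnTo_pos_of_not_desc (not_desc_child hcx hv))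
        (edgeDir_turnTo_of_not_desc hd)⟩
      rwa [edgeDir_turnTo_of_not_desc hd, edgeDir_turnTo_of_not_desc hxd]
    · constructor
      · rw [hdir, edgeDir_turnTo_of_not_desc hxd]
        intro he
        -- The direction of the edge above `x` lies in the span that belongs to this edge, so the
        -- general `w` cannot point along it.
        apply hwv x hx hxn
        rw [← norm_smul_dirVec w, he, hcx]
        refine Submodule.smul_mem _ _ ?_
        rw [edgeDir, dirVec, ← neg_sub (P (par x)), smul_neg]
        exact Submodule.neg_mem _ (Submodule.smul_mem _ _ (Submodule.subset_span (by simp)))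
      · intro v h0 hn hd Y hY τ' hτ'
        rw [turnTo_pos_of_not_desc hxd, turnTo_pos_of_not_desc (not_desc_child hcx hd),
          turnTo_pos_of_not_desc fun h => hd (not_not.1 fun h' =>
            not_desc_child hcx h' h.of_par)] at hY
        rw [hdir]
        refine (mul_le_mul_of_nonneg_right ωδ hτ').trans ?_
        rw [hδ] at *
        exact le_norm_sub_of_ball (ne_zero_of_notMem_span hs0 hw') hw1
          (fun y hy => uv v h0 hn y (by rw [pickBall, ← hw]; exact hy))
          (mem_span_of_mem_segment (by simp) (by simp) hY) hτ'
  · rintro τ ⟨h1, h2, h3, h4, h5⟩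
    exact ⟨h1, h2, h3, h4, fun c hcn hc => h5 c hcn hc (by omega)⟩

end

/-- A contact would have to be at a shared end. It cannot be the parent of `x`, whose place differs
from that of `x`; and `x` is an end only of the edge above it and of the edges to its children, all
of which lie below `x`. -/
theorem Inv.notMem_segment {par : ℕ → ℕ} {n : ℕ} {K : Set ℕ} {P : ℕ → E4} (h : Inv par n K P)
    (hp : IsParentMap par) (hK : IsAligned par K) {x v : ℕ} (hx : 0 < x) (hxn : x ≤ n)
    (hxK : x ∉ K) (hv : 0 < v) (hvn : v ≤ n) (hd : ¬ Desc par x v) :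
    P x ∉ segment ℝ (P (par v)) (P v) := by
  intro hmem
  have hne : x ≠ v := fun e => hd (e ▸ Desc.refl _ _)
  have htop : top par K x ≠ top par K v := top_ne_top hp hK hxK (Desc.refl _ _) hd
  obtain ⟨u, ⟨hu1, hu2⟩, hu⟩ := h.clean x v hx hxn hv hvn hne htop
    ⟨right_mem_segment ℝ _ _, hmem⟩
  rcases hu1 with rfl | rfl
  · exact h.ne x hx hxn hu.symm
  · rcases hu2 with e | e
    · exact hd (desc_iff.2 (Or.inr (e ▸ Desc.refl _ _)))
    · exact hne e

/-- A lower bound for the distance of the origin from the segment between `A` and `B`. -/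
def excess (A B : E4) : ℝ := (‖A‖ + ‖B‖ - ‖A - B‖) / 2

/-- Compute in `70` a number that is at most `1` and at most the distance of the vertex `10` from
all edges that do not contain it. -/
def clearance : Cmd :=
  .seq (.setR 70 (.lit 0) .one)
  (forLoop 72 (.lit 1) nPlusOne (.seq
    (.setR 71 (.lit 0) (.div (.sub (.add ((vget 40 (.get 5 (ivar 72))).sub (vget 40 (ivar 10))).norm
      ((vget 40 (ivar 72)).sub (vget 40 (ivar 10))).norm)
      (((vget 40 (.get 5 (ivar 72))).sub (vget 40 (ivar 10))).sub
        ((vget 40 (ivar 72)).sub (vget 40 (ivar 10)))).norm) rTwo))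
    (.ite (.and (.rlt .zero (rvar 71)) (.rlt (rvar 71) (rvar 70)))
      (.setR 70 (.lit 0) (rvar 71)) .skip)))

/-- The excess vanishes for edges through the vertex, so the test for positivity discards these
without consulting the tree. The initial value `1` keeps the minimum positive if nothing remains. -/
theorem does_clearance {S n x : ℕ} {par : ℕ → ℕ} {P : ℕ → E4} {σ : State} (hS : n + 1 ≤ S)
    (hn : σ.ints 0 0 = n) (hx : σ.ints 10 0 = x) (hpar : σ.ints 5 = par) (hP : vecAt σ 40 = P) :
    Does S clearance σ (5 * n + 3) fun τ => Keep 70 σ τ ∧ 0 < τ.reals 70 0 ∧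
      ∀ v, 0 < v → v ≤ n → 0 < excess (P (par v) - P x) (P v - P x) →
        τ.reals 70 0 ≤ excess (P (par v) - P x) (P v - P x) := by
  have hS0 : 0 < S := by omega
  let I : ℕ → State → Prop := fun j τ => Keep 70 σ τ ∧ 0 < τ.reals 70 0 ∧
      ∀ v, 0 < v → v < j → 0 < excess (P (par v) - P x) (P v - P x) →
        τ.reals 70 0 ≤ excess (P (par v) - P x) (P v - P x)
  refine (Does.seq (T := 1) (Q' := fun τ => τ = σ.setReal 70 0 1) (does_setR hS0 rfl) ?_).mono
    (T := 1 + ((n + 1 - 1) * (3 + 2) + 2)) (by simp; omega) fun _ h => h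
  rintro _ rfl
  refine does_forLoop_const (I := I) (a := 1) (N := n + 1) 3 rfl (by omega) hS hS0 ?_ ?_ ?_ ?_
  · rintro j τ ⟨k, -⟩
    simp [nPlusOne, IExpr.eval, k.ints 0 (by norm_num), hn]
  · refine ⟨((Keep.refl _ _).setReal le_rfl).setInt (by norm_num), ?_, fun v h0 h1 => by omega⟩
    rw [State.setInt_reals, State.setReal_reals_self]
    exact one_pos
  · rintro j τ h1 hj ⟨k, hδ, hv⟩ hk
    have e5 : τ.ints 5 = par := by rw [k.ints 5 (by norm_num), hpar]
    have e10 : τ.ints 10 0 = x := by rw [k.ints 10 (by norm_num), hx]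
    have eP : ∀ v, vecAt τ 40 v = P v := fun v => by
      rw [k.vecAt _ _ (by norm_num), hP]
    obtain ⟨y, hy⟩ : ∃ y, y = excess (P (par j) - P x) (P j - P x) := ⟨_, rfl⟩
    refine (Does.seq (T := 1) (T' := 2) (Q' := fun υ => υ = τ.setReal 71 0 y)
      (does_setR hS0 ?_) ?_)
    · simp [RExpr.eval, IExpr.eval, e5, e10, hk, eP, hy, excess]
    rintro _ rfl
    have e71 : (τ.setReal 71 0 y).reals 71 0 = y := State.setReal_reals_self _ _ _ _
    have e70 : (τ.setReal 71 0 y).reals 70 = τ.reals 70 :=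
      State.setReal_reals_of_ne _ (by norm_num)
    refine does_ite (fun hc => ?_) fun hc => ?_
    · simp only [BExpr.Holds, eval_rvar, RExpr.eval, e71, e70] at hc
      refine does_setR hS0 ⟨hk, ((k.setReal (by norm_num)).setReal le_rfl).setInt (by norm_num),
        ?_, fun v h0 hvj h => ?_⟩
      · rw [State.setInt_reals, eval_lit, State.setReal_reals_self, eval_rvar, e71]
        exact hc.1
      · rw [State.setInt_reals, eval_lit, State.setReal_reals_self, eval_rvar, e71]
        rcases Nat.lt_succ_iff_lt_or_eq.1 hvj with h' | rfl
        · exact hc.2.le.trans (hv v h0 h' h)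
        · exact hy.le
    · simp only [BExpr.Holds, eval_rvar, RExpr.eval, e71, e70] at hc
      refine does_skip ⟨hk, (k.setReal (by norm_num)).setInt (by norm_num), ?_,
        fun v h0 hvj h => ?_⟩
      · rw [State.setInt_reals, e70]
        exact hδ
      · rw [State.setInt_reals, e70]
        rcases Nat.lt_succ_iff_lt_or_eq.1 hvj with h' | rfl
        · exact hv v h0 h' h
        · rw [← hy] at h ⊢
          exact not_lt.1 fun h'' => hc ⟨h, h''⟩
  · rintro τ ⟨k, hδ, hv⟩
    exact ⟨k, hδ, fun v h0 hvn => hv v h0 (by omega)⟩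

/-- Second phase: turn the whole broom of the vertex `10` a little, so that the extension of its
handle is free. -/
def phaseB : Cmd :=
  .seq clearance
  (.seq (setV 20 (.lit 0) ((vget 40 (ivar 10)).sub (vget 40 (.get 5 (ivar 10)))))
  (.seq (setV 24 (.lit 0) (vget 40 (.get 5 (ivar 10))))
  (.seq (setV 50 (.lit 0) (vvar 20).dir)
  (.seq (.setR 54 (.lit 0) (.div (.mul (rvar 12) (rvar 70))
    (.add (.mul rEight (vvar 20).norm) (.mul rFour (rvar 70)))))
  (.seq pick (rotate 10))))))

section

variable {S n x B : ℕ} {par ord : ℕ → ℕ} {P₀ : ℕ → E4} (hS : n + 1 ≤ S)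
  (hp : IsParentMap par) (hpn : ∀ v, n < v → par v = 0)
include hS hp hpn

/-- Starting the search from a ball around the present direction of the handle, with the radius
required by `Inv.isStep_broom`, makes the result at once general and close. -/
theorem does_phaseB {σ : State} (hx : 0 < x) (hxn : x ≤ n)
    (h : Cur n par ord P₀ {v | x < par v} B σ) (hσ : σ.ints 10 0 = x)
    (h0 : 0 < σ.reals 12 0) (h1 : σ.reals 12 0 ≤ 1)
    (hc : ∀ c, c ≤ n → par c = x → edgeDir par (vecAt σ 40) c ≠ edgeDir par (vecAt σ 40) x ∧
      IsClear par n x c (vecAt σ 40) (σ.reals 12 0)) :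
    Does S phaseB σ (108 * n + 34) fun τ =>
      Cur n par ord P₀ {v | x < par v} (B + 1) τ ∧ (∀ k, k < 13 → τ.ints k = σ.ints k) ∧
      IsFree par n x (vecAt τ 40) ∧
      ∀ c, c ≤ n → par c = x → edgeDir par (vecAt τ 40) c ≠ edgeDir par (vecAt τ 40) x := by
  have hS0 : 0 < S := by omega
  obtain ⟨P, hP⟩ : ∃ P, P = vecAt σ 40 := ⟨_, rfl⟩
  obtain ⟨κ, hκ⟩ : ∃ κ, κ = σ.reals 12 0 := ⟨_, rfl⟩
  have hinv : Inv par n {v | x < par v} P := hP ▸ h.inv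
  have hxK : x ∉ {v | x < par v} := fun h => (hp.le x).not_gt h
  rw [← hP, ← hκ] at hc
  rw [← hκ] at h0 h1
  refine (Does.seq (does_clearance hS h.n_eq hσ h.par_eq hP.symm) ?_).mono
    (T := (5 * n + 3) + (8 + (8 + (8 + (1 + ((90 * n + 2) + (13 * n + 4))))))) (by omega)
    fun _ h => h
  rintro τ ⟨k, ρ0, hρ⟩
  obtain ⟨ρ, hρτ⟩ : ∃ ρ, ρ = τ.reals 70 0 := ⟨_, rfl⟩
  rw [← hρτ] at ρ0 hρ
  have hρ' : ∀ v, 0 < v → v ≤ n → ¬ Desc par x v →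
      ∀ Y ∈ segment ℝ (P (par v) - P x) (P v - P x), ρ ≤ ‖Y‖ := by
    intro v hv hvn hd Y hY
    refine (hρ v hv hvn (excess_pos fun h' => ?_)).trans (excess_le_norm hY)
    refine hinv.notMem_segment hp h.isAligned hx hxn hxK hv hvn hd ?_
    have := (mem_segment_translate ℝ (P x)).2 h'
    simpa using this
  refine Does.seq (Q' := fun υ => Frame σ υ ∧ υ.reals 70 0 = ρ ∧
    vecAt υ 20 0 = P x - P (par x)) (does_setV ?_ (by norm_num) hS0 fun υ hυ => ?_) ?_
  · refine VExpr.isLow_of_eval fun σ τ hi _ h => ?_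
    simp [h, hi, IExpr.eval]
  · refine ⟨(k.frame (by norm_num)).trans (hυ.frame (by norm_num) (by norm_num)), ?_, ?_⟩
    · rw [hυ.reals 70 (by norm_num) (by norm_num), hρτ]
    · have := hυ.vec
      simpa [IExpr.eval, k.ints 10, k.ints 5, k.vecAt, hσ, h.par_eq, ← hP] using this
  rintro υ ⟨u1, u2, u3⟩
  refine Does.seq (Q' := fun ω => Frame σ ω ∧ ω.reals 70 0 = ρ ∧
    vecAt ω 20 0 = P x - P (par x) ∧ vecAt ω 24 0 = P (par x))
    (does_setV ?_ (by norm_num) hS0 fun ω hω => ?_) ?_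
  · refine VExpr.isLow_of_eval fun σ τ hi _ h => ?_
    simp [h, hi, IExpr.eval]
  · refine ⟨u1.trans (hω.frame (by norm_num) (by norm_num)), ?_, ?_, ?_⟩
    · rw [hω.reals 70 (by norm_num) (by norm_num), u2]
    · rw [hω.vecAt _ _ (by norm_num) (by norm_num), u3]
    · have := hω.vec
      simpa [IExpr.eval, u1.ints 10, u1.ints 5, u1.pos, hσ, h.par_eq, ← hP] using this
  rintro ω ⟨w1, w2, w3, w4⟩
  refine Does.seq (Q' := fun φ => Frame σ φ ∧ φ.reals 70 0 = ρ ∧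
    vecAt φ 20 0 = P x - P (par x) ∧ vecAt φ 24 0 = P (par x) ∧ vecAt φ 50 0 = edgeDir par P x)
    (does_setV ?_ (by norm_num) hS0 fun φ hφ => ?_) ?_
  · refine VExpr.isLow_of_eval fun σ τ hi _ h => ?_
    simp [h]
  · refine ⟨w1.trans (hφ.frame (by norm_num) (by norm_num)), ?_, ?_, ?_, ?_⟩
    · rw [hφ.reals 70 (by norm_num) (by norm_num), w2]
    · rw [hφ.vecAt _ _ (by norm_num) (by norm_num), w3]
    · rw [hφ.vecAt _ _ (by norm_num) (by norm_num), w4]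
    · have := hφ.vec
      rw [VExpr.eval_dir, eval_vvar, w3] at this
      exact this
  rintro φ ⟨v1, v2, v3, v4, v5⟩
  obtain ⟨δ, hδ⟩ : ∃ δ, δ = κ * ρ / (8 * ‖P x - P (par x)‖ + 4 * ρ) := ⟨_, rfl⟩
  have hδ0 : 0 < δ := by
    rw [hδ]
    positivity
  have kf : Keep 54 φ (φ.setReal 54 0 δ) := (Keep.refl _ _).setReal le_rfl
  refine Does.seq (Q' := fun φ' => φ' = φ.setReal 54 0 δ) (does_setR hS0 ?_) ?_
  · simp [RExpr.eval, v1.reals 12, v2, v3, hδ, ← hκ]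
  rintro _ rfl
  have f2 : Frame σ (φ.setReal 54 0 δ) := v1.trans (kf.frame (by norm_num))
  refine Does.seq (does_pick (n := n) _ (by rw [f2.ints 0 (by norm_num), h.n_eq]) hS
    (by rw [State.setReal_reals_self]; exact hδ0)) ?_
  rintro ψ ⟨k', hδ', hb, hv⟩
  have f3 : Frame σ ψ := f2.trans (k'.frame (by norm_num))
  obtain ⟨w, hw⟩ : ∃ w, w = vecAt ψ 50 0 := ⟨_, rfl⟩
  have hwb : w ∈ pickBall ψ := by rw [hw]; exact Metric.mem_ball_self hδ'
  have hnear : ‖w - edgeDir par P x‖ < κ * ρ / (8 * ‖P x - P (par x)‖ + 4 * ρ) := by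
    have := hb hwb
    rwa [pickBall, kf.vecAt _ _ (by norm_num), v5, State.setReal_reals_self, mem_ball_iff_norm,
      hδ] at this
  have hwv : ∀ v, 0 < v → v ≤ n → w ∉ Submodule.span ℝ
      ({P x - P (par x), P (par v) - P (par x), P v - P (par x)} : Set E4) := by
    intro v h0 h1
    have := hv v h0 h1 w hwb
    rwa [kf.vecAt 20 _ (by norm_num), kf.vecAt 24 _ (by norm_num), v3, v4, f2.vecAt, f2.vecAt,
      f2.ints 5 (by norm_num), h.par_eq, ← hP] at this
  have h20 : vecAt ψ 20 0 = P x - P (par x) := by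
    rw [k'.vecAt _ _ (by norm_num), kf.vecAt _ _ (by norm_num), v3]
  have hs0 : P x - P (par x) ≠ 0 := sub_ne_zero.2 (hinv.ne x hx hxn)
  have hw' : w ∉ Submodule.span ℝ ({P x - P (par x)} : Set E4) := fun h =>
    hwv x hx hxn (Submodule.span_mono (by simp) h)
  have hstep := hinv.isStep_broom hp h.isAligned hx hxn hxK (fun v _ h => h) hs0 rfl hwv h0 h1 ρ0
    (fun c hcn hcx => (hc c hcn hcx).2) hρ' hnear
  refine ((h.frame f3).does_rotate hS hp hpn (kb := 10) (b := x) (by norm_num)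
    (by rw [f3.ints 10 (by norm_num), hσ]) (by rw [f3.pos, ← hP, h20, ← hw]; exact hstep)).mono
    le_rfl ?_
  rw [f3.pos, ← hP, h20, ← hw]
  rintro χ ⟨x1, x2, x3⟩
  refine ⟨x1, fun k hk => ?_, ?_, fun c hcn hcx => ?_⟩
  · rw [x2.ints k (by omega), f3.ints k (by omega)]
  · rw [x3]
    intro v h0 hvn hd τ hτ
    exact free_of_turnTo hp hinv hx hxn hs0 rfl hwv h0 hvn hd hτ
  · rw [x3]
    -- Handle and rods turn by the same isometry, so different directions stay different.
    exact edgeDir_turnTo_ne hp hx hs0 hw' (Desc.of_par (hcx ▸ Desc.refl _ _)) (Desc.refl _ _)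
      (hc c hcn hcx).1

end

/-- Third phase: align the edges that hang from the vertex `10` with the edge above it, one by one.
The rod is turned into general position first. -/
def phaseC : Cmd :=
  forChildren (.seq aim
    (.seq (setV 28 (.lit 0) (vvar 20))
    (.seq (setV 20 (.lit 0) ((vget 40 (ivar 10)).sub (vget 40 (.get 5 (ivar 10)))))
    (.seq pick
    (.seq (setV 20 (.lit 0) (vvar 28))
    (.seq (rotate 13)
    (.seq (setV 20 (.lit 0) (vvar 50))
    (.seq (setV 50 (.lit 0) ((vget 40 (ivar 10)).sub (vget 40 (.get 5 (ivar 10)))))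
    (rotate 13)))))))))

/-- The aligned vertices when the children of `x` that come before `j` are done. -/
def alignedUpTo (par : ℕ → ℕ) (x j : ℕ) : Set ℕ := {v | x < par v ∨ (par v = x ∧ v < j)}

/-! ### How the aligned set grows in the third phase -/

section

variable {par : ℕ → ℕ} {x j : ℕ}

theorem alignedUpTo_of_le (h : ∀ v, par v = x → j ≤ v) :
    alignedUpTo par x j = {v | x < par v} := by
  ext v
  have := h v
  simp only [alignedUpTo, Set.mem_ofPred_eq]
  grind

theorem alignedUpTo_succ_of_ne (h : par j ≠ x) :
    alignedUpTo par x (j + 1) = alignedUpTo par x j := by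
  ext v
  simp only [alignedUpTo, Set.mem_ofPred_eq]
  grind

theorem alignedUpTo_succ (h : par j = x) :
    alignedUpTo par x (j + 1) = insert j (alignedUpTo par x j) := by
  ext v
  simp only [alignedUpTo, Set.mem_ofPred_eq, Set.mem_insert_iff]
  grind

theorem alignedUpTo_of_lt (h : ∀ v, par v = x → v < j) :
    alignedUpTo par x j = {v | x ≤ par v} := by
  ext v
  have := h v
  simp only [alignedUpTo, Set.mem_ofPred_eq]
  grind

end

section

variable {S n x B : ℕ} {par ord : ℕ → ℕ} {P₀ : ℕ → E4} (hS : n + 1 ≤ S)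
  (hp : IsParentMap par) (hpn : ∀ v, n < v → par v = 0)
include hS hp hpn

/-- Each child takes two moves, to a general direction and from there into the extension of the
handle. The handle stays at rest all the while, so its extension remains free of outer edges, and
the rods not yet treated keep their directions. -/
theorem does_phaseC {σ : State} (hx : 0 < x)
    (h : Cur n par ord P₀ {v | x < par v} B σ) (hσ : σ.ints 10 0 = x)
    (hfree : IsFree par n x (vecAt σ 40))
    (hc : ∀ c, c ≤ n → par c = x → edgeDir par (vecAt σ 40) c ≠ edgeDir par (vecAt σ 40) x) :
    Does S phaseC σ ((206 * n + 77) * numChildren par x (n + 1) + 4 * n + 2) fun τ =>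
      Cur n par ord P₀ {v | x ≤ par v} (B + 2 * numChildren par x (n + 1)) τ ∧
      (∀ k, k < 13 → τ.ints k = σ.ints k) := by
  have hS0 : 0 < S := by omega
  have hpos : ∀ c, par c = x → 0 < c := fun c hc => hp.pos_of_pos (hc ▸ hx)
  have hchild : ∀ v, par v = x → v < n + 1 := fun v hv => by
    by_contra hlt
    have := hpn v (by omega)
    omega
  let I : ℕ → State → Prop := fun j τ =>
    Cur n par ord P₀ (alignedUpTo par x j) (B + 2 * numChildren par x j) τ ∧
      (∀ k, k < 13 → τ.ints k = σ.ints k) ∧ IsFree par n x (vecAt τ 40) ∧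
      ∀ c, c ≤ n → par c = x → j ≤ c →
        edgeDir par (vecAt τ 40) c ≠ edgeDir par (vecAt τ 40) x
  refine does_forChildren (I := I) (par := par) (x := x) (206 * n + 77) hS ?_ ?_ ?_ ?_ ?_
  · rintro j τ ⟨h1, h2, -⟩
    exact ⟨h1.n_eq, h1.par_eq, by rw [h2 10 (by norm_num), hσ]⟩
  · refine ⟨?_, fun k hk => ?_, hfree, fun c hcn hcx _ => hc c hcn hcx⟩
    · rw [alignedUpTo_of_le fun v hv => hpos v hv]
      exact (h.setInt (by norm_num)).mono (by omega)
    · rw [State.setInt_ints_of_ne _ (by omega)]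
  · rintro j τ hj hjn hne ⟨h1, h2, h3, h4⟩
    refine ⟨?_, fun k hk => ?_, h3, fun c hcn hcx hcj => h4 c hcn hcx (by omega)⟩
    · rw [numChildren_succ _ _ hj, if_neg hne, alignedUpTo_succ_of_ne hne]
      exact h1.setInt (by norm_num)
    · rw [State.setInt_ints_of_ne _ (by omega), h2 k hk]
  · rintro c τ hc1 hcn hcx ⟨h1, h2, h3, h4⟩ hk
    have hxc : x < c := hcx ▸ hp.lt c hc1
    have h10 : τ.ints 10 0 = x := by rw [h2 10 (by norm_num), hσ]
    obtain ⟨P, hP⟩ : ∃ P, P = vecAt τ 40 := ⟨_, rfl⟩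
    refine (Does.seq (does_aim hS h1.n_eq h1.par_eq h10 hk) ?_).mono
      (T := (90 * n + 27) + (8 + (8 + ((90 * n + 2) + (8 + ((13 * n + 4) + (8 + (8 +
        (13 * n + 4))))))))) (by omega) fun _ h => h
    rintro υ ⟨f, u20, u24, uδ, -, uv⟩
    rw [← hP] at uv u20 u24 h3 h4
    refine Does.seq (Q' := fun φ => Frame τ φ ∧ vecAt φ 28 0 = P c - P x ∧ vecAt φ 24 0 = P x ∧
      pickBall φ = pickBall υ ∧ 0 < φ.reals 54 0)
      (does_setV ?_ (by norm_num) hS0 fun φ hφ => ?_) ?_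
    · refine VExpr.isLow_of_eval fun σ τ hi _ h => ?_
      simp [h]
    · refine ⟨f.trans (hφ.frame (by norm_num) (by norm_num)), ?_, ?_, ?_, ?_⟩
      · have := hφ.vec
        rwa [eval_vvar, u20] at this
      · rw [hφ.vecAt _ _ (by norm_num) (by norm_num), u24]
      · rw [pickBall, pickBall, hφ.vecAt _ _ (by norm_num) (by norm_num),
          hφ.reals 54 (by norm_num) (by norm_num)]
      · rwa [hφ.reals 54 (by norm_num) (by norm_num)]
    rintro φ ⟨f1, a28, a24, ab, aδ⟩
    refine Does.seq (Q' := fun ω => Frame τ ω ∧ vecAt ω 28 0 = P c - P x ∧ vecAt ω 24 0 = P x ∧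
      pickBall ω = pickBall υ ∧ 0 < ω.reals 54 0 ∧ vecAt ω 20 0 = P x - P (par x))
      (does_setV ?_ (by norm_num) hS0 fun ω hω => ?_) ?_
    · refine VExpr.isLow_of_eval fun σ τ hi _ h => ?_
      simp [h, hi, IExpr.eval]
    · refine ⟨f1.trans (hω.frame (by norm_num) (by norm_num)), ?_, ?_, ?_, ?_, ?_⟩
      · rw [hω.vecAt _ _ (by norm_num) (by norm_num), a28]
      · rw [hω.vecAt _ _ (by norm_num) (by norm_num), a24]
      · rw [← ab, pickBall, pickBall, hω.vecAt _ _ (by norm_num) (by norm_num),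
          hω.reals 54 (by norm_num) (by norm_num)]
      · rwa [hω.reals 54 (by norm_num) (by norm_num)]
      · have := hω.vec
        simpa [IExpr.eval, f1.ints 10, f1.ints 5, f1.pos, h10, h1.par_eq, ← hP] using this
    rintro ω ⟨f2, b28, b24, bb, bδ, b20⟩
    -- The second search starts from the ball left by the first one. Its result is general both with
    -- respect to the rod's old direction and with respect to the handle, as the two rotations
    -- require.
    refine Does.seq (does_pick (n := n) _ (by rw [f2.ints 0 (by norm_num), h1.n_eq]) hS bδ) ?_
    rintro ψ ⟨k, cδ, cb, cv⟩
    have f3 : Frame τ ψ := f2.trans (k.frame (by norm_num))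
    obtain ⟨w, hw⟩ : ∃ w, w = vecAt ψ 50 0 := ⟨_, rfl⟩
    have hwb : w ∈ pickBall ψ := by rw [hw]; exact Metric.mem_ball_self cδ
    have hwv : ∀ v, 0 < v → v ≤ n → w ∉ Submodule.span ℝ
        ({P c - P x, P (par v) - P (par c), P v - P (par c)} : Set E4) :=
      fun v h0 hn => hcx.symm ▸ uv v h0 hn w (bb ▸ cb hwb)
    have hwg : ∀ v, 0 < v → v ≤ n → w ∉ Submodule.span ℝ
        ({P x - P (par x), P (par v) - P x, P v - P x} : Set E4) := by
      intro v h0 hn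
      have := cv v h0 hn w hwb
      rwa [b20, b24, f2.pos, ← hP, f2.ints 5 (by norm_num), h1.par_eq] at this
    have hinv : Inv par n (alignedUpTo par x c) P := hP ▸ h1.inv
    have hs0 : P c - P x ≠ 0 := sub_ne_zero.2 (hcx ▸ hinv.ne c hc1 hcn)
    have hw' : w ∉ Submodule.span ℝ ({P c - P x} : Set E4) := fun h =>
      hwv c hc1 hcn (Submodule.span_mono (by simp) h)
    have hw0 : w ≠ 0 := ne_zero_of_notMem_span hs0 hw'
    have hwg' : w ∉ Submodule.span ℝ ({P x - P (par x)} : Set E4) := fun h =>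
      hwg c hc1 hcn (Submodule.span_mono (by simp) h)
    have hsc : dirVec (P c - P x) = edgeDir par P c := by rw [edgeDir, hcx]
    have hcK : c ∉ alignedUpTo par x c := by
      simp [alignedUpTo, hcx]
    have hxK : x ∉ alignedUpTo par x c := by
      have := hp.lt x hx
      simp only [alignedUpTo, Set.mem_ofPred_eq]
      omega
    have hxd : ¬ Desc par c x := fun hd => (hd.le hp).not_gt hxc
    have hstep := hinv.isStep_rod hp h1.isAligned hc1 hcn hcK
      (fun u hd _ hne => Or.inl (lt_of_lt_of_le hxc (hd.le_par hp hne))) hs0 hsc hwv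
    have hdir := edgeDir_turnTo hp (P := P) hc1 hs0 hsc hw'
    refine Does.seq (Q' := fun χ => Frame τ χ ∧ vecAt χ 20 0 = P c - P x ∧ vecAt χ 50 0 = w)
      (does_setV ?_ (by norm_num) hS0 fun χ hχ => ?_) ?_
    · refine VExpr.isLow_of_eval fun σ τ hi _ h => ?_
      simp [h]
    · refine ⟨f3.trans (hχ.frame (by norm_num) (by norm_num)), ?_, ?_⟩
      · have := hχ.vec
        rwa [eval_vvar, k.vecAt _ _ (by norm_num), b28] at this
      · rw [hχ.vecAt _ _ (by norm_num) (by norm_num), hw]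
    rintro χ ⟨f4, d20, d50⟩
    refine Does.seq ((h1.frame f4).does_rotate hS hp hpn (kb := 13) (b := c) (by norm_num)
      (by rw [f4.ints 13 (by norm_num), hk])
      (by rw [f4.pos, ← hP, d20, d50]; exact hstep)) ?_
    rw [f4.pos, ← hP, d20, d50]
    obtain ⟨P', hP'⟩ : ∃ P', P' = (turnTo c (P c - P x) w).pos par P 1 := ⟨_, rfl⟩
    rw [← hP'] at hdir ⊢
    have rest : ∀ v, ¬ Desc par c v → P' v = P v := fun v hd => by
      rw [hP', turnTo_pos_of_not_desc hd]
    have restd : ∀ v, ¬ Desc par c v → edgeDir par P' v = edgeDir par P v := fun v hd => by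
      rw [hP', edgeDir_turnTo_of_not_desc hd]
    have hxd' : ¬ Desc par c (par x) := not_desc_par_of_not_desc hxd
    have hother : ∀ c', c' ≤ n → par c' = x → c' ≠ c → c ≤ c' →
        edgeDir par P' c' ≠ edgeDir par P' x := fun c' hn hx' hne hle => by
      rw [restd _ hxd, restd _ (not_desc_of_par_eq hp hxc hcx hx' hne)]
      exact h4 c' hn hx' hle
    have hfree' : IsFree par n x P' := h3.congr (rest _ hxd)
      (fun v hv => rest v (not_desc_child hcx hv)) (restd _ hxd)
    rintro α ⟨e1, e2, e3⟩
    refine Does.seq (Q' := fun β => Frame α β ∧ vecAt β 20 0 = w)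
      (does_setV ?_ (by norm_num) hS0 fun β hβ => ?_) ?_
    · refine VExpr.isLow_of_eval fun σ τ hi _ h => ?_
      simp [h]
    · refine ⟨hβ.frame (by norm_num) (by norm_num), ?_⟩
      have := hβ.vec
      rwa [eval_vvar, e2.vecAt _ _ (by norm_num) (by norm_num), d50] at this
    rintro β ⟨f5, g20⟩
    have β10 : β.ints 10 0 = x := by
      rw [f5.ints 10 (by norm_num), e2.ints 10 (by norm_num), f4.ints 10 (by norm_num), h10]
    refine Does.seq (Q' := fun γ => Frame α γ ∧ vecAt γ 20 0 = w ∧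
      vecAt γ 50 0 = P x - P (par x)) (does_setV ?_ (by norm_num) hS0 fun γ hγ => ?_) ?_
    · refine VExpr.isLow_of_eval fun σ τ hi _ h => ?_
      simp [h, hi, IExpr.eval]
    · refine ⟨f5.trans (hγ.frame (by norm_num) (by norm_num)), ?_, ?_⟩
      · rw [hγ.vecAt _ _ (by norm_num) (by norm_num), g20]
      · have := hγ.vec
        simpa [IExpr.eval, β10, f5.ints 5, e1.par_eq, f5.pos, e3, rest _ hxd, rest _ hxd']
          using this
    rintro γ ⟨f6, i20, i50⟩
    have hinv' : Inv par n (alignedUpTo par x c) P' := e3 ▸ e1.inv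
    have hpc' : P' (par c) = P x := by rw [hcx, rest _ hxd]
    -- For the second rotation the general vector `w` is the starting direction, and the handle is
    -- the target.
    have hstep' := hinv'.isStep_align hp e1.isAligned hc1 hcn hcK (hcx.symm ▸ hx)
      (hcx.symm ▸ hxK) (fun v _ hv => Or.inl (hcx ▸ hv)) hw0 hdir.symm (g := P x - P (par x))
      (by rw [hcx, restd _ hxd]; rfl) hwg'
      (fun v h0 hn hd => by
        rw [hpc', rest _ hd, rest _ (not_desc_par_of_not_desc hd)]
        exact hwg v h0 hn)
      (by rw [hcx]; exact hfree')
      (fun c' hn hx' hK' hne => by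
        rw [hcx] at hx' ⊢
        refine hother c' hn hx' hne (not_lt.1 fun hlt => hK' (Or.inr ⟨hx', hlt⟩)))
    refine ((e1.frame f6).does_rotate hS hp hpn (kb := 13) (b := c) (by norm_num)
      (by rw [f6.ints 13 (by norm_num), e2.ints 13 (by norm_num), f4.ints 13 (by norm_num), hk])
      (by rw [f6.pos, e3, i20, i50]; exact hstep')).mono le_rfl ?_
    rw [f6.pos, e3, i20, i50]
    rintro ζ ⟨j1, j2, j3⟩
    have hζ : ∀ k, k < 40 → ζ.ints k = τ.ints k := fun k hk => by
      rw [j2.ints k hk, f6.ints k hk, e2.ints k hk, f4.ints k hk]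
    refine ⟨by rw [hζ 13 (by norm_num), hk], ?_, fun k hk => ?_, ?_, fun c' hn hx' hle => ?_⟩
    · rw [numChildren_succ _ _ hc1, if_pos hcx, alignedUpTo_succ hcx]
      exact (j1.setInt (by norm_num)).mono (by omega)
    · rw [State.setInt_ints_of_ne _ (by omega), hζ k (by omega), h2 k hk]
    · change IsFree par n x (vecAt ζ 40)
      rw [j3]
      exact hfree'.congr (turnTo_pos_of_not_desc hxd)
        (fun v hv => turnTo_pos_of_not_desc (not_desc_child hcx hv))
        (edgeDir_turnTo_of_not_desc hxd)
    · change edgeDir par (vecAt ζ 40) c' ≠ edgeDir par (vecAt ζ 40) x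
      have hne : c' ≠ c := by omega
      rw [j3, edgeDir_turnTo_of_not_desc hxd,
        edgeDir_turnTo_of_not_desc (not_desc_of_par_eq hp hxc hcx hx' hne)]
      exact hother c' hn hx' hne (by omega)
  · rintro τ ⟨h1, h2, -⟩
    rw [alignedUpTo_of_lt hchild] at h1
    exact ⟨h1, h2⟩

end

/-- Treat all vertices, from the last one down to the vertex `1`. -/
def straighten : Cmd :=
  forLoop 9 (.lit 0) (ivar 0)
    (.seq (.setI 10 (.lit 0) (.sub (ivar 0) (ivar 9))) (.seq phaseA (.seq phaseB phaseC)))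

/-- In round `i` the vertex `n - i` is treated. Summing the charges to children with
`sum_numChildren_le` gives linearly many moves and quadratically many steps. -/
theorem does_straighten {S n : ℕ} {par ord : ℕ → ℕ} {σ : State} (hS : n + 1 ≤ S)
    (hp : IsParentMap par) (hpn : ∀ v, n < v → par v = 0) (hn : σ.ints 0 0 = n)
    (hpar : σ.ints 5 = par) (hord : σ.ints 4 = ord) (hout : σ.out = [])
    (hinv : Inv par n ∅ (vecAt σ 40)) :
    Does S straighten σ (425 * n ^ 2 + 152 * n + 2) fun τ => ∃ ms P',
      Reach par n ∅ (vecAt σ 40) ms {v | 0 < par v} P' ∧ ms.length ≤ 4 * n ∧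
      τ.out = ms.map (Turn.toMove par ord) := by
  have hS0 : 0 < S := by omega
  -- One move turns the broom; each child accounts for one move of the first phase and two of the
  -- third.
  let bound : ℕ → ℕ := fun i => ∑ j ∈ Finset.range i, (1 + 3 * numChildren par (n - j) (n + 1))
  let cost : ℕ → ℕ := fun j => (309 * n + 110) * numChildren par (n - j) (n + 1) + (116 * n + 40)
  let I : ℕ → State → Prop := fun i τ =>
    Cur n par ord (vecAt σ 40) {v | n - i < par v} (bound i) τ
  have hsum := sum_numChildren_le par n
  refine (does_forLoop (I := I) (a := 0) (N := n) cost rfl (Nat.zero_le _) (by omega) hS0 ?_ ?_ ?_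
    ?_).mono ?_ fun _ h => h
  · rintro j τ h
    rw [eval_ivar, h.n_eq]
  -- A parent above `n` would belong to a vertex above `n`, but those have parent `0`.
  · have hK : {v | n - 0 < par v} = (∅ : Set ℕ) := by
      ext v
      simp only [Set.mem_ofPred_eq, Set.mem_empty_iff_false, iff_false]
      intro hlt
      have h1 := hp.le v
      have h2 := hpn v (by omega)
      omega
    have h0 : Cur n par ord (vecAt σ 40) {v | n - 0 < par v} (bound 0) σ := by
      rw [hK]
      exact ⟨hn, hpar, hord, ⟨[], .nil _ _, Nat.zero_le _, hout⟩, fun v hv => absurd hv id, hinv⟩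
    exact h0.setInt (by norm_num)
  · intro i τ _ hi h hk
    obtain ⟨x, hx⟩ : ∃ x, x = n - i := ⟨_, rfl⟩
    have hI : Cur n par ord (vecAt σ 40) {v | x < par v} (bound i) τ := hx ▸ h
    have hx0 : 0 < x := by omega
    have hxn : x ≤ n := by omega
    refine (Does.seq (T := 1) (Q' := fun υ => υ = τ.setInt 10 0 x) (does_setI hS0 ?_ ?_) ?_).mono
      (T := 1 + (((103 * n + 33) * numChildren par x (n + 1) + 4 * n + 3) + ((108 * n + 34) +
        ((206 * n + 77) * numChildren par x (n + 1) + 4 * n + 2)))) ?_ fun _ h => h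
    · simp only [IExpr.eval, eval_ivar, hk, hI.n_eq]
      omega
    · simp only [IExpr.eval, eval_ivar, hk, hI.n_eq, hx]
    rotate_left
    · simp only [cost, ← hx]
      apply le_of_eq
      ring
    rintro _ rfl
    refine Does.seq (does_phaseA hS hp hpn hx0 hxn (hI.setInt (by norm_num))
      (State.setInt_ints_self _ _ _ _)) ?_
    rintro υ ⟨a1, a2, a3, a4, a5⟩
    refine Does.seq (does_phaseB hS hp hpn hx0 hxn a1
      (by rw [a2 10 (by norm_num), State.setInt_ints_self]) a3 a4 a5) ?_
    rintro φ ⟨b1, b2, b3, b4⟩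
    refine (does_phaseC hS hp hpn hx0 b1
      (by rw [b2 10 (by norm_num), a2 10 (by norm_num), State.setInt_ints_self]) b3 b4).mono
      le_rfl ?_
    rintro ω ⟨c1, c2⟩
    refine ⟨?_, ?_⟩
    · rw [c2 9 (by norm_num), b2 9 (by norm_num), a2 9 (by norm_num),
        State.setInt_ints_of_ne _ (by norm_num), hk]
    · have hK : {v | x ≤ par v} = {v | n - (i + 1) < par v} := by
        ext v
        simp only [Set.mem_ofPred_eq]
        omega
      change Cur _ _ _ _ _ _ _
      rw [← hK]
      refine (c1.mono ?_).setInt (by norm_num)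
      simp only [bound, Finset.sum_range_succ, ← hx]
      omega
  · intro τ h
    have h : Cur n par ord (vecAt σ 40) {v | n - n < par v} (bound n) τ := h
    obtain ⟨ms, h1, h2, h3⟩ := h.reach
    rw [Nat.sub_self] at h1
    refine ⟨ms, _, h1, h2.trans ?_, h3⟩
    simp only [bound, Finset.sum_add_distrib, ← Finset.mul_sum]
    simp
    omega
  · simp only [cost, ← Finset.range_eq_Ico, Finset.sum_add_distrib, ← Finset.mul_sum]
    simp only [Finset.sum_const, Finset.card_range, smul_eq_mul]
    nlinarith

/-! ### The numbering of the vertices -/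

/-- The vertices `ord 0 = z, …, ord (i - 1)` are numbered, each is joined by `A` to an earlier one,
whose number is given by `par`, and `idx` holds the numbers increased by `1`, and `0` for the
vertices that are not numbered. -/
structure PartialNumbering (n z i : ℕ) (A : ℕ → ℕ → Prop) (idx ord par : ℕ → ℕ) : Prop where
  ord_zero : ord 0 = z
  par_zero : par 0 = 0
  ord_lt : ∀ k, n < k → ord k = 0
  par_lt : ∀ k, n < k → par k = 0
  ord_le : ∀ k, k < i → ord k ≤ n
  idx_ord : ∀ k, k < i → idx (ord k) = k + 1
  idx_le : ∀ v, v ≤ n → idx v ≤ i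
  ord_idx : ∀ v, v ≤ n → 0 < idx v → ord (idx v - 1) = v
  par : ∀ k, 0 < k → k < i → par k < k ∧ A (ord (par k)) (ord k)

theorem PartialNumbering.succ {n z i u w : ℕ} {A : ℕ → ℕ → Prop}
    {idx ord par idx' ord' par' : ℕ → ℕ} (h : PartialNumbering n z i A idx ord par) (hi : 0 < i)
    (hin : i ≤ n) (hu : u ≤ n) (hu0 : idx u = 0) (hw : w ≤ n) (hw0 : 0 < idx w) (hA : A w u)
    (hidx : ∀ v, v ≠ u → idx' v = idx v) (hidx' : idx' u = i + 1)
    (hord : ∀ k, k ≠ i → ord' k = ord k) (hord' : ord' i = u)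
    (hpar : ∀ k, k ≠ i → par' k = par k) (hpar' : par' i = idx w - 1) :
    PartialNumbering n z (i + 1) A idx' ord' par' := by
  have hne : ∀ k, k < i → ord k ≠ u := fun k hk e => by
    have := h.idx_ord k hk
    rw [e] at this
    omega
  have hwi := h.idx_le w hw
  refine ⟨?_, ?_, fun k hk => ?_, fun k hk => ?_, fun k hk => ?_, fun k hk => ?_, fun v hv => ?_,
    fun v hv h0 => ?_, fun k h0 hk => ?_⟩
  · rw [hord 0 (by omega), h.ord_zero]
  · rw [hpar 0 (by omega), h.par_zero]
  · rw [hord k (by omega), h.ord_lt k hk]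
  · rw [hpar k (by omega), h.par_lt k hk]
  · rcases Nat.lt_succ_iff_lt_or_eq.1 hk with h' | rfl
    · rw [hord k h'.ne]; exact h.ord_le k h'
    · rw [hord']; exact hu
  · rcases Nat.lt_succ_iff_lt_or_eq.1 hk with h' | rfl
    · rw [hord k h'.ne, hidx _ (hne k h')]; exact h.idx_ord k h'
    · rw [hord', hidx']
  · by_cases hvu : v = u
    · rw [hvu, hidx']
    · rw [hidx v hvu]; exact (h.idx_le v hv).trans (Nat.le_succ _)
  · by_cases hvu : v = u
    · rw [hvu, hidx', Nat.add_sub_cancel, hord']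
    · rw [hidx v hvu] at h0 ⊢
      have := h.idx_le v hv
      rw [hord _ (by omega)]
      exact h.ord_idx v hv h0
  · rcases Nat.lt_succ_iff_lt_or_eq.1 hk with h' | rfl
    · have := h.par k h0 h'
      rw [hpar k h'.ne, hord k h'.ne, hord _ (by omega)]
      exact this
    · rw [hpar', hord', hord _ (by omega), h.ord_idx w hw hw0]
      exact ⟨by omega, hA⟩

/-- Pigeonhole: `n + 1` vertices do not fit injectively into `i ≤ n` numbers. -/
theorem PartialNumbering.exists_unnumbered {n z i : ℕ} {A : ℕ → ℕ → Prop} {idx ord par : ℕ → ℕ}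
    (h : PartialNumbering n z i A idx ord par) (hi : i ≤ n) : ∃ v, v ≤ n ∧ idx v = 0 := by
  by_contra! hc
  have : Set.InjOn (fun v => idx v - 1) (Finset.range (n + 1) : Set ℕ) := by
    intro u hu v hv e
    simp only [Finset.coe_range, Set.mem_Iio] at hu hv e
    rw [← h.ord_idx u (by omega) (Nat.pos_of_ne_zero (hc u (by omega))),
      ← h.ord_idx v (by omega) (Nat.pos_of_ne_zero (hc v (by omega))), e]
  have hcard := Finset.card_le_card_of_injOn (s := Finset.range (n + 1)) (t := Finset.range i)
    (fun v => idx v - 1) (fun v hv => by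
      simp only [Finset.coe_range, Set.mem_Iio] at hv ⊢
      have h1 := h.idx_le v (by omega)
      have h2 := hc v (by omega)
      omega) this
  simp at hcard
  omega

/-! ### Complete numberings -/

section

variable {n : ℕ} {G : SimpleGraph (Fin (n + 1))} {z : ℕ} {idx ord par : ℕ → ℕ}
  {A : ℕ → ℕ → Prop} (hG : G.IsTree) (hA : ∀ u v : Fin (n + 1), G.Adj u v ↔ A u v)
  (h : PartialNumbering n z (n + 1) A idx ord par)
include h

theorem PartialNumbering.ord_lt_succ (k : ℕ) : ord k < n + 1 := by
  rcases Nat.lt_or_ge n k with hk | hk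
  · rw [h.ord_lt k hk]; omega
  · exact Nat.lt_succ_of_le (h.ord_le k (by omega))

theorem PartialNumbering.idx_pos (v : Fin (n + 1)) : 0 < idx v := by
  have hinj : Function.Injective fun k : Fin (n + 1) => (⟨ord k, h.ord_lt_succ k⟩ : Fin (n + 1)) :=
    by
    intro k k' e
    have h1 := h.idx_ord k k.2
    have h2 := h.idx_ord k' k'.2
    rw [Fin.mk.injEq] at e
    rw [e] at h1
    ext
    omega
  obtain ⟨k, rfl⟩ := Finite.injective_iff_surjective.1 hinj v
  have := h.idx_ord k k.2
  simp only
  omega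

include hG hA

/-- The `n` parent-child pairs are different edges of `G`, and a tree on `n + 1` vertices has
exactly `n` edges, so there are no others. -/
theorem PartialNumbering.isNumbering :
    IsNumbering G par (fun k => ⟨ord k, h.ord_lt_succ k⟩) fun v => idx v - 1 := by
  classical
  have hpm : IsParentMap par := by
    refine ⟨fun k hk => ?_, h.par_zero⟩
    rcases Nat.lt_or_ge n k with hk' | hk'
    · rw [h.par_lt k hk']; exact hk
    · exact (h.par k hk (by omega)).1
  have num_ord : ∀ k, k ≤ n → idx (ord k) - 1 = k := fun k hk => by
    rw [h.idx_ord k (by omega), Nat.add_sub_cancel]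
  have ord_num : ∀ v : Fin (n + 1), ord (idx v - 1) = v := fun v =>
    h.ord_idx v (by omega) (h.idx_pos v)
  have num_le : ∀ v : Fin (n + 1), idx v - 1 ≤ n := fun v => by
    have := h.idx_le v (by omega)
    omega
  let o : ℕ → Fin (n + 1) := fun k => ⟨ord k, h.ord_lt_succ k⟩
  have hedge : ∀ k, 0 < k → k ≤ n → G.Adj (o (par k)) (o k) := fun k h0 hk =>
    (hA _ _).2 (h.par k h0 (by omega)).2
  have himage : (Finset.Icc 1 n).image (fun k => s(o (par k), o k)) = G.edgeFinset := by
    apply Finset.eq_of_subset_of_card_le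
    · intro e he
      obtain ⟨k, hk, rfl⟩ := Finset.mem_image.1 he
      rw [Finset.mem_Icc] at hk
      rw [SimpleGraph.mem_edgeFinset, SimpleGraph.mem_edgeSet]
      exact hedge k (by omega) hk.2
    · rw [Finset.card_image_of_injOn]
      · have := hG.card_edgeFinset
        rw [Fintype.card_fin] at this
        simp
        omega
      · intro k hk k' hk' e
        simp only [Finset.coe_Icc, Set.mem_Icc] at hk hk'
        have ho : ∀ a b, a ≤ n → b ≤ n → o a = o b → a = b := fun a b ha hb e => by
          rw [← num_ord a ha, ← num_ord b hb]
          rw [Fin.mk.injEq] at e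
          rw [e]
        have l1 := hpm.lt k (by omega)
        have l2 := hpm.lt k' (by omega)
        rcases Sym2.eq_iff.1 e with ⟨-, e⟩ | ⟨e1, e2⟩
        · exact ho k k' hk.2 hk'.2 e
        · have := ho _ _ (by omega) (by omega) e1
          have := ho _ _ (by omega) (by omega) e2
          omega
  have heq : ∀ u : Fin (n + 1), o (idx u - 1) = u := fun u => Fin.ext (ord_num u)
  refine ⟨hpm, num_ord, heq, num_le, fun u v => ⟨fun hadj => ?_, ?_⟩⟩
  · have : s(u, v) ∈ (Finset.Icc 1 n).image fun k => s(o (par k), o k) := by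
      rw [himage, SimpleGraph.mem_edgeFinset]
      exact hadj
    obtain ⟨k, hk, e⟩ := Finset.mem_image.1 this
    rw [Finset.mem_Icc] at hk
    have l1 := hpm.lt k (by omega)
    have n1 : idx (ord k) - 1 = k := num_ord k hk.2
    have n2 : idx (ord (par k)) - 1 = par k := num_ord _ (by omega)
    rcases Sym2.eq_iff.1 e with ⟨rfl, rfl⟩ | ⟨rfl, rfl⟩
    · left
      simp only [o, n1, n2, and_true]
      omega
    · right
      simp only [o, n1, n2, and_true]
      omega
  · rintro (⟨h0, e⟩ | ⟨h0, e⟩)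
    · have := hedge _ h0 (num_le v)
      rwa [e, heq, heq] at this
    · have := hedge _ h0 (num_le u)
      rw [e, heq, heq] at this
      exact this.symm

/-- A child of the last vertex would have a larger number, so its parent is its only neighbour. -/
theorem PartialNumbering.isLeaf (hn : 1 ≤ n) : IsLeaf G ⟨ord n, h.ord_lt_succ n⟩ := by
  have hN := h.isNumbering hG hA
  have hlt := hN.isParentMap.lt n (by omega)
  have e : idx (ord n) - 1 = n := hN.num_ord n le_rfl
  have key : ∀ w : Fin (n + 1), G.Adj ⟨ord n, h.ord_lt_succ n⟩ w ↔ par n = idx w - 1 := by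
    intro w
    rw [G.adj_comm, hN.adj]
    simp only [e]
    constructor
    · rintro (h' | ⟨h0, h'⟩)
      · exact h'.2
      · have := hN.isParentMap.lt _ h0
        have := hN.num_le w
        omega
    · exact fun h' => Or.inl ⟨by omega, h'⟩
  refine ⟨⟨ord (par n), h.ord_lt_succ _⟩, (key _).2 ?_, fun w hw => ?_⟩
  · exact (hN.num_ord (par n) (by omega)).symm
  · have h1 := hN.ord_num w
    simp only [← (key w).1 hw] at h1
    exact h1.symm

end

/-- If the edge `7` leads from a numbered vertex to one that is not, take the latter for the number
`6`. -/
def scanEdge : Cmd :=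
  .ite (.and (.ilt (.lit 0) (.get 3 (.get 1 (ivar 7))))
      (.not (.ilt (.lit 0) (.get 3 (.get 2 (ivar 7))))))
    (.seq (.setI 4 (ivar 6) (.get 2 (ivar 7)))
      (.setI 5 (ivar 6) (.sub (.get 3 (.get 1 (ivar 7))) (.lit 1))))
    (.ite (.and (.ilt (.lit 0) (.get 3 (.get 2 (ivar 7))))
        (.not (.ilt (.lit 0) (.get 3 (.get 1 (ivar 7))))))
      (.seq (.setI 4 (ivar 6) (.get 1 (ivar 7)))
        (.setI 5 (ivar 6) (.sub (.get 3 (.get 2 (ivar 7))) (.lit 1)))) .skip)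

/-- Number the vertices, beginning with `z`. -/
def number (z : IExpr) : Cmd :=
  .seq (forLoop 8 (.lit 0) nPlusOne (.setI 3 (ivar 8) (.lit 0)))
  (.seq (.setI 4 (.lit 0) z)
  (.seq (.setI 3 (.get 4 (.lit 0)) (.lit 1))
  (forLoop 6 (.lit 1) nPlusOne
    (.seq (forLoop 7 (.lit 0) (ivar 0) scanEdge)
      (.setI 3 (.get 4 (ivar 6)) (.add (ivar 6) (.lit 1)))))))

/-- The `j`-th of the listed edges leads from `u` to `v`, in either order. -/
def Joins (e₁ e₂ : ℕ → ℕ) (j u v : ℕ) : Prop := (e₁ j = u ∧ e₂ j = v) ∨ (e₁ j = v ∧ e₂ j = u)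

/-- From `σ` to `τ`, only the arrays `3`, `4`, `5` and counters were changed. -/
structure KeepInput (σ τ : State) : Prop where
  ints : ∀ k, k < 3 → τ.ints k = σ.ints k
  reals : τ.reals = σ.reals
  out : τ.out = σ.out

theorem KeepInput.refl (σ : State) : KeepInput σ σ := ⟨fun _ _ => rfl, rfl, rfl⟩

theorem KeepInput.trans {σ τ υ : State} (h : KeepInput σ τ) (h' : KeepInput τ υ) :
    KeepInput σ υ :=
  ⟨fun k hk => (h'.ints k hk).trans (h.ints k hk), h'.reals.trans h.reals, h'.out.trans h.out⟩

theorem KeepInput.setInt {σ τ : State} (h : KeepInput σ τ) {k i x : ℕ} (hk : 3 ≤ k) :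
    KeepInput σ (τ.setInt k i x) :=
  ⟨fun k' hk' => by rw [State.setInt_ints_of_ne _ (by omega), h.ints k' hk'], h.reals, h.out⟩

/-- The result of the scan of the edges before `j`. -/
structure Scanned (σ : State) (i j : ℕ) (τ : State) : Prop where
  keep : KeepInput σ τ
  ints : ∀ k, k = 3 ∨ k = 6 → τ.ints k = σ.ints k
  ord : ∀ k, k ≠ i → τ.ints 4 k = σ.ints 4 k
  par : ∀ k, k ≠ i → τ.ints 5 k = σ.ints 5 k
  found : (∃ k u v, k < j ∧ Joins (σ.ints 1) (σ.ints 2) k u v ∧ 0 < σ.ints 3 u ∧ σ.ints 3 v = 0) →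
    ∃ k u v, k < j ∧ Joins (σ.ints 1) (σ.ints 2) k u v ∧ 0 < σ.ints 3 u ∧ σ.ints 3 v = 0 ∧
      τ.ints 4 i = v ∧ τ.ints 5 i = σ.ints 3 u - 1

theorem Scanned.setInt {σ τ : State} {i j x : ℕ} (h : Scanned σ i j τ) :
    Scanned σ i j (τ.setInt 7 0 x) := by
  obtain ⟨h1, h2, h3, h4, h5⟩ := h
  refine ⟨h1.setInt (by norm_num), fun k hk => ?_, fun k hk => ?_, fun k hk => ?_, ?_⟩
  · rw [State.setInt_ints_of_ne _ (by omega), h2 k hk]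
  · rw [State.setInt_ints_of_ne _ (by norm_num), h3 k hk]
  · rw [State.setInt_ints_of_ne _ (by norm_num), h4 k hk]
  · rw [State.setInt_ints_of_ne _ (by norm_num), State.setInt_ints_of_ne _ (by norm_num)]
    exact h5

theorem Scanned.take {σ τ : State} {i j u v : ℕ} (h : Scanned σ i j τ)
    (hj : Joins (σ.ints 1) (σ.ints 2) j u v) (hu : 0 < σ.ints 3 u) (hv : σ.ints 3 v = 0) :
    Scanned σ i (j + 1) ((τ.setInt 4 i v).setInt 5 i (σ.ints 3 u - 1)) := by
  obtain ⟨h1, h2, h3, h4, -⟩ := h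
  refine ⟨(h1.setInt (by norm_num)).setInt (by norm_num), fun k hk => ?_, fun k hk => ?_,
    fun k hk => ?_, fun _ => ⟨j, u, v, Nat.lt_succ_self j, hj, hu, hv, ?_, ?_⟩⟩
  · rw [State.setInt_ints_of_ne _ (by omega), State.setInt_ints_of_ne _ (by omega), h2 k hk]
  · rw [State.setInt_ints_of_ne _ (by norm_num), State.setInt_ints_of_ne' _ hk, h3 k hk]
  · rw [State.setInt_ints_of_ne' _ hk, State.setInt_ints_of_ne _ (by norm_num), h4 k hk]
  · rw [State.setInt_ints_of_ne _ (by norm_num), State.setInt_ints_self]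
  · rw [State.setInt_ints_self]

theorem Scanned.pass {σ τ : State} {i j : ℕ} (h : Scanned σ i j τ)
    (hj : ∀ u v, Joins (σ.ints 1) (σ.ints 2) j u v → 0 < σ.ints 3 u → σ.ints 3 v ≠ 0) :
    Scanned σ i (j + 1) τ := by
  refine ⟨h.keep, h.ints, h.ord, h.par, ?_⟩
  rintro ⟨k, u, v, hk, hk', hu, hv⟩
  rcases Nat.lt_succ_iff_lt_or_eq.1 hk with h' | rfl
  · obtain ⟨k, u, v, h1, h2⟩ := h.found ⟨k, u, v, h', hk', hu, hv⟩
    exact ⟨k, u, v, h1.trans (Nat.lt_succ_self _), h2⟩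
  · exact absurd hv (hj u v hk' hu)

/-! ### Correctness of the numbering -/

section

variable {S n : ℕ} (hS : n + 1 ≤ S)
include hS

/-- Several edges may lead out of the numbered part; each overwrites the choice of the one before,
and any choice is good. -/
theorem does_scan {σ : State} {i : ℕ} (hn : σ.ints 0 0 = n) (hi : σ.ints 6 0 = i) (hin : i ≤ n)
    (h1 : ∀ j, j < n → σ.ints 1 j ≤ n) (h2 : ∀ j, j < n → σ.ints 2 j ≤ n)
    (hidx : ∀ v, v ≤ n → σ.ints 3 v ≤ n + 1) :
    Does S (forLoop 7 (.lit 0) (ivar 0) scanEdge) σ (6 * n + 2) (Scanned σ i n) := by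
  have hS0 : 0 < S := by omega
  refine (does_forLoop_const (I := Scanned σ i) (a := 0) (N := n) 4 rfl (Nat.zero_le _) (by omega)
    hS0 ?_ ?_ ?_ fun τ h => h).mono (T := (n - 0) * (4 + 2) + 2) (by simp; omega) fun _ h => h
  · rintro j τ h
    rw [eval_ivar, h.keep.ints 0 (by norm_num), hn]
  · exact Scanned.setInt ⟨KeepInput.refl _, fun _ _ => rfl, fun _ _ => rfl, fun _ _ => rfl,
      fun ⟨k, _, _, hk, _⟩ => absurd hk (Nat.not_lt_zero k)⟩
  · rintro j τ - hj h hk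
    have e1 : τ.ints 1 = σ.ints 1 := h.keep.ints 1 (by norm_num)
    have e2 : τ.ints 2 = σ.ints 2 := h.keep.ints 2 (by norm_num)
    have e3 : τ.ints 3 = σ.ints 3 := h.ints 3 (by norm_num)
    have e6 : τ.ints 6 0 = i := by rw [h.ints 6 (by norm_num), hi]
    have b1 := h1 j hj
    have b2 := h2 j hj
    have b3 := hidx _ b1
    have b4 := hidx _ b2
    have take : ∀ u v, Joins (σ.ints 1) (σ.ints 2) j u v → 0 < σ.ints 3 u → σ.ints 3 v = 0 →
        ((τ.setInt 4 i v).setInt 5 i (σ.ints 3 u - 1)).ints 7 0 = j ∧ Scanned σ i (j + 1)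
          (((τ.setInt 4 i v).setInt 5 i (σ.ints 3 u - 1)).setInt 7 0 (j + 1)) := by
      intro u v huv hu hv
      refine ⟨?_, (h.take huv hu hv).setInt⟩
      rw [State.setInt_ints_of_ne _ (by norm_num), State.setInt_ints_of_ne _ (by norm_num), hk]
    refine does_ite (T := 3) (fun hc => ?_) fun hc => ?_
    · simp only [BExpr.Holds, IExpr.eval, eval_ivar, hk, e1, e2, e3] at hc
      refine (Does.seq (T := 1) (T' := 1) (Q' := fun υ => υ = τ.setInt 4 i (σ.ints 2 j))
        (does_setI ?_ ?_ ?_) ?_).mono (by norm_num) fun _ h => h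
      · rw [eval_ivar, e6]; omega
      · simp only [IExpr.eval, eval_ivar, hk, e2]; omega
      · simp only [IExpr.eval, eval_ivar, hk, e2, e6]
      rintro _ rfl
      have e : ∀ k, k ≠ 4 → (τ.setInt 4 i (σ.ints 2 j)).ints k = τ.ints k := fun k hk =>
        State.setInt_ints_of_ne _ hk
      refine does_setI ?_ ?_ ?_
      · rw [eval_ivar, e 6 (by norm_num), e6]; omega
      · simp only [IExpr.eval, eval_ivar, e 7 (by norm_num), e 1 (by norm_num), e 3 (by norm_num),
          hk, e1, e3]
        omega
      · simp only [IExpr.eval, eval_ivar, e 7 (by norm_num), e 1 (by norm_num), e 3 (by norm_num),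
          e 6 (by norm_num), hk, e1, e3, e6]
        exact take _ _ (Or.inl ⟨rfl, rfl⟩) hc.1 (by omega)
    · simp only [BExpr.Holds, IExpr.eval, eval_ivar, hk, e1, e2, e3] at hc
      refine does_ite (T := 2) (fun hc' => ?_) fun hc' => ?_
      · simp only [BExpr.Holds, IExpr.eval, eval_ivar, hk, e1, e2, e3] at hc'
        refine Does.seq (T := 1) (T' := 1) (Q' := fun υ => υ = τ.setInt 4 i (σ.ints 1 j))
          (does_setI ?_ ?_ ?_) ?_
        · rw [eval_ivar, e6]; omega
        · simp only [IExpr.eval, eval_ivar, hk, e1]; omega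
        · simp only [IExpr.eval, eval_ivar, hk, e1, e6]
        rintro _ rfl
        have e : ∀ k, k ≠ 4 → (τ.setInt 4 i (σ.ints 1 j)).ints k = τ.ints k := fun k hk =>
          State.setInt_ints_of_ne _ hk
        refine does_setI ?_ ?_ ?_
        · rw [eval_ivar, e 6 (by norm_num), e6]; omega
        · simp only [IExpr.eval, eval_ivar, e 7 (by norm_num), e 2 (by norm_num),
            e 3 (by norm_num), hk, e2, e3]
          omega
        · simp only [IExpr.eval, eval_ivar, e 7 (by norm_num), e 2 (by norm_num),
            e 3 (by norm_num), e 6 (by norm_num), hk, e2, e3, e6]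
          exact take _ _ (Or.inr ⟨rfl, rfl⟩) hc'.1 (by omega)
      · simp only [BExpr.Holds, IExpr.eval, eval_ivar, hk, e1, e2, e3] at hc'
        refine (does_skip ⟨hk, (h.pass ?_).setInt⟩).mono (T' := 2) (by norm_num) fun _ h => h
        rintro u v (⟨rfl, rfl⟩ | ⟨rfl, rfl⟩) hu hv
        · exact hc ⟨hu, by omega⟩
        · exact hc' ⟨hu, by omega⟩

/-- Connectedness enters as the cut property `hconn`: while some vertex is unnumbered, a listed edge
leaves the numbered part, so every scan succeeds. The start `z` may depend only on arrays `0` and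
`4`, which are intact when it is evaluated, whereas array `3` has been cleared by then. -/
theorem does_number {σ : State} {z : IExpr} {z₀ : ℕ} (hn : σ.ints 0 0 = n)
    (h1 : ∀ j, j < n → σ.ints 1 j ≤ n) (h2 : ∀ j, j < n → σ.ints 2 j ≤ n)
    (hz : ∀ τ : State, τ.ints 0 = σ.ints 0 → τ.ints 4 = σ.ints 4 → z.eval τ = z₀) (hzn : z₀ ≤ n)
    (hord : ∀ k, n < k → σ.ints 4 k = 0) (hpar : ∀ k, n < k → σ.ints 5 k = 0)
    (hpar0 : σ.ints 5 0 = 0)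
    (hconn : ∀ s : Set ℕ, z₀ ∈ s → (∃ v, v ≤ n ∧ v ∉ s) → ∃ j u v, j < n ∧
      Joins (σ.ints 1) (σ.ints 2) j u v ∧ u ∈ s ∧ v ∉ s) :
    Does S (number z) σ (6 * n ^ 2 + 8 * n + 9) fun τ => KeepInput σ τ ∧
      PartialNumbering n z₀ (n + 1) (fun u v => ∃ j, j < n ∧ Joins (σ.ints 1) (σ.ints 2) j u v)
        (τ.ints 3) (τ.ints 4) (τ.ints 5) := by
  have hS0 : 0 < S := by omega
  let A : ℕ → ℕ → Prop := fun u v => ∃ j, j < n ∧ Joins (σ.ints 1) (σ.ints 2) j u v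
  let I₀ : ℕ → State → Prop := fun j τ => KeepInput σ τ ∧ τ.ints 4 = σ.ints 4 ∧
    τ.ints 5 = σ.ints 5 ∧ ∀ v, v < j → τ.ints 3 v = 0
  let I : ℕ → State → Prop := fun i τ => KeepInput σ τ ∧
    PartialNumbering n z₀ i A (τ.ints 3) (τ.ints 4) (τ.ints 5)
  refine (Does.seq (does_forLoop_const (I := I₀) (Q := I₀ (n + 1)) (a := 0) (N := n + 1) 1 rfl
    (Nat.zero_le _) hS hS0 ?_ ?_ ?_ fun τ h => h) ?_).mono
    (T := ((n + 1 - 0) * (1 + 2) + 2) + (1 + (1 + ((n + 1 - 1) * ((6 * n + 3) + 2) + 2))))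
    ?_ fun _ h => h
  · rintro j τ ⟨k, -⟩
    simp [nPlusOne, IExpr.eval, k.ints 0 (by norm_num), hn]
  · refine ⟨(KeepInput.refl _).setInt (by norm_num), ?_, ?_, fun v hv => absurd hv
      (Nat.not_lt_zero v)⟩
    · exact State.setInt_ints_of_ne _ (by norm_num)
    · exact State.setInt_ints_of_ne _ (by norm_num)
  · rintro j τ - hj ⟨k1, k2, k3, k4⟩ hk
    refine does_setI (by rw [eval_ivar, hk]; omega) (Nat.zero_le _) ?_
    simp only [eval_ivar, hk, eval_lit]
    refine ⟨?_, (k1.setInt le_rfl).setInt (by norm_num), ?_, ?_, fun v hv => ?_⟩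
    · rw [State.setInt_ints_of_ne _ (by norm_num), hk]
    · rw [State.setInt_ints_of_ne _ (by norm_num), State.setInt_ints_of_ne _ (by norm_num), k2]
    · rw [State.setInt_ints_of_ne _ (by norm_num), State.setInt_ints_of_ne _ (by norm_num), k3]
    · rw [State.setInt_ints_of_ne _ (by norm_num)]
      by_cases hvj : v = j
      · rw [hvj, State.setInt_ints_self]
      · rw [State.setInt_ints_of_ne' _ hvj, k4 v (by omega)]
  rotate_left
  · simp only [Nat.sub_zero, Nat.add_sub_cancel]
    apply le_of_eq
    ring
  rintro τ ⟨k1, k2, k3, k4⟩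
  have hzτ := hz τ (k1.ints 0 (by norm_num)) k2
  refine Does.seq (T := 1) (Q' := fun υ => υ = τ.setInt 4 0 z₀) (does_setI hS0 ?_ ?_) ?_
  · rw [hzτ]; omega
  · rw [hzτ]; rfl
  rintro _ rfl
  refine Does.seq (T := 1) (Q' := fun υ => υ = (τ.setInt 4 0 z₀).setInt 3 z₀ 1)
    (does_setI ?_ ?_ ?_) ?_
  · simp only [IExpr.eval, State.setInt_ints_self]; omega
  · simp only [IExpr.eval]; omega
  · simp only [IExpr.eval, State.setInt_ints_self]
  rintro _ rfl
  refine does_forLoop_const (I := I) (a := 1) (N := n + 1) (6 * n + 3) rfl (by omega) hS hS0 ?_ ?_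
    ?_ fun τ h => h
  · rintro j τ ⟨k, -⟩
    simp [nPlusOne, IExpr.eval, k.ints 0 (by norm_num), hn]
  · obtain ⟨υ, hυ⟩ : ∃ υ, υ = ((τ.setInt 4 0 z₀).setInt 3 z₀ 1).setInt 6 0 1 := ⟨_, rfl⟩
    have e3 : υ.ints 3 z₀ = 1 := by
      rw [hυ, State.setInt_ints_of_ne _ (by norm_num), State.setInt_ints_self]
    have e3' : ∀ v, v ≤ n → v ≠ z₀ → υ.ints 3 v = 0 := fun v hv hne => by
      rw [hυ, State.setInt_ints_of_ne _ (by norm_num), State.setInt_ints_of_ne' _ hne,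
        State.setInt_ints_of_ne _ (by norm_num), k4 v (by omega)]
    have e4 : υ.ints 4 0 = z₀ := by
      rw [hυ, State.setInt_ints_of_ne _ (by norm_num), State.setInt_ints_of_ne _ (by norm_num),
        State.setInt_ints_self]
    have e4' : ∀ k, k ≠ 0 → υ.ints 4 k = σ.ints 4 k := fun k hk => by
      rw [hυ, State.setInt_ints_of_ne _ (by norm_num), State.setInt_ints_of_ne _ (by norm_num),
        State.setInt_ints_of_ne' _ hk, k2]
    have e5 : υ.ints 5 = σ.ints 5 := by
      rw [hυ, State.setInt_ints_of_ne _ (by norm_num), State.setInt_ints_of_ne _ (by norm_num),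
        State.setInt_ints_of_ne _ (by norm_num), k3]
    rw [← hυ]
    refine ⟨hυ ▸ ((k1.setInt (by norm_num)).setInt (by norm_num)).setInt (by norm_num), e4,
      e5 ▸ hpar0, fun k hk => ?_, fun k hk => ?_, fun k hk => ?_, fun k hk => ?_, fun v hv => ?_,
      fun v hv h0 => ?_, fun k h0 hk => ?_⟩
    · rw [e4' k (by omega), hord k hk]
    · rw [e5, hpar k hk]
    · obtain rfl : k = 0 := by omega
      rw [e4]; exact hzn
    · obtain rfl : k = 0 := by omega
      rw [e4, e3]
    · by_cases hvz : v = z₀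
      · rw [hvz, e3]
      · rw [e3' v hv hvz]; exact Nat.zero_le _
    · by_cases hvz : v = z₀
      · rw [hvz, e3, Nat.sub_self, e4]
      · rw [e3' v hv hvz] at h0
        exact absurd h0 (lt_irrefl _)
    · omega
  · rintro i τ h0 hi ⟨k, hP⟩ hk
    have hin : i ≤ n := by omega
    have e1 : τ.ints 1 = σ.ints 1 := k.ints 1 (by norm_num)
    have e2 : τ.ints 2 = σ.ints 2 := k.ints 2 (by norm_num)
    refine Does.seq (T := 6 * n + 2) (T' := 1) (does_scan hS
      (by rw [k.ints 0 (by norm_num), hn]) hk hin (by rwa [e1]) (by rwa [e2])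
      fun v hv => (hP.idx_le v hv).trans (by omega)) ?_
    intro υ hυ
    obtain ⟨v₀, hv₀, hv₀'⟩ := hP.exists_unnumbered hin
    have hz0 := hP.idx_ord 0 h0
    rw [hP.ord_zero] at hz0
    obtain ⟨j, u, v, hj, hjuv, hu, hv⟩ := hconn {v | 0 < τ.ints 3 v}
      (by simp only [Set.mem_ofPred_eq, hz0]; omega)
      ⟨v₀, hv₀, by simp only [Set.mem_ofPred_eq]; omega⟩
    simp only [Set.mem_ofPred_eq] at hu hv
    obtain ⟨j, u, v, hj, hjuv, hu, hv, f4, f5⟩ := hυ.found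
      ⟨j, u, v, hj, by rw [e1, e2]; exact hjuv, hu, by omega⟩
    rw [e1, e2] at hjuv
    have huv : u ≤ n ∧ v ≤ n := by
      have g1 := h1 j hj
      have g2 := h2 j hj
      rcases hjuv with ⟨rfl, rfl⟩ | ⟨rfl, rfl⟩
      · exact ⟨g1, g2⟩
      · exact ⟨g2, g1⟩
    have e6 : υ.ints 6 0 = i := by rw [hυ.ints 6 (by norm_num), hk]
    have e3 : υ.ints 3 = τ.ints 3 := hυ.ints 3 (by norm_num)
    refine does_setI ?_ ?_ ?_
    · simp only [IExpr.eval, eval_ivar, e6, f4]; omega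
    · simp only [IExpr.eval, eval_ivar, e6]; omega
    simp only [IExpr.eval, eval_ivar, e6, f4]
    refine ⟨by rw [State.setInt_ints_of_ne _ (by norm_num), e6],
      ((k.trans hυ.keep).setInt le_rfl).setInt (by norm_num), ?_⟩
    refine hP.succ (u := v) (w := u) h0 hin huv.2 hv huv.1 hu ⟨j, hj, hjuv⟩ ?_ ?_ ?_ ?_ ?_ ?_
    · intro v' hv'
      rw [State.setInt_ints_of_ne _ (by norm_num), State.setInt_ints_of_ne' _ hv', e3]
    · rw [State.setInt_ints_of_ne _ (by norm_num), State.setInt_ints_self]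
    · intro k' hk'
      rw [State.setInt_ints_of_ne _ (by norm_num), State.setInt_ints_of_ne _ (by norm_num),
        hυ.ord k' hk']
    · rw [State.setInt_ints_of_ne _ (by norm_num), State.setInt_ints_of_ne _ (by norm_num), f4]
    · intro k' hk'
      rw [State.setInt_ints_of_ne _ (by norm_num), State.setInt_ints_of_ne _ (by norm_num),
        hυ.par k' hk']
    · rw [State.setInt_ints_of_ne _ (by norm_num), State.setInt_ints_of_ne _ (by norm_num), f5]

/-- Copy the coordinates of the vertices, in the order of their numbers. -/
def copyPos : Cmd := forLoop 8 (.lit 0) nPlusOne (setV 40 (ivar 8) (vget 0 (.get 4 (ivar 8))))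

theorem does_copyPos {σ : State} (hn : σ.ints 0 0 = n) :
    Does S copyPos σ (10 * n + 12) fun τ => (∀ k, k ≠ 8 → τ.ints k = σ.ints k) ∧ τ.out = σ.out ∧
      ∀ k, k ≤ n → vecAt τ 40 k = vecAt σ 0 (σ.ints 4 k) := by
  have hS0 : 0 < S := by omega
  let I : ℕ → State → Prop := fun j τ => (∀ k, k ≠ 8 → τ.ints k = σ.ints k) ∧ τ.out = σ.out ∧
    (∀ i, vecAt τ 0 i = vecAt σ 0 i) ∧ ∀ k, k < j → vecAt τ 40 k = vecAt σ 0 (σ.ints 4 k)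
  refine (does_forLoop_const (I := I) (a := 0) (N := n + 1) 8 rfl (Nat.zero_le _) hS hS0 ?_ ?_ ?_
    ?_).mono (T := (n + 1 - 0) * (8 + 2) + 2) (by omega) fun _ h => h
  · rintro j τ ⟨k, -⟩
    simp [nPlusOne, IExpr.eval, k 0 (by norm_num), hn]
  · exact ⟨fun k hk => State.setInt_ints_of_ne _ hk, rfl, fun _ => rfl,
      fun k hk => absurd hk (Nat.not_lt_zero k)⟩
  · rintro j τ - hj ⟨k1, k2, k3, k4⟩ hk
    refine does_setV ?_ (by norm_num) (by rw [eval_ivar, hk]; omega) fun υ hυ => ?_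
    · refine VExpr.isLow_of_eval fun σ τ hi _ h => ?_
      simp [h, hi, IExpr.eval]
    rw [eval_ivar, hk] at hυ
    refine ⟨by rw [hυ.ints, hk], fun k hk => ?_, hυ.out.trans k2, fun i => ?_, fun k hkj => ?_⟩
    · rw [State.setInt_ints_of_ne _ hk, hυ.ints, k1 k hk]
    · change vecAt υ 0 i = _
      rw [hυ.vecAt _ _ (by norm_num) (by norm_num), k3]
    · change vecAt υ 40 k = _
      by_cases hkj' : k = j
      · rw [hkj', hυ.vec, eval_vget, IExpr.eval, eval_ivar, hk, k3, k1 4 (by norm_num)]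
      · rw [hυ.vec_ne k hkj', k4 k (by omega)]
  · rintro τ ⟨k1, k2, -, k4⟩
    exact ⟨k1, k2, fun k hk => k4 k (by omega)⟩

end

/-- The algorithm: number the vertices from an arbitrary one, then from the last one, which is a
leaf, and straighten the tree. -/
def program : Cmd :=
  .seq (number (.lit 0)) (.seq (number (.get 4 (ivar 0))) (.seq copyPos straighten))

/-! ### The complete algorithm -/

section

variable {n : ℕ} {G : SimpleGraph (Fin (n + 1))} {edges : Fin n → Fin (n + 1) × Fin (n + 1)}
  {p : Fin (n + 1) → E4}

theorem input_ints_one (j : ℕ) (hj : j < n) :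
    (input edges p).ints 1 j = ((edges ⟨j, hj⟩).1 : ℕ) := by
  simp [input, hj]

theorem input_ints_two (j : ℕ) (hj : j < n) :
    (input edges p).ints 2 j = ((edges ⟨j, hj⟩).2 : ℕ) := by
  simp [input, hj]

theorem input_ints_of_lt (k i : ℕ) (hk : 2 < k) : (input edges p).ints k i = 0 := by
  simp only [input]
  rw [if_neg (by omega)]
  split_ifs <;> first | rfl | omega

theorem vecAt_input (v : Fin (n + 1)) : vecAt (input edges p) 0 v = p v := by
  ext j
  have : (j : ℕ) < 4 := j.2
  simp [vecAt, input]
  intro h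
  omega

theorem adj_iff_joins (hE : IsEdgeList G edges) (u v : Fin (n + 1)) :
    G.Adj u v ↔ ∃ j, j < n ∧ Joins ((input edges p).ints 1) ((input edges p).ints 2) j u v := by
  rw [hE]
  constructor
  · rintro ⟨i, h⟩
    refine ⟨i, i.2, ?_⟩
    rw [Joins, input_ints_one _ i.2, input_ints_two _ i.2]
    rcases h with h | h
    · left; rw [Fin.eta, h]; exact ⟨rfl, rfl⟩
    · right; rw [Fin.eta, h]; exact ⟨rfl, rfl⟩
  · rintro ⟨j, hj, h⟩
    refine ⟨⟨j, hj⟩, ?_⟩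
    rw [Joins, input_ints_one _ hj, input_ints_two _ hj] at h
    rcases h with ⟨h1, h2⟩ | ⟨h1, h2⟩
    · exact Or.inl (Prod.ext (Fin.ext h1) (Fin.ext h2))
    · exact Or.inr (Prod.ext (Fin.ext h1) (Fin.ext h2))

theorem exists_joins (hG : G.IsTree) (hE : IsEdgeList G edges) {z : ℕ} (hz : z ≤ n) (s : Set ℕ)
    (hzs : z ∈ s) (hs : ∃ v, v ≤ n ∧ v ∉ s) : ∃ j u v, j < n ∧
      Joins ((input edges p).ints 1) ((input edges p).ints 2) j u v ∧ u ∈ s ∧ v ∉ s := by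
  obtain ⟨v, hv, hvs⟩ := hs
  obtain ⟨w⟩ := hG.connected.preconnected ⟨z, Nat.lt_succ_of_le hz⟩ ⟨v, Nat.lt_succ_of_le hv⟩
  obtain ⟨d, -, h1, h2⟩ := w.exists_boundary_dart (Fin.val ⁻¹' s) hzs hvs
  obtain ⟨j, hj, h⟩ := (adj_iff_joins (p := p) hE _ _).1 d.adj
  exact ⟨j, _, _, hj, h, h1, h2⟩

theorem does_program (hn : 1 ≤ n) {S : ℕ} (hS : n + 1 ≤ S) (hG : G.IsTree)
    (hE : IsEdgeList G edges) (hs : IsSimple G p) :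
    Does S program (input edges p) (437 * n ^ 2 + 178 * n + 32) fun τ =>
      ∃ moves : List (Move (Fin (n + 1))), τ.out = moves.map (Move.rename Fin.val) ∧
        moves.length ≤ 4 * n ∧ Straightens G p moves := by
  obtain ⟨σ, hσ⟩ : ∃ σ, σ = input edges p := ⟨_, rfl⟩
  have hadj : ∀ u v : Fin (n + 1), G.Adj u v ↔
      ∃ j, j < n ∧ Joins (σ.ints 1) (σ.ints 2) j u v := hσ ▸ adj_iff_joins hE
  have hconn : ∀ z, z ≤ n → ∀ s : Set ℕ, z ∈ s → (∃ v, v ≤ n ∧ v ∉ s) → ∃ j u v, j < n ∧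
      Joins (σ.ints 1) (σ.ints 2) j u v ∧ u ∈ s ∧ v ∉ s := fun z hz =>
    hσ ▸ exists_joins hG hE hz
  have h0 : σ.ints 0 0 = n := by rw [hσ]; simp [input]
  have h1 : ∀ j, j < n → σ.ints 1 j ≤ n := fun j hj => by
    rw [hσ, input_ints_one j hj]; omega
  have h2 : ∀ j, j < n → σ.ints 2 j ≤ n := fun j hj => by
    rw [hσ, input_ints_two j hj]; omega
  have h3 : ∀ k i, 2 < k → σ.ints k i = 0 := fun k i hk => by rw [hσ, input_ints_of_lt k i hk]
  have hout : σ.out = [] := by rw [hσ]; rfl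
  have hvec : ∀ v : Fin (n + 1), vecAt σ 0 v = p v := fun v => by rw [hσ, vecAt_input]
  rw [← hσ]
  refine (Does.seq (does_number hS (z := .lit 0) (z₀ := 0) h0 h1 h2 (fun _ _ _ => rfl)
    (Nat.zero_le _) (fun k _ => h3 4 k (by norm_num)) (fun k _ => h3 5 k (by norm_num))
    (h3 5 0 (by norm_num)) (hconn 0 (Nat.zero_le _))) ?_).mono
    (T := (6 * n ^ 2 + 8 * n + 9) + ((6 * n ^ 2 + 8 * n + 9) + ((10 * n + 12) +
      (425 * n ^ 2 + 152 * n + 2)))) (by apply le_of_eq; ring) fun _ h => h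
  rintro τ ⟨k1, n1⟩
  have t0 : τ.ints 0 0 = n := by rw [k1.ints 0 (by norm_num), h0]
  have t1 : τ.ints 1 = σ.ints 1 := k1.ints 1 (by norm_num)
  have t2 : τ.ints 2 = σ.ints 2 := k1.ints 2 (by norm_num)
  have hz := n1.ord_le n (Nat.lt_succ_self n)
  -- The new root is the last vertex of the first numbering, hence a leaf. The zero cells beyond `n`
  -- left by the first run are what the second one needs.
  refine Does.seq (does_number hS (z := .get 4 (ivar 0)) (z₀ := τ.ints 4 n) t0 (by rwa [t1])
    (by rwa [t2]) (fun υ e0 e4 => by rw [IExpr.eval, eval_ivar, e0, e4, t0]) hz n1.ord_lt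
    n1.par_lt n1.par_zero (by rw [t1, t2]; exact hconn _ hz)) ?_
  rintro υ ⟨k2, n2⟩
  rw [t1, t2] at n2
  have u0 : υ.ints 0 0 = n := by rw [k2.ints 0 (by norm_num), t0]
  refine Does.seq (does_copyPos hS u0) ?_
  rintro φ ⟨w1, w2, w3⟩
  have hN := n2.isNumbering hG hadj
  have hleaf : IsLeaf G ⟨υ.ints 4 0, n2.ord_lt_succ 0⟩ := by
    have := n1.isLeaf hG hadj hn
    simpa only [n2.ord_zero] using this
  have hP : ∀ v : Fin (n + 1), vecAt φ 40 (υ.ints 3 v - 1) = p v := fun v => by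
    have e : υ.ints 4 (υ.ints 3 v - 1) = v := congrArg Fin.val (hN.ord_num v)
    rw [w3 _ (hN.num_le v), e, ← hvec]
    simp only [vecAt, k2.reals, k1.reals]
  have hp := hN.isParentMap
  refine (does_straighten hS hp n2.par_lt (by rw [w1 0 (by norm_num), u0]) (w1 5 (by norm_num))
    (w1 4 (by norm_num)) (by rw [w2, k2.out, k1.out, hout]) (hN.inv_of_isSimple hs hP)).mono
    le_rfl ?_
  rintro ψ ⟨ms, P', g1, g2, g3⟩
  refine ⟨_, ?_, ?_, hN.straightens hG.connected hleaf hs hP g1 fun v _ h => h⟩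
  · rw [g3, List.map_map]
    rfl
  · rwa [List.length_map]

end

end

end TreeStraightening

theorem theorem2 :
    ∃ (prog : TreeStraightening.Cmd) (C : ℕ),
      ∀ (n : ℕ), 1 ≤ n →
      ∀ (G : SimpleGraph (Fin (n + 1))) (edges : Fin n → Fin (n + 1) × Fin (n + 1))
        (p : Fin (n + 1) → E4),
        G.IsTree → TreeStraightening.IsEdgeList G edges → TreeStraightening.IsSimple G p →
        ∃ (T : ℕ) (final : TreeStraightening.State)
          (moves : List (TreeStraightening.Move (Fin (n + 1)))),
          TreeStraightening.Exec (C * n) prog (TreeStraightening.input edges p) T final ∧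
          T ≤ C * n ^ 2 ∧
          final.out = moves.map (TreeStraightening.Move.rename Fin.val) ∧
          moves.length ≤ C * n ∧
          TreeStraightening.Straightens G p moves := by
  -- `647 = 437 + 178 + 32` is the sum of the coefficients of the time bound, since `n ≥ 1`; it is
  -- ample for the space and the number of moves.
  refine ⟨TreeStraightening.program, 647, fun n hn G edges p hG hE hs => ?_⟩
  obtain ⟨T, final, h, hT, moves, hout, hlen, hst⟩ :=
    TreeStraightening.does_program hn (S := 647 * n) (by omega) hG hE hs
  refine ⟨T, final, moves, h, hT.trans ?_, hout, by omega, hst⟩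
  nlinarith
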